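/- Let $c>0$ and let $\Gamma$ be a regular rooted metric tree with generating sequences $\{b_n\}_{n\ge 0}$ and $\{t_n\}_{n\ge 0}$: a vertex $v$ that has $n$ vertices strictly before it on the path from the root $o$ (generation $n$) is the starting point of exactly $b_n$ edges and has distance $t_n$ from the root. Assume $b_0=1$, $b_n\ge 2$ for $n\ge 1$, and that the total length $|\Gamma|=\sum_e|e|$ is infinite. Then $t_0=0$ and $\{t_n\}$ is strictly increasing; put $h(\Gamma)=\sup_n t_n\le\infty$. Let $\alpha=\begin{pmatrix}0&-i\\ i&0\end{pmatrix}$, $\beta=\begin{pmatrix}1&0\\0&-1\end{pmatrix}$. The Dirac operator $D_c$ acts in $L^2(\Gamma)\otimes\mathbb C^2$ by $D_cf=\alpha\frac{c}{i}f'+c^2\beta f$ on every edge (parametrized in the direction away from the root). Its domain consists of all $f=(f_1,f_2)\in L^2(\Gamma)\otimes\mathbb C^2$ that are $H^1$ on every edge, with $\sum_e\int_e|f'|^2<\infty$, such that $f_1(o)=0$ and, at every vertex $v\ne o$, $f_1$ is continuous and the sum of the boundary values at $v$ of $f_2$ on the edges that start at $v$ equals the boundary value at $v$ of $f_2$ on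 the edge that ends at $v$. For $k\ge 0$ the operator $M_k$ acts in $L^2(t_k,h(\Gamma))\otimes\mathbb C^2$ by $M_k\psi=\alpha\frac{c}{i}\psi'+c^2\beta\psi$ away from the points $t_j$. Its domain consists of all $\psi=(\psi_1,\psi_2)\in L^2(t_k,h(\Gamma))\otimes\mathbb C^2$ that are $H^1$ on every interval $(t_{j-1},t_j)$, $j>k$, with $\sum_{j>k}\int_{t_{j-1}}^{t_j}|\psi'|^2\,dt<\infty$, and satisfy $$\psi_1(t_k+)=0,\qquad \begin{pmatrix}\psi_1(t_j+)\\-\psi_2(t_j+)\end{pmatrix}=\begin{pmatrix}b_j^{1/2}&0\\0&-b_j^{-1/2}\end{pmatrix}\begin{pmatrix}\psi_1(t_j-)\\ \psi_2(t_j-)\end{pmatrix}\quad(j>k).$$ The operators $D_c$ and $M_k$ are self-adjoint. For $A=D_c$ and $A=M_k$, $k\ge0$, there is exactly one closed subspace that reduces $A$ and is such that $(f,Af)>0$ for all nonzero $f\in\mathrm{Dom}\,A$ in it and $(f,Af)\le0$ for all $f\in\mathrm{Dom}\,A$ orthogonal to it; let $\chi_{(0,\infty)}(A)$ be the orthogonal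 projection onto it. Put $B_c=\chi_{(0,\infty)}(D_c)D_c$ and $M_k^+=\chi_{(0,\infty)}(M_k)M_k$. Then $$B_c\;\sim\; M_0^+\oplus\bigoplus_{k=1}^{\infty}\bigl(M_k^+\bigr)^{[b_0\cdots b_{k-1}(b_k-1)]},$$ where $\sim$ denotes unitary equivalence and $A^{[r]}$ the orthogonal sum of $r$ copies of $A$. This holds both when every positive part is regarded as an operator in the range of its projection $\chi_{(0,\infty)}$ and when it is regarded as a self-adjoint operator in the whole $L^2$ space, extended by zero to the orthogonal complement of that range. -/

import Mathlib

open MeasureTheory Set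
open scoped InnerProductSpace ENNReal

universe u

noncomputable section

/-! ### Unbounded operators in Hilbert spaces -/

section Operators

variable {H : Type*} [NormedAddCommGroup H] [InnerProductSpace ℂ H]
variable {H' : Type*} [NormedAddCommGroup H'] [InnerProductSpace ℂ H']

/-- Two (possibly unbounded) operators are unitarily equivalent if some unitary operator
between the two Hilbert spaces maps the graph of the first onto the graph of the second. -/
def UnitarilyEquivalent (A : H →ₗ.[ℂ] H) (B : H' →ₗ.[ℂ] H') : Prop :=
  ∃ U : H ≃ₗᵢ[ℂ] H', ∀ x y : H, (x, y) ∈ A.graph ↔ (U x, U y) ∈ B.graph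

/-- The closed subspace `K` is the range of the spectral projection `χ_{(0,∞)}(A)` of the
self-adjoint operator `A`: it reduces `A`, and `(f, A f)` is positive for the nonzero `f` of the
domain that lie in `K` and nonpositive for the `f` of the domain orthogonal to `K`. -/
structure IsPositiveSpectralSubspace (A : H →ₗ.[ℂ] H) (K : Submodule ℂ H) : Prop where
  isClosed : IsClosed (K : Set H)
  reduces : ∀ x : A.domain, ∃ y z : A.domain, x = y + z ∧
    (y : H) ∈ K ∧ A y ∈ K ∧ (z : H) ∈ Kᗮ ∧ A z ∈ Kᗮ
  pos : ∀ x : A.domain, (x : H) ∈ K → (x : H) ≠ 0 → 0 < (⟪(x : H), A x⟫_ℂ).re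
  nonpos : ∀ x : A.domain, (x : H) ∈ Kᗮ → (⟪(x : H), A x⟫_ℂ).re ≤ 0

open Classical in
/-- The range of `χ_{(0,∞)}(A)` (the zero subspace if there is none). -/
def positiveSpectralSubspace (A : H →ₗ.[ℂ] H) : Submodule ℂ H :=
  if h : ∃ K, IsPositiveSpectralSubspace A K then h.choose else ⊥

theorem isClosed_positiveSpectralSubspace (A : H →ₗ.[ℂ] H) :
    IsClosed (positiveSpectralSubspace A : Set H) := by
  unfold positiveSpectralSubspace
  split_ifs with h
  · exact h.choose_spec.isClosed
  · simp

instance completeSpace_positiveSpectralSubspace [CompleteSpace H] (A : H →ₗ.[ℂ] H) :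
    CompleteSpace (positiveSpectralSubspace A) :=
  (isClosed_positiveSpectralSubspace A).completeSpace_coe

variable [CompleteSpace H]

/-- The positive part `χ_{(0,∞)}(A) A`, as an operator in the Hilbert space
`χ_{(0,∞)}(A) H`, with domain `χ_{(0,∞)}(A) Dom A = Dom A ∩ χ_{(0,∞)}(A) H`. -/
def positivePart (A : H →ₗ.[ℂ] H) :
    positiveSpectralSubspace A →ₗ.[ℂ] positiveSpectralSubspace A where
  domain := A.domain.comap (positiveSpectralSubspace A).subtype
  toFun :=
    { toFun := fun x =>
        (positiveSpectralSubspace A).orthogonalProjectionOnto (A ⟨((x : positiveSpectralSubspace A) : H), x.2⟩)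
      map_add' := fun x y => by
        rw [← map_add, ← LinearPMap.map_add]; rfl
      map_smul' := fun a x => by
        rw [RingHom.id_apply, ← map_smul, ← LinearPMap.map_smul]; rfl }

/-- The positive part of `A` as an operator in the whole space `H`, extended by zero to the
orthogonal complement of `χ_{(0,∞)}(A) H`; this is `F(A)` with `F(s) = s` for `s > 0` and
`F(s) = 0` for `s ≤ 0`. -/
def positivePartExtended (A : H →ₗ.[ℂ] H) : H →ₗ.[ℂ] H where
  domain := A.domain.comap (positiveSpectralSubspace A).starProjection.toLinearMap
  toFun :=
    { toFun := fun x => (positiveSpectralSubspace A).starProjection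
        (A ⟨(positiveSpectralSubspace A).starProjection (x : H), x.2⟩)
      map_add' := fun x y => by
        rw [← map_add, ← LinearPMap.map_add]
        congr 2
        exact Subtype.ext (map_add _ _ _)
      map_smul' := fun a x => by
        rw [RingHom.id_apply, ← map_smul, ← LinearPMap.map_smul]
        congr 2
        exact Subtype.ext (map_smul _ _ _) }

end Operators

section DirectSum

variable {ι : Type*} {E : ι → Type*} [∀ i, NormedAddCommGroup (E i)]
  [∀ i, InnerProductSpace ℂ (E i)]

/-- The graph of the orthogonal sum of the operators `A i`. -/
def orthogonalSumGraph (A : ∀ i, E i →ₗ.[ℂ] E i) : Submodule ℂ (lp E 2 × lp E 2) where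
  carrier := {z | ∀ i, (z.1 i, z.2 i) ∈ (A i).graph}
  add_mem' := fun hx hy i => (A i).graph.add_mem (hx i) (hy i)
  zero_mem' := fun i => (A i).graph.zero_mem
  smul_mem' := fun a _ hx i => (A i).graph.smul_mem a (hx i)

theorem orthogonalSumGraph_functional (A : ∀ i, E i →ₗ.[ℂ] E i) (z : lp E 2 × lp E 2)
    (hz : z ∈ orthogonalSumGraph A) (h0 : z.1 = 0) : z.2 = 0 := by
  ext i
  exact (A i).graph_fst_eq_zero_snd (hz i) (by rw [h0]; rfl)

/-- The orthogonal sum of the operators `A i`, acting in the Hilbert space sum of the `E i`: its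
domain consists of the `f` with `f i ∈ Dom (A i)` for all `i` and `∑ i, ‖A i (f i)‖ ^ 2 < ∞`. -/
def orthogonalSum (A : ∀ i, E i →ₗ.[ℂ] E i) : lp E 2 →ₗ.[ℂ] lp E 2 :=
  (orthogonalSumGraph A).toLinearPMap

end DirectSum

/-! ### Spinors on intervals -/

/-- The values of spinor fields: `ℂ²` with its Hermitian norm. The upper component has index `0`
and the lower component index `1`. -/
abbrev Spinor : Type := EuclideanSpace ℂ (Fin 2)

/-- `L²(s) ⊗ ℂ²`. -/
abbrev SpinorL2 (s : Set ℝ) : Type := Lp Spinor 2 (volume.restrict s)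

/-- The Dirac matrix `α`. -/
def diracAlpha : Matrix (Fin 2) (Fin 2) ℂ := !![0, -Complex.I; Complex.I, 0]

/-- The Dirac matrix `β`. -/
def diracBeta : Matrix (Fin 2) (Fin 2) ℂ := !![1, 0; 0, -1]

/-- The expression `α (c / i) f' + c² β f`, as a function of the values of `f` and of `f'`. -/
def diracExpr (c : ℝ) (f f' : Spinor) : Spinor :=
  ((c : ℂ) / Complex.I) • Matrix.toEuclideanLin diracAlpha f' +
    ((c : ℂ) ^ 2) • Matrix.toEuclideanLin diracBeta f

theorem diracExpr_add (c : ℝ) (f₁ f₂ g₁ g₂ : Spinor) :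
    diracExpr c (f₁ + f₂) (g₁ + g₂) = diracExpr c f₁ g₁ + diracExpr c f₂ g₂ := by
  simp only [diracExpr, map_add, smul_add]; abel

theorem diracExpr_smul (c : ℝ) (a : ℂ) (f g : Spinor) :
    diracExpr c (a • f) (a • g) = a • diracExpr c f g := by
  simp only [diracExpr, map_smul, smul_add, smul_comm a]

theorem diracExpr_zero (c : ℝ) : diracExpr c 0 0 = 0 := by simp [diracExpr]

/-- On the interval `(a, b)` the function `f` belongs to the Sobolev space `H¹((a, b)) ⊗ ℂ²`, its
derivative is `g`, and its (one-sided) boundary values are `p` at `a` and `q` at `b`. -/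
structure HasSobolevData (a b : ℝ) (f g : ℝ → Spinor) (p q : Spinor) : Prop where
  memLp : MemLp g 2 (volume.restrict (Ioo a b))
  ae_eq : ∀ᵐ x ∂volume.restrict (Ioo a b), f x = p + ∫ s in a..x, g s
  right : q = p + ∫ s in a..b, g s

namespace HasSobolevData

variable {a b : ℝ} {f g f₁ g₁ f₂ g₂ : ℝ → Spinor} {p q p₁ q₁ p₂ q₂ : Spinor}

theorem intervalIntegrable (hab : a ≤ b) (h : HasSobolevData a b f g p q) :
    IntervalIntegrable g volume a b := by
  rw [intervalIntegrable_iff_integrableOn_Ioo_of_le hab]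
  have : IsFiniteMeasure (volume.restrict (Ioo a b)) := ⟨by simp⟩
  exact h.memLp.integrable (by norm_num)

theorem congr (hab : a ≤ b) (h : HasSobolevData a b f₁ g₁ p q)
    (hf : f₁ =ᵐ[volume.restrict (Ioo a b)] f₂) (hg : g₁ =ᵐ[volume.restrict (Ioo a b)] g₂) :
    HasSobolevData a b f₂ g₂ p q := by
  have key : ∀ x ∈ Icc a b, ∫ s in a..x, g₁ s = ∫ s in a..x, g₂ s := by
    intro x hx
    rw [intervalIntegral.integral_of_le hx.1, intervalIntegral.integral_of_le hx.1,
      integral_Ioc_eq_integral_Ioo, integral_Ioc_eq_integral_Ioo]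
    exact integral_congr_ae (ae_restrict_of_ae_restrict_of_subset (Ioo_subset_Ioo_right hx.2) hg)
  refine ⟨(memLp_congr_ae hg).1 h.memLp, ?_, ?_⟩
  · filter_upwards [h.ae_eq, hf, ae_restrict_mem measurableSet_Ioo] with x h1 h2 hx
    rw [← h2, h1, key x (Ioo_subset_Icc_self hx)]
  · rw [h.right, key b ⟨hab, le_rfl⟩]

theorem zero (a b : ℝ) : HasSobolevData a b 0 0 0 0 :=
  ⟨MemLp.zero, by simp, by simp⟩

theorem add (hab : a ≤ b) (h₁ : HasSobolevData a b f₁ g₁ p₁ q₁)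
    (h₂ : HasSobolevData a b f₂ g₂ p₂ q₂) :
    HasSobolevData a b (f₁ + f₂) (g₁ + g₂) (p₁ + p₂) (q₁ + q₂) := by
  have i₁ := h₁.intervalIntegrable hab
  have i₂ := h₂.intervalIntegrable hab
  have key : ∀ x ∈ Icc a b, ∫ s in a..x, (g₁ + g₂) s
      = (∫ s in a..x, g₁ s) + ∫ s in a..x, g₂ s := by
    intro x hx
    have hs : uIcc a x ⊆ uIcc a b := by
      rw [uIcc_of_le hx.1, uIcc_of_le hab]; exact Icc_subset_Icc_right hx.2
    exact intervalIntegral.integral_add (i₁.mono_set hs) (i₂.mono_set hs)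
  refine ⟨h₁.memLp.add h₂.memLp, ?_, ?_⟩
  · filter_upwards [h₁.ae_eq, h₂.ae_eq, ae_restrict_mem measurableSet_Ioo] with x e₁ e₂ hx
    rw [Pi.add_apply, e₁, e₂, key x (Ioo_subset_Icc_self hx)]; abel
  · rw [h₁.right, h₂.right, key b ⟨hab, le_rfl⟩]; abel

theorem smul (k : ℂ) (h : HasSobolevData a b f g p q) :
    HasSobolevData a b (k • f) (k • g) (k • p) (k • q) := by
  refine ⟨h.memLp.const_smul k, ?_, ?_⟩
  · filter_upwards [h.ae_eq] with x e
    simp only [Pi.smul_apply, intervalIntegral.integral_smul, ← smul_add, ← e]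
  · simp only [Pi.smul_apply, intervalIntegral.integral_smul, ← smul_add, ← h.right]

/-- The derivative is determined by the function. -/
theorem deriv_ae_eq_zero (hab : a ≤ b) (h : HasSobolevData a b f g p q)
    (hf : f =ᵐ[volume.restrict (Ioo a b)] 0) : g =ᵐ[volume.restrict (Ioo a b)] 0 := by
  have i := h.intervalIntegrable hab
  have hd := i.ae_hasDerivAt_integral
  rw [uIcc_of_le hab] at hd
  have hcont : ContinuousOn (fun x => p + ∫ s in a..x, g s) (Ioo a b) := by
    have := intervalIntegral.continuousOn_primitive_interval' i left_mem_uIcc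
    rw [uIcc_of_le hab] at this
    exact (continuousOn_const.add this).mono Ioo_subset_Icc_self
  have heq : EqOn (fun x => p + ∫ s in a..x, g s) 0 (Ioo a b) := by
    refine Measure.eqOn_Ioo_of_ae_eq (μ := volume) ?_ hcont continuousOn_const
    filter_upwards [h.ae_eq, hf] with x h1 h2
    rw [← h1, h2]
  filter_upwards [ae_restrict_of_ae hd, ae_restrict_mem measurableSet_Ioo] with x hx hxm
  have h1 := (hx (Ioo_subset_Icc_self hxm) a ⟨le_rfl, hab⟩).const_add p
  have h2 : HasDerivAt (fun _ : ℝ => (0 : Spinor)) (g x) x :=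
    h1.congr_of_eventuallyEq (by
      filter_upwards [isOpen_Ioo.mem_nhds hxm] with y hy
      exact (heq hy).symm)
  exact h2.unique (hasDerivAt_const x 0)

end HasSobolevData

/-! ### Metric trees -/

/-- A rooted metric tree with finite branching: a rooted tree (ordered by `x ≤ y` iff `x` lies on
the path from the root `⊥` to `y`) together with the lengths of its edges. An edge is given by
the vertex `w ≠ ⊥` at which it terminates; it emanates from the vertex covered by `w`. -/
structure MetricTree where
  /-- the combinatorial tree, that is, the set of vertices -/
  tree : RootedTree.{u}
  /-- the lengths of the edges -/
  length : {w : tree // w ≠ ⊥} → ℝ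
  length_pos : ∀ e, 0 < length e
  finite_emanating : ∀ v : tree, {e : {w : tree // w ≠ ⊥} | v ⋖ e.1}.Finite

namespace MetricTree

variable (Γ : MetricTree.{u})

/-- The edges of `Γ`; the edge `e` terminates at the vertex `e.1` and is identified with the
interval `(0, |e|)`, where `0` corresponds to the end closer to the root. -/
abbrev Edge : Type u := {w : Γ.tree // w ≠ ⊥}

/-- The set of the edges emanating from a vertex. -/
def emanating (v : Γ.tree) : Finset Γ.Edge := (Γ.finite_emanating v).toFinset

/-- The generation of a vertex: the number of the vertices strictly before it. -/
def gen (v : Γ.tree) : ℕ := (Iio v).ncard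

/-- The branching number of a vertex. -/
def branching (v : Γ.tree) : ℕ := (Γ.emanating v).card

/-- The distance of a vertex to the root: the total length of the path between them. -/
def distRoot (v : Γ.tree) : ℝ := ∑ᶠ (e : Γ.Edge) (_ : e.1 ≤ v), Γ.length e

/-- `Γ` is a regular tree with the generating sequences `b` and `t`. -/
structure IsRegular (b : ℕ → ℕ) (t : ℕ → ℝ) : Prop where
  branching_eq : ∀ v, Γ.branching v = b (Γ.gen v)
  distRoot_eq : ∀ v, Γ.distRoot v = t (Γ.gen v)

/-- `L²(Γ) ⊗ ℂ²`, the Hilbert space sum of the spaces `L²(e) ⊗ ℂ²` over the edges `e`. -/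
abbrev L2 : Type u := lp (fun e : Γ.Edge => SpinorL2 (Ioo 0 (Γ.length e))) 2

/-- The vertex conditions for the boundary values `p e` at the initial and `q e` at the terminal
end of the edges. At the root the upper component vanishes. At any other vertex the upper
component is continuous, and the values of the lower component on the emanating edges add up to
its value on the edge that terminates there. -/
structure VertexConditions (p q : Γ.Edge → Spinor) : Prop where
  root : ∀ e ∈ Γ.emanating ⊥, p e 0 = 0
  upper : ∀ e : Γ.Edge, ∀ e' ∈ Γ.emanating e.1, p e' 0 = q e 0
  lower : ∀ e : Γ.Edge, ∑ e' ∈ Γ.emanating e.1, p e' 1 = q e 1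

/-- The graph of the Dirac operator on `Γ`: the pairs `(f, D f)`. -/
def diracGraph (c : ℝ) : Submodule ℂ (Γ.L2 × Γ.L2) where
  carrier := {z | ∃ (g : Γ.L2) (p q : Γ.Edge → Spinor),
    (∀ e, HasSobolevData 0 (Γ.length e) (z.1 e) (g e) (p e) (q e)) ∧
    Γ.VertexConditions p q ∧
    ∀ e, ∀ᵐ x ∂volume.restrict (Ioo 0 (Γ.length e)), z.2 e x = diracExpr c (z.1 e x) (g e x)}
  zero_mem' := by
    refine ⟨0, 0, 0, fun e => ?_, ⟨by simp, by simp, by simp⟩, fun e => ?_⟩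
    · exact (HasSobolevData.zero _ _).congr (Γ.length_pos e).le
        (Lp.coeFn_zero _ _ _).symm (Lp.coeFn_zero _ _ _).symm
    · filter_upwards [Lp.coeFn_zero Spinor 2 (volume.restrict (Ioo 0 (Γ.length e)))] with x hx
      change (0 : SpinorL2 (Ioo 0 (Γ.length e))) x = diracExpr c
        ((0 : SpinorL2 (Ioo 0 (Γ.length e))) x) ((0 : SpinorL2 (Ioo 0 (Γ.length e))) x)
      rw [hx, Pi.zero_apply, diracExpr_zero]
  add_mem' := by
    rintro z z' ⟨g, p, q, h1, h2, h3⟩ ⟨g', p', q', h1', h2', h3'⟩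
    refine ⟨g + g', p + p', q + q', fun e => ?_, ⟨?_, ?_, ?_⟩, fun e => ?_⟩
    · exact ((h1 e).add (Γ.length_pos e).le (h1' e)).congr (Γ.length_pos e).le
        (Lp.coeFn_add _ _).symm (Lp.coeFn_add _ _).symm
    · intro e he; simp [h2.root e he, h2'.root e he]
    · intro e e' he; simp [h2.upper e e' he, h2'.upper e e' he]
    · intro e; simp [Finset.sum_add_distrib, h2.lower e, h2'.lower e]
    · filter_upwards [h3 e, h3' e, Lp.coeFn_add (z.1 e) (z'.1 e), Lp.coeFn_add (z.2 e) (z'.2 e),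
        Lp.coeFn_add (g e) (g' e)] with x e1 e2 e3 e4 e5
      change (z.2 e + z'.2 e) x = diracExpr c ((z.1 e + z'.1 e) x) ((g e + g' e) x)
      rw [e3, e4, e5, Pi.add_apply, Pi.add_apply, Pi.add_apply, diracExpr_add, e1, e2]
  smul_mem' := by
    rintro k z ⟨g, p, q, h1, h2, h3⟩
    refine ⟨k • g, k • p, k • q, fun e => ?_, ⟨?_, ?_, ?_⟩, fun e => ?_⟩
    · exact ((h1 e).smul k).congr (Γ.length_pos e).le
        (Lp.coeFn_smul _ _).symm (Lp.coeFn_smul _ _).symm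
    · intro e he; simp [h2.root e he]
    · intro e e' he; simp [h2.upper e e' he]
    · intro e; simp [← Finset.mul_sum, h2.lower e]
    · filter_upwards [h3 e, Lp.coeFn_smul k (z.1 e), Lp.coeFn_smul k (z.2 e),
        Lp.coeFn_smul k (g e)] with x e1 e3 e4 e5
      change (k • z.2 e) x = diracExpr c ((k • z.1 e) x) ((k • g e) x)
      rw [e3, e4, e5, Pi.smul_apply, Pi.smul_apply, Pi.smul_apply, diracExpr_smul, e1]

theorem diracGraph_functional (c : ℝ) (z : Γ.L2 × Γ.L2) (hz : z ∈ Γ.diracGraph c)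
    (h0 : z.1 = 0) : z.2 = 0 := by
  obtain ⟨g, p, q, h1, h2, h3⟩ := hz
  ext e : 2
  refine Lp.ext ?_
  have hf : z.1 e =ᵐ[volume.restrict (Ioo 0 (Γ.length e))] 0 := by
    rw [h0]; exact Lp.coeFn_zero _ _ _
  have hg := (h1 e).deriv_ae_eq_zero (Γ.length_pos e).le hf
  filter_upwards [hf, hg, h3 e,
    Lp.coeFn_zero Spinor 2 (volume.restrict (Ioo 0 (Γ.length e)))] with x e1 e2 e3 e4
  rw [e3, e1, e2, Pi.zero_apply, diracExpr_zero]
  exact e4.symm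

/-- The Dirac operator `D_c` on `Γ`. Its domain consists of the `f` in `L²(Γ) ⊗ ℂ²` that are `H¹`
on every edge, with derivative in `L²(Γ) ⊗ ℂ²`, and satisfy the vertex conditions; on every edge
`D_c f = α (c / i) f' + c² β f`. -/
def dirac (c : ℝ) : Γ.L2 →ₗ.[ℂ] Γ.L2 := (Γ.diracGraph c).toLinearPMap

end MetricTree

/-! ### The reduced operators -/

/-- The interval `(t k, h)`, where `h = sup t ≤ ∞` is the height. -/
def reducedInterval (t : ℕ → ℝ) (k : ℕ) : Set ℝ :=
  {x | t k < x ∧ (x : EReal) < ⨆ n, (t n : EReal)}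

theorem Ioo_subset_reducedInterval {t : ℕ → ℝ} (ht : StrictMono t) {k j : ℕ} (hj : k ≤ j) :
    Ioo (t j) (t (j + 1)) ⊆ reducedInterval t k := fun _ hx =>
  ⟨(ht.monotone hj).trans_lt hx.1,
    (EReal.coe_lt_coe_iff.2 hx.2).trans_le (le_iSup (fun n => (t n : EReal)) (j + 1))⟩

/-- The boundary condition at `t k` and the matching conditions at the points `t j`, `j > k`, for
the boundary values `p j = ψ(t j +)`, `j ≥ k`, and `q j = ψ(t j -)`, `j > k`. -/
structure ReducedConditions (b : ℕ → ℕ) (k : ℕ) (p q : ℕ → Spinor) : Prop where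
  boundary : p k 0 = 0
  upper : ∀ j, k < j → p j 0 = (Real.sqrt (b j) : ℂ) * q j 0
  lower : ∀ j, k < j → p j 1 = (Real.sqrt (b j) : ℂ)⁻¹ * q j 1

theorem HasSobolevData.congr_reduced {t : ℕ → ℝ} (ht : StrictMono t) {k j : ℕ} (hj : k ≤ j)
    {f₁ f₂ g₁ g₂ : ℝ → Spinor} {p q : Spinor}
    (h : HasSobolevData (t j) (t (j + 1)) f₁ g₁ p q)
    (hf : f₁ =ᵐ[volume.restrict (reducedInterval t k)] f₂)
    (hg : g₁ =ᵐ[volume.restrict (reducedInterval t k)] g₂) :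
    HasSobolevData (t j) (t (j + 1)) f₂ g₂ p q :=
  h.congr (ht (Nat.lt_succ_self j)).le
    (ae_restrict_of_ae_restrict_of_subset (Ioo_subset_reducedInterval ht hj) hf)
    (ae_restrict_of_ae_restrict_of_subset (Ioo_subset_reducedInterval ht hj) hg)

/-- The graph of the reduced operator `M_k`: the pairs `(ψ, M_k ψ)`. -/
def reducedGraph (b : ℕ → ℕ) (t : ℕ → ℝ) (ht : StrictMono t) (c : ℝ) (k : ℕ) :
    Submodule ℂ (SpinorL2 (reducedInterval t k) × SpinorL2 (reducedInterval t k)) where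
  carrier := {z | ∃ (g : SpinorL2 (reducedInterval t k)) (p q : ℕ → Spinor),
    (∀ j, k ≤ j → HasSobolevData (t j) (t (j + 1)) z.1 g (p j) (q (j + 1))) ∧
    ReducedConditions b k p q ∧
    ∀ᵐ x ∂volume.restrict (reducedInterval t k), z.2 x = diracExpr c (z.1 x) (g x)}
  zero_mem' := by
    refine ⟨0, 0, 0, fun j hj => ?_, ⟨by simp, by simp, by simp⟩, ?_⟩
    · exact (HasSobolevData.zero _ _).congr_reduced ht hj
        (Lp.coeFn_zero _ _ _).symm (Lp.coeFn_zero _ _ _).symm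
    · filter_upwards [Lp.coeFn_zero Spinor 2 (volume.restrict (reducedInterval t k))] with x hx
      rw [Prod.fst_zero, Prod.snd_zero, hx, Pi.zero_apply, diracExpr_zero]
  add_mem' := by
    rintro z z' ⟨g, p, q, h1, h2, h3⟩ ⟨g', p', q', h1', h2', h3'⟩
    refine ⟨g + g', p + p', q + q', fun j hj => ?_, ⟨?_, ?_, ?_⟩, ?_⟩
    · exact ((h1 j hj).add (ht (Nat.lt_succ_self j)).le (h1' j hj)).congr_reduced ht hj
        (Lp.coeFn_add _ _).symm (Lp.coeFn_add _ _).symm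
    · simp [h2.boundary, h2'.boundary]
    · intro j hj; simp [h2.upper j hj, h2'.upper j hj, mul_add]
    · intro j hj; simp [h2.lower j hj, h2'.lower j hj, mul_add]
    · filter_upwards [h3, h3', Lp.coeFn_add z.1 z'.1, Lp.coeFn_add z.2 z'.2,
        Lp.coeFn_add g g'] with x e1 e2 e3 e4 e5
      rw [Prod.fst_add, Prod.snd_add, e3, e4, e5, Pi.add_apply, Pi.add_apply, Pi.add_apply,
        diracExpr_add, e1, e2]
  smul_mem' := by
    rintro a z ⟨g, p, q, h1, h2, h3⟩
    refine ⟨a • g, a • p, a • q, fun j hj => ?_, ⟨?_, ?_, ?_⟩, ?_⟩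
    · exact ((h1 j hj).smul a).congr_reduced ht hj
        (Lp.coeFn_smul _ _).symm (Lp.coeFn_smul _ _).symm
    · simp [h2.boundary]
    · intro j hj; simp [h2.upper j hj]; ring
    · intro j hj; simp [h2.lower j hj]; ring
    · filter_upwards [h3, Lp.coeFn_smul a z.1, Lp.coeFn_smul a z.2,
        Lp.coeFn_smul a g] with x e1 e3 e4 e5
      rw [Prod.smul_fst, Prod.smul_snd, e3, e4, e5, Pi.smul_apply, Pi.smul_apply, Pi.smul_apply,
        diracExpr_smul, e1]

/-- The interval `(t k, h)` is covered by the intervals `(t j, t (j + 1))`, `j ≥ k`, and the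
points `t j`. -/
theorem reducedInterval_subset {t : ℕ → ℝ} (ht : StrictMono t) (k : ℕ) :
    reducedInterval t k ⊆ (⋃ j ∈ Ici k, Ioo (t j) (t (j + 1))) ∪ range t := by
  classical
  rintro x ⟨hk, hx⟩
  obtain ⟨n, hn⟩ := lt_iSup_iff.1 hx
  have hn' : x < t n := EReal.coe_lt_coe_iff.1 hn
  have hex : ∃ m, x < t m := ⟨n, hn'⟩
  have h1 : x < t (Nat.find hex) := Nat.find_spec hex
  have h2 : k < Nat.find hex := ht.lt_iff_lt.1 (hk.trans h1)
  obtain ⟨m, hm⟩ : ∃ m, Nat.find hex = m + 1 := ⟨Nat.find hex - 1, by omega⟩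
  have h3 : t m ≤ x := not_lt.1 (Nat.find_min hex (by omega))
  rw [hm] at h1 h2
  rcases h3.eq_or_lt with h | h
  · exact Or.inr ⟨m, h⟩
  · exact Or.inl (mem_biUnion (show m ∈ Ici k from Nat.lt_succ_iff.1 h2) ⟨h, h1⟩)

theorem reducedGraph_functional (b : ℕ → ℕ) (t : ℕ → ℝ) (ht : StrictMono t) (c : ℝ) (k : ℕ)
    (z : SpinorL2 (reducedInterval t k) × SpinorL2 (reducedInterval t k))
    (hz : z ∈ reducedGraph b t ht c k) (h0 : z.1 = 0) : z.2 = 0 := by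
  obtain ⟨g, p, q, h1, h2, h3⟩ := hz
  have hf : z.1 =ᵐ[volume.restrict (reducedInterval t k)] 0 := by
    rw [h0]; exact Lp.coeFn_zero _ _ _
  have hg : g =ᵐ[volume.restrict (reducedInterval t k)] 0 := by
    refine ae_restrict_of_ae_restrict_of_subset (reducedInterval_subset ht k) ?_
    refine (ae_restrict_union_iff _ _ _).2 ⟨?_, ?_⟩
    · refine (ae_restrict_biUnion_iff _ (to_countable (Ici k)) _).2 fun j hj => ?_
      exact (h1 j hj).deriv_ae_eq_zero (ht (Nat.lt_succ_self j)).le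
        (ae_restrict_of_ae_restrict_of_subset (Ioo_subset_reducedInterval ht hj) hf)
    · rw [Measure.restrict_eq_zero.2 ((countable_range t).measure_zero _)]
      simp
  refine Lp.ext ?_
  filter_upwards [hf, hg, h3,
    Lp.coeFn_zero Spinor 2 (volume.restrict (reducedInterval t k))] with x e1 e2 e3 e4
  rw [e3, e1, e2, e4, Pi.zero_apply, diracExpr_zero]

/-- The operator `M_k` in `L²((t k, h)) ⊗ ℂ²`. Its domain consists of the `ψ` that are `H¹` on
every interval `(t j, t (j + 1))`, `j ≥ k`, with derivative in `L²((t k, h)) ⊗ ℂ²`, and satisfy the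
boundary and matching conditions; on these intervals `M_k ψ = α (c / i) ψ' + c² β ψ`. -/
def reducedDirac (b : ℕ → ℕ) (t : ℕ → ℝ) (ht : StrictMono t) (c : ℝ) (k : ℕ) :
    SpinorL2 (reducedInterval t k) →ₗ.[ℂ] SpinorL2 (reducedInterval t k) :=
  (reducedGraph b t ht c k).toLinearPMap

/-- The index set of the orthogonal sum: one index for `M_0`, and for every `k = m + 1` with
`m = 0, 1, …` as many as `b 0 ⋯ b (k - 1) (b k - 1)`. -/
abbrev ReducedIndex (b : ℕ → ℕ) : Type :=
  Unit ⊕ (Σ m : ℕ, Fin ((∏ i ∈ Finset.range (m + 1), b i) * (b (m + 1) - 1)))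

/-- The number `k` of the operator `M_k` that belongs to an index. -/
def ReducedIndex.level {b : ℕ → ℕ} : ReducedIndex b → ℕ
  | Sum.inl _ => 0
  | Sum.inr i => i.1 + 1

end

/-!
The proof decomposes `L²(Γ) ⊗ ℂ²` by symmetry and reduces everything to the operators `M_k`, which
are treated by hand.

*Haar system.* On the `b 0 ⋯ b n` edges of level `n` (those that start at a vertex of generation
`n`) there is an orthonormal basis of coefficient vectors `a i n`, indexed by the `i` of level at
most `n`: a vector of level `m + 1` is born on the edges of level `m + 1`, where its sums over
siblings vanish, and is afterwards passed on to the descendants with the factor `b⁻¹ᐟ²`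
(`exists_isHaarSystem`). The dimension of the space of vectors with vanishing sums over siblings
gives the multiplicities `b 0 ⋯ b (k - 1) (b k - 1)`. Spreading a function on `(t k, h)` over the
tree with the coefficients `a i` is an isometry, and these isometries together form a unitary
operator from the Hilbert space sum onto `L²(Γ) ⊗ ℂ²`
(`MetricTree.IsRegular.isHilbertSum_haarIsometry`). The vertex conditions on the tree turn into the
matching conditions of the `M_k`, so the graph of `D_c` is mapped onto the graph of the orthogonal
sum (`MetricTree.IsRegular.mem_graph_dirac_iff`).

*The operators `M_k`.* Let `ω` be the step function with `ω = 1` on `(t k, t (k + 1))` that jumps by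
the factor `√(b j)` at `t j`. The matching conditions say that `ψ₁ / ω` and `ω ψ₂` are absolutely
continuous across the `t j`, so `M_k` is a Dirac operator with weight `ω`. The infinite total length
of `Γ` means `∫ ω² = ∞`, and this excludes a nontrivial kernel (`ae_eq_zero_of_isWeightedPrimitive`).
Integration by parts and a weighted du Bois-Reymond lemma show that `M_k` is the adjoint of its
restriction to the functions that vanish near the end `h`. Since the mass term anticommutes with the
derivative term, `‖M_k z‖ ≥ c² ‖z‖` for these functions, and therefore `M_k` is the inverse of a
bounded self-adjoint operator `S` with `‖S‖ ≤ c⁻²` (`exists_hasSelfAdjointInverse_of_testPairs`,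
`exists_hasSelfAdjointInverse_reducedDirac`). The bound does not depend on `k`, so that `D_c` is the
inverse of a bounded self-adjoint operator, too.

*Spectral subspaces.* For an operator `A` with bounded self-adjoint inverse `S`, the kernel of the
negative part of `S` is the only subspace with the properties of the range of `χ_{(0,∞)}(A)`
(`HasSelfAdjointInverse.isPositiveSpectralSubspace_ker`,
`HasSelfAdjointInverse.eq_ker_of_isPositiveSpectralSubspace`). By uniqueness, the positive spectral
subspace of an orthogonal sum is the sum of those of the summands, and the unitary operator
intertwines the positive parts, both on the spectral subspaces and extended by zero.
-/

open scoped ComplexConjugate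

/-! ### Spectral subspaces of operators with bounded inverse -/

section PositiveSpectralSubspace

variable {H : Type*} [NormedAddCommGroup H] [InnerProductSpace ℂ H]

theorem isPositiveSpectralSubspace_positiveSpectralSubspace {A : H →ₗ.[ℂ] H}
    (h : ∃ K, IsPositiveSpectralSubspace A K) :
    IsPositiveSpectralSubspace A (positiveSpectralSubspace A) := by
  rw [positiveSpectralSubspace, dif_pos h]
  exact h.choose_spec

theorem IsPositiveSpectralSubspace.apply_mem {A : H →ₗ.[ℂ] H} {K : Submodule ℂ H}
    (hK : IsPositiveSpectralSubspace A K) {x : A.domain} (hx : (x : H) ∈ K) : A x ∈ K := by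
  obtain ⟨y, z, e, hy, hAy, hz, -⟩ := hK.reduces x
  have hz0 : (z : H) = 0 := by
    refine Submodule.disjoint_def.1 (Submodule.orthogonal_disjoint K) _ ?_ hz
    have : (z : H) = x - y := by rw [e]; simp
    rw [this]
    exact K.sub_mem hx hy
  have : x = y := by rw [e, show z = 0 from Subtype.ext hz0, add_zero]
  rw [this]
  exact hAy

end PositiveSpectralSubspace

section OperatorsWithBoundedInverse

variable {H : Type*} [NormedAddCommGroup H] [InnerProductSpace ℂ H] [CompleteSpace H]

/-- The operator `A` is the inverse of the bounded self-adjoint operator `S`. -/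
structure HasSelfAdjointInverse (A : H →ₗ.[ℂ] H) (S : H →L[ℂ] H) : Prop where
  isSelfAdjoint : IsSelfAdjoint S
  mem_graph_iff : ∀ x y, (x, y) ∈ A.graph ↔ S y = x

namespace HasSelfAdjointInverse

variable {A : H →ₗ.[ℂ] H} {S : H →L[ℂ] H}

theorem inner_comm (h : HasSelfAdjointInverse A S) (x y : H) : ⟪S x, y⟫_ℂ = ⟪x, S y⟫_ℂ := by
  conv_rhs => rw [← h.isSelfAdjoint.adjoint_eq]
  rw [ContinuousLinearMap.adjoint_inner_right]

theorem injective (h : HasSelfAdjointInverse A S) {y : H} (hy : S y = 0) : y = 0 :=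
  A.graph_fst_eq_zero_snd ((h.mem_graph_iff 0 y).2 hy) rfl

theorem dense_domain (h : HasSelfAdjointInverse A S) : Dense (A.domain : Set H) := by
  rw [Submodule.dense_iff_topologicalClosure_eq_top, Submodule.topologicalClosure_eq_top_iff,
    Submodule.eq_bot_iff]
  intro y hy
  refine h.injective (ext_inner_left ℂ fun w => ?_)
  rw [inner_zero_right, ← h.inner_comm]
  exact Submodule.inner_right_of_mem_orthogonal
    (A.mem_domain_of_mem_graph ((h.mem_graph_iff (S w) w).2 rfl)) hy

theorem isSelfAdjoint_operator (h : HasSelfAdjointInverse A S) : IsSelfAdjoint A := by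
  rw [LinearPMap.isSelfAdjoint_def]
  refine LinearPMap.eq_of_eq_graph ?_
  rw [LinearPMap.adjoint_graph_eq_graph_adjoint h.dense_domain]
  ext ⟨x, y⟩
  rw [Submodule.mem_adjoint_iff, h.mem_graph_iff]
  constructor
  · intro hxy
    refine ext_inner_left ℂ fun w => ?_
    have := hxy (S w) w ((h.mem_graph_iff _ _).2 rfl)
    rw [sub_eq_zero, h.inner_comm] at this
    exact this.symm
  · rintro rfl a w haw
    rw [h.mem_graph_iff] at haw
    rw [← haw, h.inner_comm, sub_self]

theorem apply_eq (h : HasSelfAdjointInverse A S) (x : A.domain) : S (A x) = x :=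
  (h.mem_graph_iff _ _).1 (A.mem_graph x)

theorem mem_domain (h : HasSelfAdjointInverse A S) (w : H) : S w ∈ A.domain :=
  A.mem_domain_of_mem_graph ((h.mem_graph_iff (S w) w).2 rfl)

theorem apply_mk (h : HasSelfAdjointInverse A S) (w : H) : A ⟨S w, h.mem_domain w⟩ = w :=
  (A.image_iff (h.mem_domain w)).2 ((h.mem_graph_iff (S w) w).2 rfl) |>.symm

theorem negPart_posPart_apply (x : H) : S⁻ (S⁺ x) = 0 := by
  have := CFC.negPart_mul_posPart S
  exact congrArg (fun T : H →L[ℂ] H => T x) this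

theorem isPositive_posPart (S : H →L[ℂ] H) : (S⁺).IsPositive :=
  (ContinuousLinearMap.nonneg_iff_isPositive _).1 (CFC.posPart_nonneg S)

theorem isPositive_negPart (S : H →L[ℂ] H) : (S⁻).IsPositive :=
  (ContinuousLinearMap.nonneg_iff_isPositive _).1 (CFC.negPart_nonneg S)

theorem eq_sub_apply (h : HasSelfAdjointInverse A S) (x : H) : S x = S⁺ x - S⁻ x := by
  conv_lhs => rw [← CFC.posPart_sub_negPart S h.isSelfAdjoint]
  rfl

/-- A positive operator annihilates the vectors on which its quadratic form vanishes. -/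
theorem _root_.ContinuousLinearMap.IsPositive.apply_eq_zero {T : H →L[ℂ] H} (hT : T.IsPositive)
    {x : H} (hx : (⟪T x, x⟫_ℂ).re = 0) : T x = 0 := by
  have hn : (0 : H →L[ℂ] H) ≤ T := (ContinuousLinearMap.nonneg_iff_isPositive _).2 hT
  have hs := CFC.sqrt_mul_sqrt_self T hn
  have hsa : IsSelfAdjoint (CFC.sqrt T) := IsSelfAdjoint.of_nonneg (CFC.sqrt_nonneg T)
  have e : T x = CFC.sqrt T (CFC.sqrt T x) := by
    conv_lhs => rw [← hs]
    rfl
  have : ⟪T x, x⟫_ℂ = ⟪CFC.sqrt T x, CFC.sqrt T x⟫_ℂ := by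
    rw [e]
    conv_lhs => rw [← hsa.adjoint_eq]
    rw [ContinuousLinearMap.adjoint_inner_left, hsa.adjoint_eq]
  rw [this] at hx
  have h0 : CFC.sqrt T x = 0 := by
    rw [← inner_self_eq_zero (𝕜 := ℂ), ← inner_self_ofReal_re (𝕜 := ℂ)]
    simpa using hx
  rw [e, h0, map_zero]

/-- The kernel of the negative part of the bounded inverse `S` is a positive spectral subspace of
`A`: it is invariant under `S`, and `⟪S w, A (S w)⟫ = ⟪S w, w⟫`, where `S` acts as its positive part
on the kernel and as minus its negative part on the orthogonal complement. -/
theorem isPositiveSpectralSubspace_ker (h : HasSelfAdjointInverse A S) :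
    IsPositiveSpectralSubspace A (S⁻).ker := by
  have hc : IsClosed ((S⁻).ker : Set H) := (S⁻).isClosed_ker
  have : CompleteSpace (S⁻).ker := hc.completeSpace_coe
  have hsa : IsSelfAdjoint (S⁻) := (isPositive_negPart S).isSelfAdjoint
  have hP : ∀ w, S⁺ w ∈ (S⁻).ker := fun w => negPart_posPart_apply w
  have hN : ∀ w, S⁻ w ∈ ((S⁻).ker)ᗮ := by
    intro w
    rw [Submodule.mem_orthogonal]
    intro u hu
    have hu' : S⁻ u = 0 := hu
    conv_lhs => rw [← hsa.adjoint_eq]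
    rw [ContinuousLinearMap.adjoint_inner_right, hu', inner_zero_left]
  have hO : ∀ w ∈ ((S⁻).ker)ᗮ, S⁺ w = 0 := by
    intro w hw
    have hp := (isPositive_posPart S).isSelfAdjoint
    refine ext_inner_right ℂ fun v => ?_
    conv_lhs => rw [← hp.adjoint_eq]
    rw [ContinuousLinearMap.adjoint_inner_left, inner_zero_left]
    exact Submodule.inner_left_of_mem_orthogonal (hP v) hw
  have hK : ∀ w ∈ (S⁻).ker, S w = S⁺ w := by
    intro w hw
    rw [h.eq_sub_apply, show S⁻ w = 0 from hw, sub_zero]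
  have hKo : ∀ w ∈ ((S⁻).ker)ᗮ, S w = -S⁻ w := by
    intro w hw
    rw [h.eq_sub_apply, hO w hw, zero_sub]
  have split : ∀ w : H, ∃ w₁ ∈ (S⁻).ker, ∃ w₂ ∈ ((S⁻).ker)ᗮ, w = w₁ + w₂ := fun w =>
    Submodule.exists_add_mem_mem_orthogonal w
  refine ⟨hc, ?_, ?_, ?_⟩
  · intro x
    obtain ⟨w₁, h1, w₂, h2, e⟩ := split (A x)
    refine ⟨⟨S w₁, h.mem_domain _⟩, ⟨S w₂, h.mem_domain _⟩, ?_, ?_, ?_, ?_, ?_⟩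
    · refine Subtype.ext ?_
      rw [← h.apply_eq x, e, map_add]; rfl
    · change S w₁ ∈ _
      rw [hK w₁ h1]; exact hP _
    · rw [h.apply_mk]; exact h1
    · change S w₂ ∈ _
      rw [hKo w₂ h2]; exact Submodule.neg_mem _ (hN _)
    · rw [h.apply_mk]; exact h2
  · intro x hx hx0
    obtain ⟨w₁, h1, w₂, h2, e⟩ := split (A x)
    have hxS := h.apply_eq x
    have e2 : S w₂ = x - S⁺ w₁ := by
      rw [← hxS, e, map_add, hK w₁ h1]; abel
    have h3 : S w₂ = 0 := by
      have ha : S w₂ ∈ (S⁻).ker := by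
        rw [e2]; exact Submodule.sub_mem _ hx (hP _)
      have hb : S w₂ ∈ ((S⁻).ker)ᗮ := by
        rw [hKo w₂ h2]; exact Submodule.neg_mem _ (hN _)
      exact Submodule.disjoint_def.1 (Submodule.orthogonal_disjoint _) _ ha hb
    have h4 : A x = w₁ := by rw [e, h.injective h3, add_zero]
    have h5 : (x : H) = S⁺ w₁ := by
      rw [h3] at e2; exact (sub_eq_zero.1 e2.symm)
    rw [h4, h5]
    refine lt_of_le_of_ne ((isPositive_posPart S).re_inner_nonneg_left w₁) ?_
    intro h6
    exact hx0 (h5.trans ((isPositive_posPart S).apply_eq_zero h6.symm))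
  · intro x hx
    obtain ⟨w₁, h1, w₂, h2, e⟩ := split (A x)
    have hxS := h.apply_eq x
    have e2 : S w₁ = x - S w₂ := by
      rw [← hxS, e, map_add]; abel
    have h3 : S w₁ = 0 := by
      have hb : S w₁ ∈ ((S⁻).ker)ᗮ := by
        rw [e2, hKo w₂ h2]; exact Submodule.sub_mem _ hx (Submodule.neg_mem _ (hN _))
      have ha : S w₁ ∈ (S⁻).ker := by
        rw [hK w₁ h1]; exact hP _
      exact Submodule.disjoint_def.1 (Submodule.orthogonal_disjoint _) _ ha hb
    have h4 : A x = w₂ := by rw [e, h.injective h3, zero_add]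
    have h5 : (x : H) = -S⁻ w₂ := by
      rw [h3] at e2
      rw [← hKo w₂ h2]; exact (sub_eq_zero.1 e2.symm)
    rw [h4, h5, inner_neg_left, Complex.neg_re, neg_nonpos]
    exact (isPositive_negPart S).re_inner_nonneg_left w₂

/-- If `P` is the projection onto a positive spectral subspace, then `S P` and `S P - S` are positive
operators with product zero, hence the positive and the negative part of `S`. This shows that
there is only one such subspace. -/
theorem eq_ker_of_isPositiveSpectralSubspace (h : HasSelfAdjointInverse A S) {K : Submodule ℂ H}
    (hK : IsPositiveSpectralSubspace A K) : K = (S⁻).ker := by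
  have : CompleteSpace K := hK.isClosed.completeSpace_coe
  have split : ∀ w : H, ∃ w₁ ∈ K, ∃ w₂ ∈ Kᗮ, w = w₁ + w₂ := fun w =>
    Submodule.exists_add_mem_mem_orthogonal w
  have disj : ∀ x ∈ K, x ∈ Kᗮ → x = 0 :=
    Submodule.disjoint_def.1 (Submodule.orthogonal_disjoint K)
  -- Both `K` and its orthogonal complement are invariant under the bounded inverse.
  have inv1 : ∀ w ∈ K, S w ∈ K := by
    intro w hw
    obtain ⟨y, z, e, hy, hAy, hz, hAz⟩ := hK.reduces ⟨S w, h.mem_domain w⟩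
    have e1 : w = A y + A z := by
      rw [← LinearPMap.map_add, ← e, h.apply_mk]
    have h0 : A z = 0 := by
      refine disj _ ?_ hAz
      rw [eq_sub_of_add_eq' e1.symm]
      exact K.sub_mem hw hAy
    have : S w = y := by rw [e1, h0, add_zero, h.apply_eq]
    rw [this]; exact hy
  have inv2 : ∀ w ∈ Kᗮ, S w ∈ Kᗮ := by
    intro w hw
    rw [Submodule.mem_orthogonal]
    intro u hu
    rw [← h.inner_comm]
    exact Submodule.inner_right_of_mem_orthogonal (inv1 u hu) hw
  set P : H →L[ℂ] H := K.starProjection with hPdef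
  have hPmem : ∀ x, P x ∈ K := fun x => K.starProjection_apply_mem x
  have hQmem : ∀ x, x - P x ∈ Kᗮ := fun x => K.sub_starProjection_mem_orthogonal x
  have hPK : ∀ x ∈ K, P x = x := fun x hx => K.starProjection_eq_self_iff.2 hx
  have hPO : ∀ x ∈ Kᗮ, P x = 0 := fun x hx => (K.starProjection_apply_eq_zero_iff).2 hx
  have pos : ∀ x, 0 ≤ (⟪S (P x), x⟫_ℂ).re := by
    intro x
    have e : ⟪S (P x), x⟫_ℂ = ⟪S (P x), P x⟫_ℂ := by
      rw [← sub_eq_zero, ← inner_sub_right,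
        Submodule.inner_right_of_mem_orthogonal (inv1 _ (hPmem x)) (hQmem x)]
    rw [e]
    by_cases h0 : S (P x) = 0
    · rw [h0, inner_zero_left]; simp
    · have := hK.pos ⟨S (P x), h.mem_domain _⟩ (inv1 _ (hPmem x)) h0
      rw [h.apply_mk] at this
      exact this.le
  have neg : ∀ x, (⟪S (x - P x), x⟫_ℂ).re ≤ 0 := by
    intro x
    have e : ⟪S (x - P x), x⟫_ℂ = ⟪S (x - P x), x - P x⟫_ℂ := by
      rw [← sub_eq_zero, ← inner_sub_right, sub_sub_cancel,
        Submodule.inner_left_of_mem_orthogonal (hPmem x) (inv2 _ (hQmem x))]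
    rw [e]
    have := hK.nonpos ⟨S (x - P x), h.mem_domain _⟩ (inv2 _ (hQmem x))
    rw [h.apply_mk] at this
    exact this
  have comm : Commute S P := by
    ext x
    change S (P x) = P (S x)
    conv_rhs => rw [← add_sub_cancel (P x) x, map_add, map_add, hPK _ (inv1 _ (hPmem x)),
      hPO _ (inv2 _ (hQmem x)), add_zero]
  have hSP : IsSelfAdjoint (S * P) :=
    (h.isSelfAdjoint.commute_iff (isSelfAdjoint_starProjection K)).1 comm
  have p1 : (0 : H →L[ℂ] H) ≤ S * P :=
    (ContinuousLinearMap.nonneg_iff_isPositive _).2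
      (ContinuousLinearMap.isPositive_def'.2 ⟨hSP, fun x => pos x⟩)
  have p2 : (0 : H →L[ℂ] H) ≤ S * P - S := by
    refine (ContinuousLinearMap.nonneg_iff_isPositive _).2
      (ContinuousLinearMap.isPositive_def'.2 ⟨hSP.sub h.isSelfAdjoint, fun x => ?_⟩)
    have e : (S * P - S) x = -S (x - P x) := by
      simp [map_sub]
    rw [ContinuousLinearMap.reApplyInnerSelf_apply, e, inner_neg_left, map_neg]
    exact neg_nonneg.2 (neg x)
  have hmul : (S * P) * (S * P - S) = 0 := by
    ext x
    have e : (S * P - S) x = -S (x - P x) := by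
      simp [map_sub]
    rw [mul_apply_eq_comp, e, mul_apply_eq_comp, map_neg,
      hPO _ (inv2 _ (hQmem x))]
    simp
  have key := (CFC.posPart_negPart_unique (a := S) (by abel) hmul p1 p2).2
  ext x
  rw [key, LinearMap.mem_ker]
  have e : (S * P - S) x = -S (x - P x) := by
    simp [map_sub]
  change _ ↔ (S * P - S) x = 0
  rw [e, neg_eq_zero]
  constructor
  · intro hx; rw [hPK x hx, sub_self, map_zero]
  · intro hx
    have := h.injective hx
    rw [sub_eq_zero] at this
    rw [this]; exact hPmem x

theorem existsUnique_isPositiveSpectralSubspace (h : HasSelfAdjointInverse A S) :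
    ∃! K, IsPositiveSpectralSubspace A K :=
  ⟨_, h.isPositiveSpectralSubspace_ker, fun _ hK => h.eq_ker_of_isPositiveSpectralSubspace hK⟩

end HasSelfAdjointInverse

end OperatorsWithBoundedInverse

/-! ### Positive parts of orthogonal sums -/

section PositivePart

variable {H : Type*} [NormedAddCommGroup H] [InnerProductSpace ℂ H] [CompleteSpace H]

/-- The projection in the definition of the positive part has no effect, since the spectral subspace
is invariant. -/
theorem mem_graph_positivePart {A : H →ₗ.[ℂ] H} (h : ∃ K, IsPositiveSpectralSubspace A K)
    (x y : positiveSpectralSubspace A) :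
    (x, y) ∈ (positivePart A).graph ↔ ((x : H), (y : H)) ∈ A.graph := by
  have hK := isPositiveSpectralSubspace_positiveSpectralSubspace h
  rw [LinearPMap.mem_graph_iff, LinearPMap.mem_graph_iff]
  constructor
  · rintro ⟨w, hw, hy⟩
    obtain rfl : (w : positiveSpectralSubspace A) = x := hw
    refine ⟨⟨((w : positiveSpectralSubspace A) : H), w.2⟩, rfl, ?_⟩
    have h1 : A ⟨((w : positiveSpectralSubspace A) : H), w.2⟩ ∈ positiveSpectralSubspace A :=
      hK.apply_mem (w : positiveSpectralSubspace A).2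
    have h2 := congrArg (fun v : positiveSpectralSubspace A => (v : H)) hy
    refine Eq.trans ?_ h2
    exact (Submodule.starProjection_eq_self_iff.2 h1).symm
  · rintro ⟨w, hw, hy⟩
    have hw' : (x : H) ∈ A.domain := by
      change (w : H) = x at hw
      exact hw ▸ w.2
    obtain rfl : w = ⟨x, hw'⟩ := Subtype.ext hw
    refine ⟨⟨x, hw'⟩, rfl, Subtype.ext ?_⟩
    refine Eq.trans ?_ hy
    exact Submodule.starProjection_eq_self_iff.2 (hK.apply_mem x.2)

theorem mem_graph_positivePartExtended {A : H →ₗ.[ℂ] H}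
    (h : ∃ K, IsPositiveSpectralSubspace A K) (x y : H) :
    (x, y) ∈ (positivePartExtended A).graph ↔
      ((positiveSpectralSubspace A).starProjection x, y) ∈ A.graph := by
  have hK := isPositiveSpectralSubspace_positiveSpectralSubspace h
  rw [LinearPMap.mem_graph_iff, LinearPMap.mem_graph_iff]
  constructor
  · rintro ⟨w, rfl, hy⟩
    refine ⟨⟨_, w.2⟩, rfl, Eq.trans ?_ hy⟩
    exact (Submodule.starProjection_eq_self_iff.2
      (hK.apply_mem (x := ⟨_, w.2⟩) (Submodule.starProjection_apply_mem _ _))).symm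
  · rintro ⟨w, hw, hy⟩
    have hw' : (positiveSpectralSubspace A).starProjection x ∈ A.domain := by
      change (w : H) = (positiveSpectralSubspace A).starProjection x at hw
      rw [← hw]
      exact w.2
    obtain rfl : w = ⟨_, hw'⟩ := Subtype.ext hw
    refine ⟨⟨x, hw'⟩, rfl, Eq.trans ?_ hy⟩
    exact Submodule.starProjection_eq_self_iff.2
      (hK.apply_mem (x := ⟨_, hw'⟩) (Submodule.starProjection_apply_mem _ _))

end PositivePart

theorem memℓp_two_of_norm_le {ι : Type*} {E F : ι → Type*} [∀ i, NormedAddCommGroup (E i)]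
    [∀ i, NormedAddCommGroup (F i)] (x : lp E 2)
    {f : ∀ i, F i} (C : ℝ) (h : ∀ i, ‖f i‖ ≤ C * ‖x i‖) : Memℓp f 2 := by
  refine memℓp_gen ?_
  have hx := (lp.memℓp x).summable (by norm_num)
  refine Summable.of_nonneg_of_le (fun i => by positivity) (fun i => ?_)
    (hx.mul_left (C ^ (2 : ℝ≥0∞).toReal))
  have h2 : (2 : ℝ≥0∞).toReal = ((2 : ℕ) : ℝ) := by norm_num
  simp only [h2, Real.rpow_natCast, ← mul_pow]
  exact pow_le_pow_left₀ (norm_nonneg _) (h i) 2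

section OrthogonalSum

variable {ι : Type*} {E : ι → Type*} [∀ i, NormedAddCommGroup (E i)]
  [∀ i, InnerProductSpace ℂ (E i)]

theorem mem_graph_orthogonalSum (A : ∀ i, E i →ₗ.[ℂ] E i) (x y : lp E 2) :
    (x, y) ∈ (orthogonalSum A).graph ↔ ∀ i, (x i, y i) ∈ (A i).graph := by
  rw [orthogonalSum, Submodule.toLinearPMap_graph_eq _
    (fun z hz h0 => orthogonalSumGraph_functional A z hz h0)]
  rfl

/-- The bounded operator that acts as `T i` in the `i`-th summand of a Hilbert space sum. -/
noncomputable def lpDiagonal (T : ∀ i, E i →L[ℂ] E i) (C : ℝ) (hT : ∀ i, ‖T i‖ ≤ C) :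
    lp E 2 →L[ℂ] lp E 2 :=
  LinearMap.mkContinuous
    { toFun := fun x => ⟨fun i => T i (x i), memℓp_two_of_norm_le x C fun i =>
        ((T i).le_opNorm _).trans (mul_le_mul_of_nonneg_right (hT i) (norm_nonneg _))⟩
      map_add' := fun x y => lp.ext (funext fun i => map_add (T i) _ _)
      map_smul' := fun a x => lp.ext (funext fun i => map_smul (T i) _ _) } |C| (by
    intro x
    have h2 : (2 : ℝ≥0∞).toReal = ((2 : ℕ) : ℝ) := by norm_num
    refine lp.norm_le_of_tsum_le (by norm_num) (by positivity) ?_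
    have hx := lp.hasSum_norm (p := 2) (by norm_num) x
    simp only [h2, Real.rpow_natCast] at hx ⊢
    rw [mul_pow, ← (hx.mul_left _).tsum_eq]
    have key : ∀ i, ‖T i (x i)‖ ^ 2 ≤ |C| ^ 2 * ‖x i‖ ^ 2 := fun i => by
      rw [← mul_pow]
      refine pow_le_pow_left₀ (norm_nonneg _) (((T i).le_opNorm _).trans ?_) 2
      exact mul_le_mul_of_nonneg_right ((hT i).trans (le_abs_self _)) (norm_nonneg _)
    exact Summable.tsum_le_tsum key
      (Summable.of_nonneg_of_le (fun i => by positivity) key (hx.mul_left _).summable)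
      (hx.mul_left _).summable)

theorem mem_orthogonal_comap_iff {H : Type*} [NormedAddCommGroup H] [InnerProductSpace ℂ H]
    (U : H ≃ₗᵢ[ℂ] lp E 2) {K : Submodule ℂ H} {L : ∀ i, Submodule ℂ (E i)}
    (hKL : ∀ x, x ∈ K ↔ ∀ i, U x i ∈ L i) (x : H) : x ∈ Kᗮ ↔ ∀ i, U x i ∈ (L i)ᗮ := by
  classical
  constructor
  · intro hx i
    rw [Submodule.mem_orthogonal]
    intro v hv
    have h1 : U.symm (lp.single 2 i v) ∈ K := by
      rw [hKL]
      intro j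
      rw [U.apply_symm_apply]
      by_cases hij : j = i
      · subst hij; rwa [lp.single_apply_self]
      · rw [lp.single_apply_ne _ _ _ hij]; exact zero_mem _
    have h2 := Submodule.inner_right_of_mem_orthogonal h1 hx
    rwa [← U.inner_map_map, U.apply_symm_apply, lp.inner_single_left] at h2
  · intro hx
    rw [Submodule.mem_orthogonal]
    intro v hv
    rw [← U.inner_map_map, lp.inner_eq_tsum]
    exact (tsum_congr fun i =>
      Submodule.inner_right_of_mem_orthogonal ((hKL v).1 hv i) (hx i)).trans tsum_zero

variable [∀ i, CompleteSpace (E i)]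
variable {H : Type*} [NormedAddCommGroup H] [InnerProductSpace ℂ H]
variable {A : ∀ i, E i →ₗ.[ℂ] E i} {D : H →ₗ.[ℂ] H} (U : H ≃ₗᵢ[ℂ] lp E 2)

/-- If the operators `A i` have uniformly bounded inverses, then every operator that is unitarily
equivalent to their orthogonal sum has a bounded inverse. -/
theorem exists_hasSelfAdjointInverse_of_orthogonalSum [CompleteSpace H]
    (hU : ∀ x y, (x, y) ∈ D.graph ↔ ∀ i, (U x i, U y i) ∈ (A i).graph)
    {S : ∀ i, E i →L[ℂ] E i} (hS : ∀ i, HasSelfAdjointInverse (A i) (S i))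
    (C : ℝ) (hC : ∀ i, ‖S i‖ ≤ C) : ∃ T : H →L[ℂ] H, HasSelfAdjointInverse D T := by
  refine ⟨(U.symm : lp E 2 →L[ℂ] H) ∘L lpDiagonal S C hC ∘L (U : H →L[ℂ] lp E 2), ?_, ?_⟩
  · rw [ContinuousLinearMap.isSelfAdjoint_iff_isSymmetric]
    intro x y
    change ⟪U.symm (lpDiagonal S C hC (U x)), y⟫_ℂ = ⟪x, U.symm (lpDiagonal S C hC (U y))⟫_ℂ
    rw [← U.inner_map_map, ← U.inner_map_map x, U.apply_symm_apply, U.apply_symm_apply,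
      lp.inner_eq_tsum, lp.inner_eq_tsum]
    exact tsum_congr fun i => (hS i).inner_comm _ _
  · intro x y
    rw [hU]
    change _ ↔ U.symm (lpDiagonal S C hC (U y)) = x
    rw [LinearIsometryEquiv.symm_apply_eq]
    constructor
    · intro h
      exact lp.ext (funext fun i => ((hS i).mem_graph_iff _ _).1 (h i))
    · intro h i
      rw [(hS i).mem_graph_iff, ← h]
      rfl

/-- The positive spectral subspace of an orthogonal sum is the sum of those of the summands. -/
theorem isPositiveSpectralSubspace_of_orthogonalSum
    (hU : ∀ x y, (x, y) ∈ D.graph ↔ ∀ i, (U x i, U y i) ∈ (A i).graph)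
    {L : ∀ i, Submodule ℂ (E i)} (hL : ∀ i, IsPositiveSpectralSubspace (A i) (L i))
    {K : Submodule ℂ H} (hKL : ∀ x, x ∈ K ↔ ∀ i, U x i ∈ L i) :
    IsPositiveSpectralSubspace D K := by
  have hcomp : ∀ i, CompleteSpace (L i) := fun i => (hL i).isClosed.completeSpace_coe
  have hO := mem_orthogonal_comap_iff U hKL
  have hdom : ∀ x : D.domain, ∀ i, U x i ∈ (A i).domain := fun x i =>
    LinearPMap.mem_domain_of_mem_graph ((hU _ _).1 (D.mem_graph x) i)
  have happ : ∀ (x : D.domain) i, A i ⟨U x i, hdom x i⟩ = U (D x) i := fun x i =>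
    (((A i).image_iff (hdom x i)).2 ((hU _ _).1 (D.mem_graph x) i)).symm
  have hinner : ∀ x : D.domain, HasSum
      (fun i => (⟪U x i, A i ⟨U x i, hdom x i⟩⟫_ℂ).re) (⟪(x : H), D x⟫_ℂ).re := by
    intro x
    rw [← U.inner_map_map]
    simp only [happ]
    exact Complex.hasSum_re (lp.hasSum_inner (U x) (U (D x)))
  refine ⟨?_, ?_, ?_, ?_⟩
  · have : (K : Set H) = ⋂ i, (fun x => U x i) ⁻¹' (L i : Set (E i)) := by
      ext x; simp [hKL]
    rw [this]
    refine isClosed_iInter fun i => (hL i).isClosed.preimage ?_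
    exact (lp.evalCLM ℂ E (p := 2) i).continuous.comp U.continuous
  · intro x
    have hm : ∀ z : lp E 2, Memℓp (fun i => (L i).starProjection (z i)) 2 := fun z =>
      memℓp_two_of_norm_le z 1 fun i => by
        rw [one_mul]; exact (L i).norm_starProjection_apply_le _
    -- The projection onto each summand of the subspace commutes with the operator.
    have hgr : ∀ i, ((L i).starProjection (U x i), (L i).starProjection (U (D x) i)) ∈
        (A i).graph := by
      intro i
      obtain ⟨y, z, e, hy, hAy, hz, hAz⟩ := (hL i).reduces ⟨U x i, hdom x i⟩
      have e1 : U x i = y + z := congrArg Subtype.val e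
      have e2 : U (D x) i = A i y + A i z := by
        rw [← happ, e, LinearPMap.map_add]
      rw [e1, e2, map_add, map_add, Submodule.starProjection_eq_self_iff.2 hy,
        Submodule.starProjection_eq_self_iff.2 hAy,
        (Submodule.starProjection_apply_eq_zero_iff _).2 hz,
        (Submodule.starProjection_apply_eq_zero_iff _).2 hAz, add_zero, add_zero]
      exact (A i).mem_graph y
    set y : H := U.symm ⟨_, hm (U x)⟩ with hy
    set y' : H := U.symm ⟨_, hm (U (D x))⟩ with hy'
    have hUy : ∀ i, U y i = (L i).starProjection (U x i) := fun i => by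
      rw [hy, U.apply_symm_apply]
    have hUy' : ∀ i, U y' i = (L i).starProjection (U (D x) i) := fun i => by
      rw [hy', U.apply_symm_apply]
    have hg : (y, y') ∈ D.graph := by
      rw [hU]
      intro i
      rw [hUy, hUy']
      exact hgr i
    have hyd : y ∈ D.domain := LinearPMap.mem_domain_of_mem_graph hg
    have hDy : D ⟨y, hyd⟩ = y' := ((D.image_iff hyd).2 hg).symm
    refine ⟨⟨y, hyd⟩, x - ⟨y, hyd⟩, by abel, ?_, ?_, ?_, ?_⟩
    · rw [hKL]; intro i; rw [hUy]; exact Submodule.starProjection_apply_mem _ _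
    · rw [hDy, hKL]; intro i; rw [hUy']; exact Submodule.starProjection_apply_mem _ _
    · rw [hO]
      intro i
      have : U ((x - ⟨y, hyd⟩ : D.domain) : H) i = U x i - (L i).starProjection (U x i) := by
        rw [← hUy]
        change U ((x : H) - y) i = _
        rw [map_sub]; rfl
      rw [this]
      exact Submodule.sub_starProjection_mem_orthogonal _
    · rw [hO]
      intro i
      have : U (D (x - ⟨y, hyd⟩)) i = U (D x) i - (L i).starProjection (U (D x) i) := by
        rw [← hUy', LinearPMap.map_sub, hDy, map_sub]; rfl
      rw [this]
      exact Submodule.sub_starProjection_mem_orthogonal _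
  · intro x hx hx0
    have hnn : ∀ i, 0 ≤ (⟪U x i, A i ⟨U x i, hdom x i⟩⟫_ℂ).re := by
      intro i
      by_cases h0 : U x i = 0
      · have : ⟪U x i, A i ⟨U x i, hdom x i⟩⟫_ℂ = 0 :=
          (congrArg (fun v => ⟪v, A i ⟨U x i, hdom x i⟩⟫_ℂ) h0).trans (inner_zero_left _)
        rw [this, Complex.zero_re]
      · exact ((hL i).pos ⟨U x i, hdom x i⟩ ((hKL _).1 hx i) h0).le
    obtain ⟨i, hi⟩ : ∃ i, U x i ≠ 0 := by
      by_contra! hcon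
      exact hx0 (U.map_eq_zero_iff.1 (lp.ext (funext hcon)))
    rw [← (hinner x).tsum_eq]
    exact (hinner x).summable.tsum_pos hnn i
      ((hL i).pos ⟨U x i, hdom x i⟩ ((hKL _).1 hx i) hi)
  · intro x hx
    rw [← (hinner x).tsum_eq]
    exact tsum_nonpos fun i => (hL i).nonpos ⟨U x i, hdom x i⟩ ((hO _).1 hx i)

/-- A unitary operator onto a Hilbert space sum restricts to the subspace of those vectors whose
components lie in given subspaces of the summands. -/
noncomputable def LinearIsometryEquiv.restrictLp (K : Submodule ℂ H) (L : ∀ i, Submodule ℂ (E i))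
    (hKL : ∀ x, x ∈ K ↔ ∀ i, U x i ∈ L i) : K ≃ₗᵢ[ℂ] lp (fun i => L i) 2 where
  toFun x := ⟨fun i => ⟨U x i, (hKL x).1 x.2 i⟩,
    memℓp_two_of_norm_le (U x) 1 fun i => by rw [one_mul]; rfl⟩
  map_add' x y := lp.ext (funext fun i => Subtype.ext (by
    change U ((x : H) + y) i = U x i + U y i
    rw [map_add]; rfl))
  map_smul' a x := lp.ext (funext fun i => Subtype.ext (by
    change U (a • (x : H)) i = a • U x i
    rw [map_smul]; rfl))
  invFun y := ⟨U.symm ⟨fun i => (y i : E i), memℓp_two_of_norm_le y 1 fun i => by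
      rw [one_mul]; rfl⟩, by
    rw [hKL]
    intro i
    rw [U.apply_symm_apply]
    exact (y i).2⟩
  left_inv x := Subtype.ext (U.symm_apply_apply x)
  right_inv y := lp.ext (funext fun i => Subtype.ext (by
    change U (U.symm _) i = _
    rw [U.apply_symm_apply]))
  norm_map' x := by
    change _ = ‖(x : H)‖
    rw [← U.norm_map, lp.norm_eq_tsum_rpow (by norm_num), lp.norm_eq_tsum_rpow (by norm_num)]
    rfl

variable (hU : ∀ x y, (x, y) ∈ D.graph ↔ ∀ i, (U x i, U y i) ∈ (A i).graph)
  (hA : ∀ i, ∃ K, IsPositiveSpectralSubspace (A i) K)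
  (hD : ∃! K, IsPositiveSpectralSubspace D K)

include hU hA hD

/-- The sum of the positive spectral subspaces of the summands has the defining properties, hence it
is the positive spectral subspace by uniqueness. -/
theorem mem_positiveSpectralSubspace_iff_of_orthogonalSum (x : H) :
    x ∈ positiveSpectralSubspace D ↔ ∀ i, U x i ∈ positiveSpectralSubspace (A i) := by
  let K : Submodule ℂ H :=
    { carrier := {x | ∀ i, U x i ∈ positiveSpectralSubspace (A i)}
      add_mem' := fun hx hy i => by
        rw [map_add]; exact add_mem (hx i) (hy i)
      zero_mem' := fun i => by rw [map_zero]; exact zero_mem _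
      smul_mem' := fun a x hx i => by
        rw [map_smul]; exact Submodule.smul_mem _ a (hx i) }
  have h1 : IsPositiveSpectralSubspace D K := isPositiveSpectralSubspace_of_orthogonalSum U hU
    (fun i => isPositiveSpectralSubspace_positiveSpectralSubspace (hA i)) fun x => Iff.rfl
  rw [hD.unique (isPositiveSpectralSubspace_positiveSpectralSubspace hD.exists) h1]
  rfl

theorem unitarilyEquivalent_positivePart_of_orthogonalSum [CompleteSpace H] :
    UnitarilyEquivalent (positivePart D) (orthogonalSum fun i => positivePart (A i)) := by
  refine ⟨U.restrictLp _ _ (mem_positiveSpectralSubspace_iff_of_orthogonalSum U hU hA hD),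
    fun x y => ?_⟩
  rw [mem_graph_positivePart hD.exists, mem_graph_orthogonalSum, hU]
  exact forall_congr' fun i => (mem_graph_positivePart (hA i)
    (U.restrictLp _ _ (mem_positiveSpectralSubspace_iff_of_orthogonalSum U hU hA hD) x i)
    (U.restrictLp _ _ (mem_positiveSpectralSubspace_iff_of_orthogonalSum U hU hA hD) y i)).symm

theorem unitarilyEquivalent_positivePartExtended_of_orthogonalSum [CompleteSpace H] :
    UnitarilyEquivalent (positivePartExtended D)
      (orthogonalSum fun i => positivePartExtended (A i)) := by
  have hmem := mem_positiveSpectralSubspace_iff_of_orthogonalSum U hU hA hD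
  refine ⟨U, fun x y => ?_⟩
  rw [mem_graph_positivePartExtended hD.exists, mem_graph_orthogonalSum, hU]
  refine forall_congr' fun i => ?_
  rw [mem_graph_positivePartExtended (hA i)]
  have : U ((positiveSpectralSubspace D).starProjection x) i =
      (positiveSpectralSubspace (A i)).starProjection (U x i) := by
    refine (Submodule.eq_starProjection_of_mem_orthogonal
      (K := positiveSpectralSubspace (A i)) ?_ ?_).symm
    · exact (hmem _).1 (Submodule.starProjection_apply_mem _ x) i
    · have := (mem_orthogonal_comap_iff U hmem _).1
        (Submodule.sub_starProjection_mem_orthogonal (K := positiveSpectralSubspace D) x) i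
      rwa [map_sub] at this
  rw [this]

end OrthogonalSum

/-! ### Self-adjoint inverses from test pairs; primitives -/

section InverseFromTestPairs

variable {H : Type*} [NormedAddCommGroup H] [InnerProductSpace ℂ H] [CompleteSpace H]

/-- An operator `A` that is the adjoint of its restriction to a set `G` of test pairs, has trivial
kernel and anticommutes, up to the multiple `2 m` of the identity, with a symmetric contraction `β`
is the inverse of a bounded self-adjoint operator. The relation with `β` gives
`m ‖x‖² = Re ⟪β x, A x⟫ ≤ ‖x‖ ‖A x‖` for the test pairs, hence the bound for the inverse. -/
theorem exists_hasSelfAdjointInverse_of_testPairs (A : H →ₗ.[ℂ] H) (G : Set (H × H))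
    (hGA : ∀ z ∈ G, z ∈ A.graph)
    (hpair : ∀ x ∈ A.graph, ∀ z ∈ G, ⟪x.1, z.2⟫_ℂ = ⟪x.2, z.1⟫_ℂ)
    (hadj : ∀ x y, (∀ z ∈ G, ⟪x, z.2⟫_ℂ = ⟪y, z.1⟫_ℂ) → (x, y) ∈ A.graph)
    (hker : ∀ x, (x, (0 : H)) ∈ A.graph → x = 0)
    (β : H →L[ℂ] H) (hβ : ∀ x y, ⟪β x, y⟫_ℂ = ⟪x, β y⟫_ℂ) (hβn : ∀ x, ‖β x‖ ≤ ‖x‖)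
    {m : ℝ} (hm : 0 < m)
    (hGβ : ∀ z ∈ G, (β z.1, ((2 * m : ℝ) : ℂ) • z.1 - β z.2) ∈ G) :
    ∃ S : H →L[ℂ] H, HasSelfAdjointInverse A S ∧ ‖S‖ ≤ m⁻¹ := by
  -- All hypotheses on the test pairs extend to their linear span.
  set G' : Submodule ℂ (H × H) := Submodule.span ℂ G with hG'
  have hG'A : G' ≤ A.graph := Submodule.span_le.2 hGA
  have hpair' : ∀ x ∈ A.graph, ∀ z ∈ G', ⟪x.1, z.2⟫_ℂ = ⟪x.2, z.1⟫_ℂ := by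
    intro x hx z hz
    induction hz using Submodule.span_induction with
    | mem z hz => exact hpair x hx z hz
    | zero => simp
    | add z w _ _ h1 h2 => simp [h1, h2]
    | smul a z _ h1 => simp [h1]
  have hβ' : ∀ z ∈ G', (β z.1, ((2 * m : ℝ) : ℂ) • z.1 - β z.2) ∈ G' := by
    intro z hz
    induction hz using Submodule.span_induction with
    | mem z hz => exact Submodule.subset_span (hGβ z hz)
    | zero => simp only [Prod.fst_zero, Prod.snd_zero, map_zero, smul_zero, sub_zero]; exact zero_mem _
    | add z w _ _ h1 h2 =>
      convert add_mem h1 h2 using 1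
      simp only [Prod.fst_add, Prod.snd_add, map_add, smul_add, Prod.mk_add_mk]
      congr 1; abel
    | smul a z _ h1 =>
      convert Submodule.smul_mem _ a h1 using 1
      simp only [Prod.smul_fst, Prod.smul_snd, map_smul, Prod.smul_mk, smul_sub]
      rw [smul_comm]
  have hbound : ∀ z ∈ G', m * ‖z.1‖ ≤ ‖z.2‖ := by
    intro z hz
    have h1 := hpair' z (hG'A hz) _ (hβ' z hz)
    have h2 : m * ‖z.1‖ ^ 2 = (⟪z.2, β z.1⟫_ℂ).re := by
      have h3 : ⟪z.1, β z.2⟫_ℂ = (starRingEnd ℂ) ⟪z.2, β z.1⟫_ℂ := by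
        rw [inner_conj_symm, hβ]
      simp only [inner_sub_right, inner_smul_right, h3] at h1
      have h4 := congrArg Complex.re h1
      rw [Complex.sub_re, Complex.re_ofReal_mul, Complex.conj_re] at h4
      have h5 : (⟪z.1, z.1⟫_ℂ).re = ‖z.1‖ ^ 2 := inner_self_eq_norm_sq (𝕜 := ℂ) z.1
      rw [h5] at h4
      linarith
    have h6 : (⟪z.2, β z.1⟫_ℂ).re ≤ ‖z.2‖ * ‖z.1‖ :=
      (re_inner_le_norm (𝕜 := ℂ) _ _).trans
        (mul_le_mul_of_nonneg_left (hβn _) (norm_nonneg _))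
    rcases (norm_nonneg z.1).eq_or_lt with h0 | h0
    · rw [← h0, mul_zero]; exact norm_nonneg _
    · refine le_of_mul_le_mul_right ?_ h0
      nlinarith
  let e : G' →ₗ[ℂ] H := (LinearMap.snd ℂ H H).comp G'.subtype
  let f : G' →ₗ[ℂ] H := (LinearMap.fst ℂ H H).comp G'.subtype
  -- The second components are dense: a vector orthogonal to them lies in the kernel of `A`.
  have hdense : DenseRange e := by
    have : Dense ((LinearMap.range e : Submodule ℂ H) : Set H) := by
      rw [Submodule.dense_iff_topologicalClosure_eq_top,
        Submodule.topologicalClosure_eq_top_iff, Submodule.eq_bot_iff]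
      intro x hx
      refine hker x (hadj x 0 fun z hz => ?_)
      rw [inner_zero_left]
      exact Submodule.inner_left_of_mem_orthogonal
        (LinearMap.mem_range.2 ⟨⟨z, Submodule.subset_span hz⟩, rfl⟩) hx
    rwa [LinearMap.coe_range] at this
  have hnorm : ∀ z : G', ‖f z‖ ≤ m⁻¹ * ‖e z‖ := fun z => by
    rw [← div_eq_inv_mul, le_div_iff₀' hm]; exact hbound z z.2
  set S : H →L[ℂ] H := f.extendOfNorm e with hS
  have hSe : ∀ z : G', S (e z) = f z := fun z =>
    f.extendOfNorm_eq hdense ⟨_, hnorm⟩ z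
  have hsymm : ∀ x y, ⟪S x, y⟫_ℂ = ⟪x, S y⟫_ℂ := by
    intro x y
    induction x using hdense.induction_on with
    | hp => exact isClosed_eq (by fun_prop) (by fun_prop)
    | ih z =>
      induction y using hdense.induction_on with
      | hp => exact isClosed_eq (by fun_prop) (by fun_prop)
      | ih w =>
        rw [hSe, hSe]
        exact hpair' z (hG'A z.2) w w.2
  refine ⟨S, ⟨(ContinuousLinearMap.isSelfAdjoint_iff_isSymmetric).2 hsymm, fun x y => ⟨fun h => ?_,
    ?_⟩⟩, f.opNorm_extendOfNorm_le hdense (inv_nonneg.2 hm.le) hnorm⟩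
  · refine Dense.eq_of_inner_right ℂ hdense ?_
    rintro _ ⟨z, rfl⟩
    have h1 := congrArg (starRingEnd ℂ) (hpair' (x, y) h z z.2)
    rw [inner_conj_symm, inner_conj_symm] at h1
    rw [← hsymm, hSe]
    exact h1.symm
  · rintro rfl
    refine hadj _ _ fun z hz => ?_
    have := hSe ⟨z, Submodule.subset_span hz⟩
    rw [hsymm]
    exact congrArg _ this

end InverseFromTestPairs

section IntegrationByParts

theorem absolutelyContinuousOnInterval_const {X : Type*} [PseudoMetricSpace X] (k : X) (a b : ℝ) :
    AbsolutelyContinuousOnInterval (fun _ : ℝ => k) a b :=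
  ((LipschitzWith.const (α := ℝ) k).lipschitzOnWith (s := uIcc a b)).absolutelyContinuousOnInterval

theorem absolutelyContinuousOnInterval_integral {F : Type*} [NormedAddCommGroup F]
    [NormedSpace ℝ F] {f : ℝ → F} {a b : ℝ} (hf : IntervalIntegrable f volume a b) :
    AbsolutelyContinuousOnInterval (fun x => ∫ y in a..x, f y) a b := by
  have hn := hf.norm.absolutelyContinuousOnInterval_intervalIntegral left_mem_uIcc
  rw [AbsolutelyContinuousOnInterval] at hn ⊢
  refine squeeze_zero' (Filter.Eventually.of_forall fun E => Finset.sum_nonneg fun i _ =>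
    dist_nonneg) ?_ hn
  rw [Filter.eventually_inf_principal]
  refine Filter.Eventually.of_forall fun E hE => Finset.sum_le_sum fun i hi => ?_
  have hx := hf.mono_set (uIcc_subset_uIcc_left (hE.1 i hi).1)
  have hy := hf.mono_set (uIcc_subset_uIcc_left (hE.1 i hi).2)
  rw [dist_comm, dist_comm (∫ y in a..(E.2 i).1, ‖f y‖), dist_eq_norm, dist_eq_norm,
    intervalIntegral.integral_interval_sub_left hy hx,
    intervalIntegral.integral_interval_sub_left hy.norm hx.norm, Real.norm_eq_abs]
  exact intervalIntegral.norm_integral_le_abs_integral_norm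

theorem continuousOn_primitive {f : ℝ → ℂ} {a b : ℝ}
    (hf : IntervalIntegrable f volume a b) (p : ℂ) :
    ContinuousOn (fun x => p + ∫ y in a..x, f y) (uIcc a b) :=
  continuousOn_const.add (intervalIntegral.continuousOn_primitive_interval' hf left_mem_uIcc)

/-- Integration by parts for primitives of integrable functions. -/
theorem primitive_mul_primitive {f g : ℝ → ℂ} {a b : ℝ}
    (hf : IntervalIntegrable f volume a b) (hg : IntervalIntegrable g volume a b) (p q : ℂ) :
    (p + ∫ y in a..b, f y) * (q + ∫ y in a..b, g y) =
      p * q + ∫ x in a..b, (f x * (q + ∫ y in a..x, g y) + (p + ∫ y in a..x, f y) * g x) := by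
  have hi : IntervalIntegrable
      (fun x => f x * (q + ∫ y in a..x, g y) + (p + ∫ y in a..x, f y) * g x) volume a b :=
    (hf.mul_continuousOn (continuousOn_primitive hg q)).add
      (hg.continuousOn_mul (continuousOn_primitive hf p))
  have hac := (((absolutelyContinuousOnInterval_const p a b).fun_add
    (absolutelyContinuousOnInterval_integral hf)).fun_smul
    ((absolutelyContinuousOnInterval_const q a b).fun_add
    (absolutelyContinuousOnInterval_integral hg))).sub
    (absolutelyContinuousOnInterval_integral hi)
  -- The difference of the two sides is absolutely continuous with derivative zero.
  obtain ⟨C, hC⟩ := hac.const_of_ae_hasDerivAt_zero (by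
    filter_upwards [hf.ae_hasDerivAt_integral, hg.ae_hasDerivAt_integral,
      hi.ae_hasDerivAt_integral] with x h1 h2 h3 hx
    have := (((h1 hx a left_mem_uIcc).const_add p).mul
      ((h2 hx a left_mem_uIcc).const_add q)).sub (h3 hx a left_mem_uIcc)
    rw [sub_eq_zero.2 rfl] at this
    exact this)
  have h1 := hC a left_mem_uIcc
  have h2 := hC b right_mem_uIcc
  simp only [Pi.sub_apply, smul_eq_mul, intervalIntegral.integral_same, add_zero, sub_zero] at h1 h2
  rw [h1, ← h2]
  ring

end IntegrationByParts

/-! ### Weighted primitives -/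

section WeightedPrimitives

/-- `I` is an interval `(a, h)` with `h ≤ ∞`, given as a countable union of the intervals
`(a, T]` with `T ∈ I`. -/
structure IsRightOpenInterval (a : ℝ) (I : Set ℝ) : Prop where
  subset_Ioi : I ⊆ Ioi a
  Ioc_subset : ∀ T ∈ I, Ioc a T ⊆ I
  exhaust : ∃ T : ℕ → ℝ, (∀ n, T n ∈ I) ∧ I ⊆ ⋃ n, Ioc a (T n)

/-- A positive measurable function that is bounded and bounded away from zero on every interval
`(a, T]` with `T ∈ I`. -/
structure IsLocalWeight (a : ℝ) (I : Set ℝ) (ρ : ℝ → ℝ) : Prop where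
  measurable : Measurable ρ
  pos : ∀ x, 0 < ρ x
  bounded : ∀ T ∈ I, ∃ M, ∀ x ∈ Ioc a T, ρ x ≤ M ∧ (ρ x)⁻¹ ≤ M

/-- Up to the weight `ρ`, the function `f` is the primitive of `g` with initial value `q`. -/
def IsWeightedPrimitive (a : ℝ) (I : Set ℝ) (ρ : ℝ → ℝ) (q : ℂ) (f g : ℝ → ℂ) : Prop :=
  ∀ᵐ x ∂volume.restrict I, f x = (ρ x : ℂ) * (q + ∫ y in a..x, (ρ y : ℂ)⁻¹ * g y)

variable {a : ℝ} {I : Set ℝ} {ρ : ℝ → ℝ}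

theorem IsRightOpenInterval.ae_of_forall_Ioc (hI : IsRightOpenInterval a I) {P : ℝ → Prop}
    (h : ∀ T ∈ I, ∀ᵐ x ∂volume.restrict (Ioc a T), P x) : ∀ᵐ x ∂volume.restrict I, P x := by
  obtain ⟨T, hT, hsub⟩ := hI.exhaust
  exact ae_restrict_of_ae_restrict_of_subset hsub
    ((ae_restrict_iUnion_iff _ _).2 fun n => h (T n) (hT n))

theorem IsRightOpenInterval.measurableSet (hI : IsRightOpenInterval a I) : MeasurableSet I := by
  obtain ⟨T, hT, hsub⟩ := hI.exhaust
  rw [show I = ⋃ n, Ioc a (T n) from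
    subset_antisymm hsub (iUnion_subset fun n => hI.Ioc_subset _ (hT n))]
  exact MeasurableSet.iUnion fun n => measurableSet_Ioc

theorem IsRightOpenInterval.restrict_le (hI : IsRightOpenInterval a I) {T : ℝ} (hT : T ∈ I) :
    volume.restrict (Ioc a T) ≤ volume.restrict I :=
  Measure.restrict_mono (hI.Ioc_subset T hT) le_rfl

theorem IsLocalWeight.inv (h : IsLocalWeight a I ρ) : IsLocalWeight a I fun x => (ρ x)⁻¹ where
  measurable := h.measurable.inv
  pos x := inv_pos.2 (h.pos x)
  bounded T hT := by
    obtain ⟨M, hM⟩ := h.bounded T hT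
    exact ⟨M, fun x hx => ⟨(hM x hx).2, by rw [inv_inv]; exact (hM x hx).1⟩⟩

theorem IsLocalWeight.ne_zero (h : IsLocalWeight a I ρ) (x : ℝ) : (ρ x : ℂ) ≠ 0 :=
  Complex.ofReal_ne_zero.2 (h.pos x).ne'

theorem IsLocalWeight.memLp_mul (h : IsLocalWeight a I ρ) {T : ℝ} (hT : T ∈ I) {p : ℝ≥0∞}
    {f : ℝ → ℂ} (hf : MemLp f p (volume.restrict (Ioc a T))) :
    MemLp (fun x => (ρ x : ℂ) * f x) p (volume.restrict (Ioc a T)) := by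
  obtain ⟨M, hM⟩ := h.bounded T hT
  refine MemLp.of_le_mul (c := M) hf
    (((Complex.measurable_ofReal.comp h.measurable).aestronglyMeasurable).mul
      hf.aestronglyMeasurable) ?_
  filter_upwards [ae_restrict_mem measurableSet_Ioc] with x hx
  rw [norm_mul, Complex.norm_real, Real.norm_of_nonneg (h.pos x).le]
  exact mul_le_mul_of_nonneg_right (hM x hx).1 (norm_nonneg _)

theorem IsLocalWeight.memLp_inv_mul (h : IsLocalWeight a I ρ) {T : ℝ} (hT : T ∈ I) {p : ℝ≥0∞}
    {f : ℝ → ℂ} (hf : MemLp f p (volume.restrict (Ioc a T))) :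
    MemLp (fun x => (ρ x : ℂ)⁻¹ * f x) p (volume.restrict (Ioc a T)) := by
  simpa using h.inv.memLp_mul hT hf

theorem intervalIntegrable_of_memLp_two {a T : ℝ} (haT : a ≤ T) {f : ℝ → ℂ}
    (hf : MemLp f 2 (volume.restrict (Ioc a T))) : IntervalIntegrable f volume a T := by
  rw [intervalIntegrable_iff_integrableOn_Ioc_of_le haT]
  exact hf.integrable (by norm_num)

theorem memLp_of_continuousOn {a T : ℝ} {p : ℝ≥0∞} {f : ℝ → ℂ} (hf : ContinuousOn f (Icc a T)) :
    MemLp f p (volume.restrict (Ioc a T)) := by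
  obtain ⟨M, hM⟩ := isCompact_Icc.exists_bound_of_continuousOn hf
  refine MemLp.of_bound
    ((hf.mono Ioc_subset_Icc_self).aestronglyMeasurable measurableSet_Ioc) M ?_
  filter_upwards [ae_restrict_mem measurableSet_Ioc] with x hx
  exact hM x (Ioc_subset_Icc_self hx)

theorem IsLocalWeight.memLp_primitive (h : IsLocalWeight a I ρ) {T : ℝ} (hT : T ∈ I) (haT : a ≤ T)
    {g : ℝ → ℂ} (hg : MemLp g 2 (volume.restrict (Ioc a T))) (q : ℂ) :
    MemLp (fun x => (ρ x : ℂ) * (q + ∫ y in a..x, (ρ y : ℂ)⁻¹ * g y)) 2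
      (volume.restrict (Ioc a T)) := by
  refine h.memLp_mul hT (memLp_of_continuousOn ?_)
  rw [← uIcc_of_le haT]
  exact continuousOn_primitive (intervalIntegrable_of_memLp_two haT (h.memLp_inv_mul hT hg)) q

/-- Integration by parts for weighted primitives with reciprocal weights, when the boundary terms
vanish. -/
theorem IsLocalWeight.integral_conj_mul_add_eq_zero (h : IsLocalWeight a I ρ) {T : ℝ} (hT : T ∈ I)
    (haT : a ≤ T) {p q : ℂ} (hpq : p = 0 ∨ q = 0) {u v f g : ℝ → ℂ}
    (hv : MemLp v 2 (volume.restrict (Ioc a T))) (hg : MemLp g 2 (volume.restrict (Ioc a T)))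
    (hu : ∀ᵐ x ∂volume.restrict (Ioc a T), u x = (ρ x : ℂ)⁻¹ * (p + ∫ y in a..x, (ρ y : ℂ) * v y))
    (hf : ∀ᵐ x ∂volume.restrict (Ioc a T), f x = (ρ x : ℂ) * (q + ∫ y in a..x, (ρ y : ℂ)⁻¹ * g y))
    (hfT : q + ∫ y in a..T, (ρ y : ℂ)⁻¹ * g y = 0) :
    ∫ x in Ioc a T, (conj (u x) * g x + conj (v x) * f x) = 0 := by
  have i1 : IntervalIntegrable (fun y => conj ((ρ y : ℂ) * v y)) volume a T := by
    have := intervalIntegrable_of_memLp_two haT (h.memLp_mul hT hv).star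
    exact this
  have i2 := intervalIntegrable_of_memLp_two haT (h.memLp_inv_mul hT hg)
  have key := primitive_mul_primitive i1 i2 (conj p) q
  rw [hfT, mul_zero, show conj p * q = 0 by rcases hpq with rfl | rfl <;> simp, zero_add,
    intervalIntegral.integral_of_le haT] at key
  rw [key]
  refine integral_congr_ae ?_
  filter_upwards [hu, hf, ae_restrict_mem measurableSet_Ioc] with x e1 e2 hx
  have e3 : (∫ y in a..x, conj ((ρ y : ℂ) * v y)) = conj (∫ y in a..x, (ρ y : ℂ) * v y) := by
    rw [intervalIntegral.integral_of_le hx.1.le, intervalIntegral.integral_of_le hx.1.le]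
    exact integral_conj
  have hne := h.ne_zero x
  rw [e1, e2, e3]
  simp only [map_mul, map_add, Complex.conj_ofReal, map_inv₀]
  field_simp
  ring

end WeightedPrimitives

section DuBoisReymond

variable {a : ℝ} {I : Set ℝ} {ρ : ℝ → ℝ}

/-- A weighted du Bois-Reymond lemma. The only test function needed is the weighted primitive of the
difference `W` of `u` and the candidate: subtracting the integration by parts formula from the weak
equation leaves `∫ |W|² = 0`. -/
theorem IsLocalWeight.eq_primitive_of_test (h : IsLocalWeight a I ρ) {T : ℝ} (hT : T ∈ I)
    (haT : a ≤ T) {p q : ℂ} (hpq : p = 0 ∨ q = 0) {u v W : ℝ → ℂ}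
    (hu : MemLp u 2 (volume.restrict (Ioc a T))) (hv : MemLp v 2 (volume.restrict (Ioc a T)))
    (hW : ∀ x, W x = u x - (ρ x : ℂ)⁻¹ * (p + ∫ y in a..x, (ρ y : ℂ) * v y))
    (hq : q + ∫ y in a..T, (ρ y : ℂ)⁻¹ * W y = 0)
    (htest : ∫ x in Ioc a T, (conj (u x) * W x +
      conj (v x) * ((ρ x : ℂ) * (q + ∫ y in a..x, (ρ y : ℂ)⁻¹ * W y))) = 0) :
    ∀ᵐ x ∂volume.restrict (Ioc a T),
      u x = (ρ x : ℂ)⁻¹ * (p + ∫ y in a..x, (ρ y : ℂ) * v y) := by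
  have hV : MemLp (fun x => (ρ x : ℂ)⁻¹ * (p + ∫ y in a..x, (ρ y : ℂ) * v y)) 2
      (volume.restrict (Ioc a T)) := by
    simpa using h.inv.memLp_primitive hT haT hv p
  have hWm : MemLp W 2 (volume.restrict (Ioc a T)) := by
    rw [show W = fun x => u x - _ from funext hW]; exact hu.sub hV
  have hF := h.memLp_primitive hT haT hWm q
  have key := h.integral_conj_mul_add_eq_zero hT haT hpq hv hWm (Filter.Eventually.of_forall
    fun x => rfl) (Filter.Eventually.of_forall fun x => rfl) hq
  have i1 : Integrable (fun x => conj (v x) * ((ρ x : ℂ) * (q + ∫ y in a..x, (ρ y : ℂ)⁻¹ * W y)))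
      (volume.restrict (Ioc a T)) := MemLp.integrable_mul hv.star hF
  have i2 : Integrable (fun x => conj (u x) * W x) (volume.restrict (Ioc a T)) :=
    MemLp.integrable_mul hu.star hWm
  have i3 : Integrable (fun x => conj ((ρ x : ℂ)⁻¹ * (p + ∫ y in a..x, (ρ y : ℂ) * v y)) * W x)
      (volume.restrict (Ioc a T)) := MemLp.integrable_mul hV.star hWm
  rw [integral_add i2 i1] at htest
  rw [integral_add i3 i1] at key
  have h0 : ∫ x in Ioc a T, conj (W x) * W x = 0 := by
    have e : (fun x => conj (W x) * W x) = fun x => conj (u x) * W x -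
        conj ((ρ x : ℂ)⁻¹ * (p + ∫ y in a..x, (ρ y : ℂ) * v y)) * W x := by
      funext x
      rw [← sub_mul, ← map_sub, ← hW]
    rw [e, integral_sub i2 i3]
    linear_combination htest - key
  have h1 : ∫ x in Ioc a T, ‖W x‖ ^ 2 = 0 := by
    have e : (fun x => conj (W x) * W x) = fun x => ((‖W x‖ ^ 2 : ℝ) : ℂ) := by
      funext x; rw [Complex.conj_mul']; norm_cast
    rw [e, integral_complex_ofReal] at h0
    exact_mod_cast h0
  rw [integral_eq_zero_iff_of_nonneg (fun x => by positivity) hWm.integrable_norm_pow'] at h1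
  filter_upwards [h1] with x hx
  have : W x = 0 := by simpa using hx
  rw [hW, sub_eq_zero] at this
  exact this

/-- Weak solutions without restriction on the initial value of the test functions. -/
theorem IsRightOpenInterval.isWeightedPrimitive_of_test (hI : IsRightOpenInterval a I)
    (h : IsLocalWeight a I ρ) {u v : ℝ → ℂ}
    (hu : MemLp u 2 (volume.restrict I)) (hv : MemLp v 2 (volume.restrict I))
    (htest : ∀ T ∈ I, ∀ (W : ℝ → ℂ) (q : ℂ), MemLp W 2 (volume.restrict (Ioc a T)) →
      q + ∫ y in a..T, (ρ y : ℂ)⁻¹ * W y = 0 → ∫ x in Ioc a T, (conj (u x) * W x +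
      conj (v x) * ((ρ x : ℂ) * (q + ∫ y in a..x, (ρ y : ℂ)⁻¹ * W y))) = 0) :
    IsWeightedPrimitive a I (fun x => (ρ x)⁻¹) 0 u v := by
  refine hI.ae_of_forall_Ioc fun T hT => ?_
  have haT : a ≤ T := (hI.subset_Ioi hT).le
  have hu' := hu.mono_measure (hI.restrict_le hT)
  have hv' := hv.mono_measure (hI.restrict_le hT)
  have hV : MemLp (fun x => (ρ x : ℂ)⁻¹ * (0 + ∫ y in a..x, (ρ y : ℂ) * v y)) 2
      (volume.restrict (Ioc a T)) := by
    simpa using h.inv.memLp_primitive hT haT hv' 0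
  simpa using h.eq_primitive_of_test hT haT (Or.inl rfl) hu' hv' (fun x => rfl)
    (neg_add_cancel _) (htest T hT _ _ (hu'.sub hV) (neg_add_cancel _))

/-- Weak solutions when the test functions vanish at the initial point. -/
theorem IsRightOpenInterval.exists_isWeightedPrimitive_of_test (hI : IsRightOpenInterval a I)
    (h : IsLocalWeight a I ρ) {u v : ℝ → ℂ}
    (hu : MemLp u 2 (volume.restrict I)) (hv : MemLp v 2 (volume.restrict I))
    (htest : ∀ T ∈ I, ∀ (W : ℝ → ℂ), MemLp W 2 (volume.restrict (Ioc a T)) →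
      ∫ y in a..T, (ρ y : ℂ)⁻¹ * W y = 0 → ∫ x in Ioc a T, (conj (u x) * W x +
      conj (v x) * ((ρ x : ℂ) * (∫ y in a..x, (ρ y : ℂ)⁻¹ * W y))) = 0) :
    ∃ p, IsWeightedPrimitive a I (fun x => (ρ x)⁻¹) p u v := by
  have hloc : ∀ T ∈ I, ∃ p, ∀ᵐ x ∂volume.restrict (Ioc a T),
      u x = (ρ x : ℂ)⁻¹ * (p + ∫ y in a..x, (ρ y : ℂ) * v y) := by
    intro T hT
    have haT : a ≤ T := (hI.subset_Ioi hT).le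
    have hu' := hu.mono_measure (hI.restrict_le hT)
    have hv' := hv.mono_measure (hI.restrict_le hT)
    have hV : ∀ p, MemLp (fun x => (ρ x : ℂ)⁻¹ * (p + ∫ y in a..x, (ρ y : ℂ) * v y)) 2
        (volume.restrict (Ioc a T)) := fun p => by
      simpa using h.inv.memLp_primitive hT haT hv' p
    have hone : MemLp (fun x => (ρ x : ℂ)⁻¹) 2 (volume.restrict (Ioc a T)) := by
      simpa using h.memLp_inv_mul hT (memLp_const (1 : ℂ))
    have j1 : IntervalIntegrable (fun y => (ρ y : ℂ)⁻¹ *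
        (u y - (ρ y : ℂ)⁻¹ * (0 + ∫ z in a..y, (ρ z : ℂ) * v z))) volume a T :=
      intervalIntegrable_of_memLp_two haT (h.memLp_inv_mul hT (hu'.sub (hV 0)))
    have j2 := intervalIntegrable_of_memLp_two haT (h.memLp_inv_mul hT hone)
    -- The initial value makes the difference orthogonal to the reciprocal weight.
    have hpos : (∫ y in a..T, (ρ y : ℂ)⁻¹ * (ρ y : ℂ)⁻¹) ≠ 0 := by
      have e : (fun y => (ρ y : ℂ)⁻¹ * (ρ y : ℂ)⁻¹) = fun y => (((ρ y)⁻¹ * (ρ y)⁻¹ : ℝ) : ℂ) := by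
        funext y; push_cast; rfl
      rw [e] at j2 ⊢
      rw [intervalIntegral.integral_ofReal, Complex.ofReal_ne_zero]
      have j3 : IntervalIntegrable (fun y => (ρ y)⁻¹ * (ρ y)⁻¹) volume a T := by
        exact ⟨j2.1.re, j2.2.re⟩
      refine (intervalIntegral.intervalIntegral_pos_of_pos_on j3 (fun x _ => ?_)
        (hI.subset_Ioi hT)).ne'
      exact mul_pos (inv_pos.2 (h.pos x)) (inv_pos.2 (h.pos x))
    set p := (∫ y in a..T, (ρ y : ℂ)⁻¹ * (u y - (ρ y : ℂ)⁻¹ * (0 + ∫ z in a..y, (ρ z : ℂ) * v z))) /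
      (∫ y in a..T, (ρ y : ℂ)⁻¹ * (ρ y : ℂ)⁻¹) with hp
    have hq : ∫ y in a..T, (ρ y : ℂ)⁻¹ *
        (u y - (ρ y : ℂ)⁻¹ * (p + ∫ z in a..y, (ρ z : ℂ) * v z)) = 0 := by
      have e : (fun y => (ρ y : ℂ)⁻¹ * (u y - (ρ y : ℂ)⁻¹ * (p + ∫ z in a..y, (ρ z : ℂ) * v z))) =
          fun y => (ρ y : ℂ)⁻¹ * (u y - (ρ y : ℂ)⁻¹ * (0 + ∫ z in a..y, (ρ z : ℂ) * v z)) -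
            p * ((ρ y : ℂ)⁻¹ * (ρ y : ℂ)⁻¹) := by
        funext y; ring
      rw [e, intervalIntegral.integral_sub j1 (j2.const_mul p),
        intervalIntegral.integral_const_mul, hp, div_mul_cancel₀ _ hpos, sub_self]
    refine ⟨p, h.eq_primitive_of_test hT haT (Or.inr rfl) hu' hv' (fun x => rfl)
      (by rw [zero_add]; exact hq) ?_⟩
    simpa only [zero_add, Pi.sub_apply] using htest T hT _ (hu'.sub (hV p)) hq
  -- The initial values that belong to different intervals agree.
  obtain ⟨T, hT, -⟩ := hI.exhaust
  obtain ⟨p, hp⟩ := hloc (T 0) (hT 0)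
  refine ⟨p, hI.ae_of_forall_Ioc fun S hS => ?_⟩
  simp only [Complex.ofReal_inv, inv_inv]
  rcases le_total S (T 0) with hle | hle
  · exact ae_restrict_of_ae_restrict_of_subset (Ioc_subset_Ioc_right hle) hp
  · obtain ⟨p', hp'⟩ := hloc S hS
    have hp'' := ae_restrict_of_ae_restrict_of_subset (Ioc_subset_Ioc_right hle) hp'
    have hne : (volume.restrict (Ioc a (T 0))) ≠ 0 := by
      rw [Ne, Measure.restrict_eq_zero, Real.volume_Ioc, ENNReal.ofReal_eq_zero, not_le]
      exact sub_pos.2 (hI.subset_Ioi (hT 0))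
    have : (ae (volume.restrict (Ioc a (T 0)))).NeBot := ae_neBot.2 hne
    obtain ⟨x, e1, e2⟩ := (hp.and hp'').exists
    rw [e1] at e2
    have := mul_left_cancel₀ (inv_ne_zero (h.ne_zero x)) e2
    rw [add_right_cancel this]
    exact hp'

end DuBoisReymond

/-! ### Solutions of the homogeneous weighted Dirac equation -/

section Kernel

variable {a : ℝ} {I : Set ℝ} {ω : ℝ → ℝ}

/-- The equation `A u = 0` has no nontrivial square-integrable solution if `∫ ω² = ∞`: with
`u₀ = ω φ` and `u₁ = χ / ω`, the function `|φ|²` vanishes at `a` and has the nonnegative derivative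
`2 c ω⁻² Re (φ̄ χ)`, where `φ̄ χ` is the integral of `c (|u₀|² + |u₁|²)`. -/
theorem ae_eq_zero_of_isWeightedPrimitive (hI : IsRightOpenInterval a I)
    (hω : IsLocalWeight a I ω) (hinf : ∫⁻ x in I, ENNReal.ofReal (ω x ^ 2) = ⊤)
    {c : ℝ} (hc : 0 < c) {u₀ u₁ : ℝ → ℂ} (hu₀ : MemLp u₀ 2 (volume.restrict I))
    (hu₁ : MemLp u₁ 2 (volume.restrict I)) {C : ℂ}
    (h₀ : IsWeightedPrimitive a I ω 0 u₀ fun x => c * u₁ x)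
    (h₁ : IsWeightedPrimitive a I (fun x => (ω x)⁻¹) C u₁ fun x => c * u₀ x) :
    ∀ᵐ x ∂volume.restrict I, u₀ x = 0 ∧ u₁ x = 0 := by
  simp only [IsWeightedPrimitive, Complex.ofReal_inv, inv_inv, zero_add] at h₀ h₁
  set φ : ℝ → ℂ := fun x => ∫ y in a..x, (ω y : ℂ)⁻¹ * (c * u₁ y) with hφ
  set χ : ℝ → ℂ := fun x => C + ∫ y in a..x, (ω y : ℂ) * (c * u₀ y) with hχ
  set Q : ℝ → ℝ := fun x => ∫ y in a..x, c * (‖u₀ y‖ ^ 2 + ‖u₁ y‖ ^ 2) with hQ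
  have hle : ∀ x ∈ I, a ≤ x := fun x hx => (hI.subset_Ioi hx).le
  have m₀ : ∀ x ∈ I, MemLp u₀ 2 (volume.restrict (Ioc a x)) := fun x hx =>
    hu₀.mono_measure (hI.restrict_le hx)
  have m₁ : ∀ x ∈ I, MemLp u₁ 2 (volume.restrict (Ioc a x)) := fun x hx =>
    hu₁.mono_measure (hI.restrict_le hx)
  have iφ : ∀ x ∈ I, IntervalIntegrable (fun y => (ω y : ℂ)⁻¹ * (c * u₁ y)) volume a x :=
    fun x hx => intervalIntegrable_of_memLp_two (hle x hx)
      (hω.memLp_inv_mul hx ((m₁ x hx).const_mul (c : ℂ)))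
  have iφ' : ∀ x ∈ I, IntervalIntegrable (fun y => conj ((ω y : ℂ)⁻¹ * (c * u₁ y))) volume a x :=
    fun x hx => intervalIntegrable_of_memLp_two (hle x hx)
      (hω.memLp_inv_mul hx ((m₁ x hx).const_mul (c : ℂ))).star
  have iχ : ∀ x ∈ I, IntervalIntegrable (fun y => (ω y : ℂ) * (c * u₀ y)) volume a x :=
    fun x hx => intervalIntegrable_of_memLp_two (hle x hx)
      (hω.memLp_mul hx ((m₀ x hx).const_mul (c : ℂ)))
  have hconj : ∀ x ∈ I, (∫ y in a..x, conj ((ω y : ℂ)⁻¹ * (c * u₁ y))) = conj (φ x) := by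
    intro x hx
    rw [hφ]
    simp only [intervalIntegral.integral_of_le (hle x hx)]
    exact integral_conj
  have iQ : ∀ x ∈ I, IntervalIntegrable (fun y => c * (‖u₀ y‖ ^ 2 + ‖u₁ y‖ ^ 2)) volume a x := by
    intro x hx
    rw [intervalIntegrable_iff_integrableOn_Ioc_of_le (hle x hx)]
    exact ((m₀ x hx).integrable_norm_pow'.add (m₁ x hx).integrable_norm_pow').const_mul c
  -- The function `φ̄ χ` is real and nondecreasing.
  have hφχ : ∀ x ∈ I, conj (φ x) * χ x = (Q x : ℂ) := by
    intro x hx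
    have key := primitive_mul_primitive (iφ' x hx) (iχ x hx) 0 C
    rw [zero_add, zero_mul, zero_add, hconj x hx] at key
    rw [hχ]
    refine key.trans ?_
    rw [hQ]
    simp only
    rw [← intervalIntegral.integral_ofReal, intervalIntegral.integral_of_le (hle x hx),
      intervalIntegral.integral_of_le (hle x hx)]
    refine integral_congr_ae ?_
    filter_upwards [ae_restrict_of_ae_restrict_of_subset (hI.Ioc_subset x hx) h₀,
      ae_restrict_of_ae_restrict_of_subset (hI.Ioc_subset x hx) h₁,
      ae_restrict_mem measurableSet_Ioc] with y e0 e1 hy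
    have hyI : y ∈ I := hI.Ioc_subset x hx hy
    have hne := hω.ne_zero y
    rw [zero_add, hconj y hyI]
    change _ * χ y + _ = _
    change u₀ y = ω y * φ y at e0
    change u₁ y = (ω y : ℂ)⁻¹ * χ y at e1
    push_cast
    rw [← Complex.conj_mul', ← Complex.conj_mul']
    have e2 : (ω y : ℂ)⁻¹ * (c * conj (u₁ y)) * χ y = c * (conj (u₁ y) * u₁ y) := by
      conv_rhs => rw [e1]
      rw [e1]; ring
    have e3 : conj (φ y) * ((ω y : ℂ) * (c * u₀ y)) = c * (conj (u₀ y) * u₀ y) := by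
      have : conj (u₀ y) = ω y * conj (φ y) := by rw [e0, map_mul, Complex.conj_ofReal]
      rw [this]; ring
    simp only [map_mul, map_inv₀, Complex.conj_ofReal]
    linear_combination e2 + e3
  have hQnn : ∀ x ∈ I, 0 ≤ Q x := fun x hx =>
    intervalIntegral.integral_nonneg (hle x hx) fun y _ => by positivity
  -- The function `|φ|²` has the nonnegative derivative `2 c ω⁻² φ̄ χ`.
  have hφφ : ∀ x ∈ I, (‖φ x‖ ^ 2 : ℝ) = ∫ y in a..x, 2 * c * (ω y)⁻¹ ^ 2 * Q y := by
    intro x hx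
    have key := primitive_mul_primitive (iφ' x hx) (iφ x hx) 0 0
    simp only [zero_add, zero_mul] at key
    rw [hconj x hx] at key
    change conj (φ x) * φ x = _ at key
    rw [Complex.conj_mul'] at key
    apply Complex.ofReal_injective
    push_cast
    rw [key, ← intervalIntegral.integral_ofReal, intervalIntegral.integral_of_le (hle x hx),
      intervalIntegral.integral_of_le (hle x hx)]
    refine integral_congr_ae ?_
    filter_upwards [ae_restrict_of_ae_restrict_of_subset (hI.Ioc_subset x hx) h₁,
      ae_restrict_mem measurableSet_Ioc] with y e1 hy
    have hyI : y ∈ I := hI.Ioc_subset x hx hy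
    rw [hconj y hyI]
    change _ * φ y + _ = _
    change u₁ y = (ω y : ℂ)⁻¹ * χ y at e1
    have e4 := hφχ y hyI
    have e5 : conj (χ y) * φ y = Q y := by
      have := congrArg conj e4
      rw [map_mul, Complex.conj_conj, Complex.conj_ofReal] at this
      rw [← this]; ring
    rw [e1]
    simp only [map_mul, map_inv₀, Complex.conj_ofReal]
    push_cast
    linear_combination (c * (ω y : ℂ)⁻¹ ^ 2) * e4 + (c * (ω y : ℂ)⁻¹ ^ 2) * e5
  have hmono : ∀ x ∈ I, ∀ y ∈ I, x ≤ y → ‖φ x‖ ^ 2 ≤ ‖φ y‖ ^ 2 := by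
    intro x hx y hy hxy
    have hint : IntervalIntegrable (fun y => 2 * c * (ω y)⁻¹ ^ 2 * Q y) volume a y := by
      have hQc : ContinuousOn Q (uIcc a y) :=
        intervalIntegral.continuousOn_primitive_interval' (iQ y hy) left_mem_uIcc
      refine IntervalIntegrable.mul_continuousOn ?_ hQc
      have h1 : MemLp (fun x => (ω x : ℂ)⁻¹ * ((ω x : ℂ)⁻¹ * 1)) 2 (volume.restrict (Ioc a y)) :=
        hω.memLp_inv_mul hy (hω.memLp_inv_mul hy (memLp_const 1))
      have h2 := intervalIntegrable_of_memLp_two (hle y hy) h1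
      have h3 : IntervalIntegrable (fun x => ((ω x : ℂ)⁻¹ * ((ω x : ℂ)⁻¹ * 1)).re) volume a y :=
        ⟨h2.1.re, h2.2.re⟩
      refine (h3.const_mul (2 * c)).congr fun x _ => ?_
      simp only [mul_one, ← Complex.ofReal_inv, ← Complex.ofReal_mul, Complex.ofReal_re]
      ring
    rw [hφφ x hx, hφφ y hy]
    have hxs : IntervalIntegrable (fun y => 2 * c * (ω y)⁻¹ ^ 2 * Q y) volume a x :=
      hint.mono_set (by rw [uIcc_of_le (hle x hx), uIcc_of_le (hle y hy)]; exact Icc_subset_Icc_right hxy)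
    rw [← sub_nonneg, intervalIntegral.integral_interval_sub_left hint hxs]
    refine intervalIntegral.integral_nonneg_of_ae_restrict hxy ?_
    filter_upwards [ae_restrict_mem measurableSet_Icc] with z hz
    have hzI : z ∈ I := hI.Ioc_subset y hy ⟨(hI.subset_Ioi hx).trans_le hz.1, hz.2⟩
    exact mul_nonneg (by positivity) (hQnn z hzI)
  have hφ0 : ∀ x ∈ I, φ x = 0 := by
    intro x hx
    by_contra hne
    have hpos : 0 < ‖φ x‖ ^ 2 := by positivity
    have hb : ∫⁻ y in Ioc a x, ENNReal.ofReal (ω y ^ 2) < ⊤ := by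
      obtain ⟨M, hM⟩ := hω.bounded x hx
      calc ∫⁻ y in Ioc a x, ENNReal.ofReal (ω y ^ 2)
          ≤ ∫⁻ y in Ioc a x, ENNReal.ofReal (M ^ 2) := by
            refine setLIntegral_mono measurable_const fun y hy => ENNReal.ofReal_le_ofReal ?_
            exact pow_le_pow_left₀ (hω.pos y).le (hM y hy).1 2
        _ < ⊤ := by
            rw [setLIntegral_const]
            exact ENNReal.mul_lt_top ENNReal.ofReal_lt_top (by simp)
    -- Beyond `x`, the inequality `ω² |φ x|² ≤ ω² |φ|² = |u₀|²` bounds the integral of `ω²`.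
    have hb2 : ∫⁻ y in I \ Ioc a x, ENNReal.ofReal (ω y ^ 2) < ⊤ := by
      have hfin : ∫⁻ y in I, ENNReal.ofReal (‖u₀ y‖ ^ 2 / ‖φ x‖ ^ 2) < ⊤ :=
        (((memLp_two_iff_integrable_sq_norm hu₀.1).1 hu₀).div_const _).lintegral_lt_top
      refine lt_of_le_of_lt ?_ hfin
      refine le_trans (lintegral_mono_ae ?_) (lintegral_mono_set sdiff_subset)
      filter_upwards [ae_restrict_of_ae_restrict_of_subset sdiff_subset h₀,
        ae_restrict_mem (hI.measurableSet.diff measurableSet_Ioc)] with y e0 hy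
      refine ENNReal.ofReal_le_ofReal ?_
      have hxy : x ≤ y := by
        by_contra hcon
        exact hy.2 ⟨hI.subset_Ioi hy.1, (not_le.1 hcon).le⟩
      rw [le_div_iff₀ hpos, e0, norm_mul, Complex.norm_real, Real.norm_of_nonneg (hω.pos y).le,
        mul_pow]
      exact mul_le_mul_of_nonneg_left (hmono x hx y hy.1 hxy) (by positivity)
    have := lintegral_inter_add_sdiff (μ := volume) (fun y => ENNReal.ofReal (ω y ^ 2)) I
      (measurableSet_Ioc (a := a) (b := x))
    rw [hinf, inter_eq_right.2 (hI.Ioc_subset x hx)] at this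
    exact absurd this (ENNReal.add_lt_top.2 ⟨hb, hb2⟩).ne
  refine hI.ae_of_forall_Ioc fun T hT => ?_
  have hQ0 : Q T = 0 := by
    have := hφχ T hT
    rw [hφ0 T hT, map_zero, zero_mul] at this
    exact_mod_cast this.symm
  rw [hQ] at hQ0
  simp only at hQ0
  rw [intervalIntegral.integral_eq_zero_iff_of_le_of_nonneg_ae (hle T hT)
    (Filter.Eventually.of_forall fun y => by positivity) (iQ T hT)] at hQ0
  filter_upwards [hQ0] with y hy
  have hy' : c * (‖u₀ y‖ ^ 2 + ‖u₁ y‖ ^ 2) = 0 := hy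
  have h3 : ‖u₀ y‖ ^ 2 + ‖u₁ y‖ ^ 2 = 0 := by
    rcases mul_eq_zero.1 hy' with h | h
    · exact absurd h hc.ne'
    · exact h
  have h4 := sq_nonneg ‖u₀ y‖
  have h5 := sq_nonneg ‖u₁ y‖
  constructor
  · rw [← norm_eq_zero, ← sq_eq_zero_iff]; linarith
  · rw [← norm_eq_zero, ← sq_eq_zero_iff]; linarith

end Kernel

/-! ### The weighted Dirac operator on an interval -/

section Spinors

theorem diracExpr_apply_zero (c : ℝ) (f g : Spinor) :
    diracExpr c f g 0 = -c * g 1 + c ^ 2 * f 0 := by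
  have h : (c : ℂ) / Complex.I = -c * Complex.I := by
    rw [div_eq_mul_inv, Complex.inv_I]; ring
  simp only [diracExpr, h, PiLp.add_apply, PiLp.smul_apply, Matrix.toLpLin_apply, diracAlpha,
    diracBeta, Matrix.mulVec, dotProduct, Fin.sum_univ_two, smul_eq_mul]
  simp
  linear_combination (c * g.ofLp 1) * Complex.I_mul_I

theorem diracExpr_apply_one (c : ℝ) (f g : Spinor) :
    diracExpr c f g 1 = c * g 0 - c ^ 2 * f 1 := by
  have h : (c : ℂ) / Complex.I = -c * Complex.I := by
    rw [div_eq_mul_inv, Complex.inv_I]; ring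
  simp only [diracExpr, h, PiLp.add_apply, PiLp.smul_apply, Matrix.toLpLin_apply, diracAlpha,
    diracBeta, Matrix.mulVec, dotProduct, Fin.sum_univ_two, smul_eq_mul]
  simp
  linear_combination (-c * g.ofLp 0) * Complex.I_mul_I

theorem inner_spinor (f g : Spinor) : ⟪f, g⟫_ℂ = conj (f 0) * g 0 + conj (f 1) * g 1 := by
  simp [PiLp.inner_apply, Fin.sum_univ_two, mul_comm]

theorem spinor_ext {f g : Spinor} (h0 : f 0 = g 0) (h1 : f 1 = g 1) : f = g := by
  ext i
  fin_cases i
  · exact h0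
  · exact h1

/-- The Dirac matrix `β` as an operator on spinors. -/
noncomputable def betaCLM : Spinor →L[ℂ] Spinor :=
  LinearMap.toContinuousLinearMap (Matrix.toEuclideanLin diracBeta)

theorem betaCLM_apply_zero (f : Spinor) : betaCLM f 0 = f 0 := by
  simp [betaCLM, diracBeta, Matrix.toLpLin_apply, dotProduct, Fin.sum_univ_two]

theorem betaCLM_apply_one (f : Spinor) : betaCLM f 1 = -f 1 := by
  simp [betaCLM, diracBeta, Matrix.toLpLin_apply, dotProduct, Fin.sum_univ_two]

theorem norm_betaCLM_apply (f : Spinor) : ‖betaCLM f‖ = ‖f‖ := by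
  rw [EuclideanSpace.norm_eq, EuclideanSpace.norm_eq, Fin.sum_univ_two, Fin.sum_univ_two,
    betaCLM_apply_zero, betaCLM_apply_one, norm_neg]

theorem memLp_spinor_apply {μ : Measure ℝ} {f : ℝ → Spinor} (hf : MemLp f 2 μ) (i : Fin 2) :
    MemLp (fun x => f x i) 2 μ :=
  (EuclideanSpace.proj (𝕜 := ℂ) i : Spinor →L[ℂ] ℂ).comp_memLp' hf

theorem memLp_spinor_mk {μ : Measure ℝ} {f g : ℝ → ℂ} (hf : MemLp f 2 μ) (hg : MemLp g 2 μ) :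
    MemLp (fun x => (!₂[f x, g x] : Spinor)) 2 μ := by
  have h1 := (ContinuousLinearMap.toSpanSingleton ℂ (!₂[1, 0] : Spinor)).comp_memLp' hf
  have h2 := (ContinuousLinearMap.toSpanSingleton ℂ (!₂[0, 1] : Spinor)).comp_memLp' hg
  refine (memLp_congr_ae (Filter.Eventually.of_forall fun x => ?_)).2 (h1.add h2)
  refine spinor_ext ?_ ?_ <;> simp

end Spinors

section WeightedDirac

variable {a : ℝ} {I : Set ℝ} {ρ ω : ℝ → ℝ}

theorem IsWeightedPrimitive.congr (hI : IsRightOpenInterval a I) {q : ℂ} {f f' g g' : ℝ → ℂ}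
    (h : IsWeightedPrimitive a I ρ q f g) (hf : f =ᵐ[volume.restrict I] f')
    (hg : g =ᵐ[volume.restrict I] g') : IsWeightedPrimitive a I ρ q f' g' := by
  filter_upwards [h, hf, ae_restrict_mem hI.measurableSet] with x e1 e2 hx
  rw [← e2, e1, intervalIntegral.integral_of_le (hI.subset_Ioi hx).le,
    intervalIntegral.integral_of_le (hI.subset_Ioi hx).le]
  congr 2
  refine integral_congr_ae ?_
  filter_upwards [ae_restrict_of_ae_restrict_of_subset (hI.Ioc_subset x hx) hg] with y e3
  rw [e3]

theorem memLp_indicator_Ioc (hI : IsRightOpenInterval a I) {T : ℝ} (hT : T ∈ I) {f : ℝ → ℂ}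
    (hf : MemLp f 2 (volume.restrict (Ioc a T))) :
    MemLp ((Ioc a T).indicator f) 2 (volume.restrict I) := by
  rw [memLp_indicator_iff_restrict measurableSet_Ioc,
    Measure.restrict_restrict_of_subset (hI.Ioc_subset T hT)]
  exact hf

/-- A weighted primitive that vanishes at `T` stays a weighted primitive when it is cut off
at `T`. -/
theorem isWeightedPrimitive_indicator (hI : IsRightOpenInterval a I)
    {T : ℝ} (hT : T ∈ I) {W : ℝ → ℂ} {q : ℂ} (hq : q + ∫ y in a..T, (ρ y : ℂ)⁻¹ * W y = 0) :
    IsWeightedPrimitive a I ρ q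
      ((Ioc a T).indicator fun x => (ρ x : ℂ) * (q + ∫ y in a..x, (ρ y : ℂ)⁻¹ * W y))
      ((Ioc a T).indicator W) := by
  filter_upwards [ae_restrict_mem hI.measurableSet] with x hx
  have hax : a < x := hI.subset_Ioi hx
  have haT : a < T := hI.subset_Ioi hT
  have e : ∀ y, (ρ y : ℂ)⁻¹ * (Ioc a T).indicator W y =
      (Ioc a T).indicator (fun y => (ρ y : ℂ)⁻¹ * W y) y := by
    intro y
    by_cases hy : y ∈ Ioc a T <;> simp [hy]
  simp only [e]
  rw [intervalIntegral.integral_of_le hax.le, setIntegral_indicator measurableSet_Ioc,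
    Ioc_inter_Ioc, max_self]
  by_cases hxT : x ≤ T
  · rw [indicator_of_mem (show x ∈ Ioc a T from ⟨hax, hxT⟩), min_eq_left hxT, intervalIntegral.integral_of_le hax.le]
  · rw [indicator_of_notMem (show x ∉ Ioc a T from fun h => hxT h.2), min_eq_right (not_le.1 hxT).le,
      ← intervalIntegral.integral_of_le haT.le, hq, mul_zero]

theorem integral_eq_integral_Ioc (hI : IsRightOpenInterval a I) {T : ℝ} (hT : T ∈ I) {f : ℝ → ℂ}
    (hf : ∀ᵐ x ∂volume.restrict I, x ∉ Ioc a T → f x = 0) :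
    ∫ x in I, f x = ∫ x in Ioc a T, f x := by
  refine (setIntegral_eq_of_subset_of_ae_sdiff_eq_zero hI.measurableSet.nullMeasurableSet
    (hI.Ioc_subset T hT) ?_)
  filter_upwards [ae_imp_of_ae_restrict hf] with x hx hxm
  exact hx hxm.1 hxm.2

/-- The boundary form of the Dirac expression. -/
theorem inner_sub_inner_eq {c : ℝ} {u v f w gu gf : SpinorL2 I}
    (hv : ∀ᵐ x ∂volume.restrict I, v x = diracExpr c (u x) (gu x))
    (hw : ∀ᵐ x ∂volume.restrict I, w x = diracExpr c (f x) (gf x)) :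
    ⟪u, w⟫_ℂ - ⟪v, f⟫_ℂ = c * ((∫ x in I, (conj (u x 1) * gf x 0 + conj (gu x 1) * f x 0)) -
      ∫ x in I, (conj (u x 0) * gf x 1 + conj (gu x 0) * f x 1)) := by
  have hm : ∀ (p r : SpinorL2 I) (i j : Fin 2),
      Integrable (fun x => conj (p x i) * r x j) (volume.restrict I) := fun p r i j =>
    MemLp.integrable_mul (memLp_spinor_apply (Lp.memLp p) i).star
      (memLp_spinor_apply (Lp.memLp r) j)
  have i1 : Integrable (fun x => conj (u x 1) * gf x 0 + conj (gu x 1) * f x 0)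
      (volume.restrict I) := (hm u gf 1 0).add (hm gu f 1 0)
  have i2 : Integrable (fun x => conj (u x 0) * gf x 1 + conj (gu x 0) * f x 1)
      (volume.restrict I) := (hm u gf 0 1).add (hm gu f 0 1)
  rw [L2.inner_def, L2.inner_def, ← integral_sub (L2.integrable_inner _ _)
    (L2.integrable_inner _ _), ← integral_sub i1 i2, ← integral_const_mul]
  refine integral_congr_ae ?_
  filter_upwards [hv, hw] with x e1 e2
  rw [e1, e2, inner_spinor, inner_spinor, diracExpr_apply_zero, diracExpr_apply_one,
    diracExpr_apply_zero, diracExpr_apply_one]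
  simp only [map_add, map_sub, map_mul, map_neg, map_pow, Complex.conj_ofReal]
  ring

/-- The derivative `g` of `f` for a function `f` in the domain of the weighted Dirac operator: up to
the weight `ω`, the upper component of `f` is a primitive that vanishes at `a`, and, up to the
reciprocal weight, the lower component is a primitive. -/
def IsWeightedDiracPair (a : ℝ) (I : Set ℝ) (ω : ℝ → ℝ) (q : ℂ) (f g : ℝ → Spinor) : Prop :=
  IsWeightedPrimitive a I ω 0 (fun x => f x 0) (fun x => g x 0) ∧
    IsWeightedPrimitive a I (fun x => (ω x)⁻¹) q (fun x => f x 1) (fun x => g x 1)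

/-- The elements of the graph of the weighted Dirac operator that vanish beyond some point `T`. -/
def weightedDiracTestPairs (a : ℝ) (I : Set ℝ) (ω : ℝ → ℝ) (c : ℝ) :
    Set (SpinorL2 I × SpinorL2 I) :=
  {z | ∃ (g : SpinorL2 I) (q : ℂ), IsWeightedDiracPair a I ω q z.1 g ∧
    (∀ᵐ x ∂volume.restrict I, z.2 x = diracExpr c (z.1 x) (g x)) ∧
    ∃ T ∈ I, (∀ᵐ x ∂volume.restrict I, x ∉ Ioc a T → z.1 x = 0 ∧ g x = 0) ∧
      ∫ y in a..T, (ω y : ℂ)⁻¹ * g y 0 = 0 ∧ q + ∫ y in a..T, (ω y : ℂ) * g y 1 = 0}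

/-- Integration by parts: the boundary form vanishes if one of the two functions vanishes near the
right end of the interval. -/
theorem inner_eq_of_mem_testPairs (hI : IsRightOpenInterval a I) (hω : IsLocalWeight a I ω) {c : ℝ}
    {u v g : SpinorL2 I} {q : ℂ} (hu : IsWeightedDiracPair a I ω q u g)
    (hv : ∀ᵐ x ∂volume.restrict I, v x = diracExpr c (u x) (g x))
    {z : SpinorL2 I × SpinorL2 I} (hz : z ∈ weightedDiracTestPairs a I ω c) :
    ⟪u, z.2⟫_ℂ = ⟪v, z.1⟫_ℂ := by
  obtain ⟨g', q', hz1, hz2, T, hT, hsupp, hT0, hT1⟩ := hz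
  have haT : a ≤ T := (hI.subset_Ioi hT).le
  have hm : ∀ (p : SpinorL2 I) (i : Fin 2), MemLp (fun x => p x i) 2 (volume.restrict (Ioc a T)) :=
    fun p i => (memLp_spinor_apply (Lp.memLp p) i).mono_measure (hI.restrict_le hT)
  have hres : ∀ {P : ℝ → Prop}, (∀ᵐ x ∂volume.restrict I, P x) →
      ∀ᵐ x ∂volume.restrict (Ioc a T), P x := fun h =>
    ae_restrict_of_ae_restrict_of_subset (hI.Ioc_subset T hT) h
  have e1 := hω.integral_conj_mul_add_eq_zero hT haT (u := fun x => u x 1) (Or.inr rfl) (hm g 1)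
    (hm g' 0) (by simpa [IsWeightedPrimitive] using hres hu.2) (hres hz1.1)
    (by rw [zero_add]; exact hT0)
  have e2 := hω.inv.integral_conj_mul_add_eq_zero hT haT (u := fun x => u x 0) (Or.inl rfl)
    (hm g 0) (hm g' 1) (by simpa [IsWeightedPrimitive] using hres hu.1) (hres hz1.2)
    (by simpa using hT1)
  rw [← sub_eq_zero, inner_sub_inner_eq hv hz2, integral_eq_integral_Ioc hI hT,
    integral_eq_integral_Ioc hI hT]
  · exact (congrArg₂ (fun s t : ℂ => (c : ℂ) * (s - t)) e1 e2).trans (by simp)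
  · filter_upwards [hsupp] with x hx hxm
    rw [(hx hxm).1, (hx hxm).2]; simp
  · filter_upwards [hsupp] with x hx hxm
    rw [(hx hxm).1, (hx hxm).2]; simp

/-- A function that satisfies the weak equation against all test pairs belongs to the graph. -/
theorem exists_isWeightedDiracPair_of_test (hI : IsRightOpenInterval a I)
    (hω : IsLocalWeight a I ω) {c : ℝ} (hc : 0 < c) {u v : SpinorL2 I}
    (h : ∀ z ∈ weightedDiracTestPairs a I ω c, ⟪u, z.2⟫_ℂ = ⟪v, z.1⟫_ℂ) :
    ∃ (g : SpinorL2 I) (q : ℂ), IsWeightedDiracPair a I ω q u g ∧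
      ∀ᵐ x ∂volume.restrict I, v x = diracExpr c (u x) (g x) := by
  have hcc : (c : ℂ) ≠ 0 := Complex.ofReal_ne_zero.2 hc.ne'
  have hmI : ∀ (p : SpinorL2 I) (i : Fin 2), MemLp (fun x => p x i) 2 (volume.restrict I) :=
    fun p i => memLp_spinor_apply (Lp.memLp p) i
  have hm0 : MemLp (fun x => (c : ℂ)⁻¹ * (v x 1 + c ^ 2 * u x 1)) 2 (volume.restrict I) :=
    ((hmI v 1).add ((hmI u 1).const_mul ((c : ℂ) ^ 2))).const_mul _
  have hm1 : MemLp (fun x => -(c : ℂ)⁻¹ * (v x 0 - c ^ 2 * u x 0)) 2 (volume.restrict I) :=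
    ((hmI v 0).sub ((hmI u 0).const_mul ((c : ℂ) ^ 2))).const_mul _
  set g : SpinorL2 I := (memLp_spinor_mk hm0 hm1).toLp _ with hg
  have hgx : ∀ᵐ x ∂volume.restrict I, g x = !₂[(c : ℂ)⁻¹ * (v x 1 + c ^ 2 * u x 1),
      -(c : ℂ)⁻¹ * (v x 0 - c ^ 2 * u x 0)] := (memLp_spinor_mk hm0 hm1).coeFn_toLp
  have hv : ∀ᵐ x ∂volume.restrict I, v x = diracExpr c (u x) (g x) := by
    filter_upwards [hgx] with x hx
    refine spinor_ext ?_ ?_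
    · rw [diracExpr_apply_zero, hx]; simp; field_simp; ring
    · rw [diracExpr_apply_one, hx]; simp; field_simp; ring
  -- Every pair of cut-off scalar functions gives a test pair.
  have htest : ∀ T ∈ I, ∀ (f₀ f₁ W₀ W₁ : ℝ → ℂ) (q : ℂ),
      MemLp ((Ioc a T).indicator f₀) 2 (volume.restrict I) →
      MemLp ((Ioc a T).indicator f₁) 2 (volume.restrict I) →
      MemLp ((Ioc a T).indicator W₀) 2 (volume.restrict I) →
      MemLp ((Ioc a T).indicator W₁) 2 (volume.restrict I) →
      IsWeightedPrimitive a I ω 0 ((Ioc a T).indicator f₀) ((Ioc a T).indicator W₀) →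
      IsWeightedPrimitive a I (fun x => (ω x)⁻¹) q ((Ioc a T).indicator f₁)
        ((Ioc a T).indicator W₁) →
      ∫ y in a..T, (ω y : ℂ)⁻¹ * W₀ y = 0 → q + ∫ y in a..T, (ω y : ℂ) * W₁ y = 0 →
      (∫ x in Ioc a T, (conj (u x 1) * W₀ x + conj (g x 1) * f₀ x)) -
        (∫ x in Ioc a T, (conj (u x 0) * W₁ x + conj (g x 0) * f₁ x)) = 0 := by
    intro T hT f₀ f₁ W₀ W₁ q mf₀ mf₁ mW₀ mW₁ hp₀ hp₁ hT₀ hT₁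
    have haT : a ≤ T := (hI.subset_Ioi hT).le
    set f : SpinorL2 I := (memLp_spinor_mk mf₀ mf₁).toLp _
    set W : SpinorL2 I := (memLp_spinor_mk mW₀ mW₁).toLp _
    have hfx : ∀ᵐ x ∂volume.restrict I, f x = !₂[(Ioc a T).indicator f₀ x,
      (Ioc a T).indicator f₁ x] := (memLp_spinor_mk mf₀ mf₁).coeFn_toLp
    have hWx : ∀ᵐ x ∂volume.restrict I, W x = !₂[(Ioc a T).indicator W₀ x,
      (Ioc a T).indicator W₁ x] := (memLp_spinor_mk mW₀ mW₁).coeFn_toLp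
    have hf₀ : (fun x => f x 0) =ᵐ[volume.restrict I] (Ioc a T).indicator f₀ := by
      filter_upwards [hfx] with x hx; rw [hx]; rfl
    have hf₁ : (fun x => f x 1) =ᵐ[volume.restrict I] (Ioc a T).indicator f₁ := by
      filter_upwards [hfx] with x hx; rw [hx]; rfl
    have hW₀ : (fun x => W x 0) =ᵐ[volume.restrict I] (Ioc a T).indicator W₀ := by
      filter_upwards [hWx] with x hx; rw [hx]; rfl
    have hW₁ : (fun x => W x 1) =ᵐ[volume.restrict I] (Ioc a T).indicator W₁ := by
      filter_upwards [hWx] with x hx; rw [hx]; rfl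
    have hw : MemLp (fun x => diracExpr c (f x) (W x)) 2 (volume.restrict I) := by
      refine (memLp_congr_ae (Filter.Eventually.of_forall fun x => ?_)).2
        (memLp_spinor_mk (((hmI W 1).const_mul (-c : ℂ)).add ((hmI f 0).const_mul ((c : ℂ) ^ 2)))
          (((hmI W 0).const_mul (c : ℂ)).sub ((hmI f 1).const_mul ((c : ℂ) ^ 2))))
      exact spinor_ext (diracExpr_apply_zero _ _ _) (diracExpr_apply_one _ _ _)
    have hsub := hI.Ioc_subset T hT
    have hmem : (f, hw.toLp _) ∈ weightedDiracTestPairs a I ω c := by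
      refine ⟨W, q, ⟨hp₀.congr hI hf₀.symm hW₀.symm, hp₁.congr hI hf₁.symm hW₁.symm⟩,
        hw.coeFn_toLp, T, hT, ?_, ?_, ?_⟩
      · filter_upwards [hf₀, hf₁, hW₀, hW₁] with x e1 e2 e3 e4 hx
        rw [indicator_of_notMem hx] at e1 e2 e3 e4
        exact ⟨spinor_ext e1 e2, spinor_ext e3 e4⟩
      · rw [← hT₀, intervalIntegral.integral_of_le haT, intervalIntegral.integral_of_le haT]
        refine integral_congr_ae ?_
        filter_upwards [ae_restrict_of_ae_restrict_of_subset hsub hW₀,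
          ae_restrict_mem measurableSet_Ioc] with x e1 hx
        rw [e1, indicator_of_mem hx]
      · rw [← hT₁, intervalIntegral.integral_of_le haT, intervalIntegral.integral_of_le haT]
        congr 1
        refine integral_congr_ae ?_
        filter_upwards [ae_restrict_of_ae_restrict_of_subset hsub hW₁,
          ae_restrict_mem measurableSet_Ioc] with x e1 hx
        rw [e1, indicator_of_mem hx]
    have key := sub_eq_zero.2 (h _ hmem)
    rw [inner_sub_inner_eq hv hw.coeFn_toLp, mul_eq_zero_iff_left hcc] at key
    rw [← key]
    congr 1
    · rw [integral_eq_integral_Ioc hI hT]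
      · refine integral_congr_ae ?_
        filter_upwards [ae_restrict_of_ae_restrict_of_subset hsub hW₀,
          ae_restrict_of_ae_restrict_of_subset hsub hf₀,
          ae_restrict_mem measurableSet_Ioc] with x e1 e2 hx
        rw [e1, e2, indicator_of_mem hx, indicator_of_mem hx]
      · filter_upwards [hW₀, hf₀] with x e1 e2 hx
        rw [e1, e2, indicator_of_notMem hx, indicator_of_notMem hx, mul_zero, mul_zero, add_zero]
    · rw [integral_eq_integral_Ioc hI hT]
      · refine integral_congr_ae ?_
        filter_upwards [ae_restrict_of_ae_restrict_of_subset hsub hW₁,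
          ae_restrict_of_ae_restrict_of_subset hsub hf₁,
          ae_restrict_mem measurableSet_Ioc] with x e1 e2 hx
        rw [e1, e2, indicator_of_mem hx, indicator_of_mem hx]
      · filter_upwards [hW₁, hf₁] with x e1 e2 hx
        rw [e1, e2, indicator_of_notMem hx, indicator_of_notMem hx, mul_zero, mul_zero, add_zero]
  have hz : ∀ T, (Ioc a T).indicator (fun _ : ℝ => (0 : ℂ)) = fun _ => 0 := fun T =>
    indicator_zero _ _
  have mz : ∀ T, MemLp ((Ioc a T).indicator fun _ : ℝ => (0 : ℂ)) 2 (volume.restrict I) := by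
    intro T; rw [hz]; exact MemLp.zero
  have pz : ∀ (T : ℝ) (ρ : ℝ → ℝ), IsWeightedPrimitive a I ρ 0
      ((Ioc a T).indicator fun _ : ℝ => (0 : ℂ)) ((Ioc a T).indicator fun _ : ℝ => (0 : ℂ)) := by
    intro T ρ; rw [hz]; simp [IsWeightedPrimitive]
  have hupper : IsWeightedPrimitive a I (fun x => ((ω x)⁻¹)⁻¹) 0 (fun x => u x 0)
      (fun x => g x 0) := by
    refine hI.isWeightedPrimitive_of_test hω.inv (hmI u 0) (hmI g 0) fun T hT W q hW hq => ?_
    have haT : a ≤ T := (hI.subset_Ioi hT).le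
    have := htest T hT (fun _ => 0) _ (fun _ => 0) W q (mz T)
      (memLp_indicator_Ioc hI hT (hω.inv.memLp_primitive hT haT hW q)) (mz T)
      (memLp_indicator_Ioc hI hT hW) (pz T ω) (isWeightedPrimitive_indicator hI hT hq) (by simp)
      (by simpa using hq)
    simpa using this
  obtain ⟨p, hlower⟩ : ∃ p, IsWeightedPrimitive a I (fun x => (ω x)⁻¹) p (fun x => u x 1)
      (fun x => g x 1) := by
    refine hI.exists_isWeightedPrimitive_of_test hω (hmI u 1) (hmI g 1) fun T hT W hW hq => ?_
    have haT : a ≤ T := (hI.subset_Ioi hT).le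
    have := htest T hT _ (fun _ => 0) W (fun _ => 0) 0
      (memLp_indicator_Ioc hI hT (hω.memLp_primitive hT haT hW 0)) (mz T)
      (memLp_indicator_Ioc hI hT hW) (mz T)
      (isWeightedPrimitive_indicator hI hT (by rw [zero_add]; exact hq)) (pz T _) hq (by simp)
    simpa using this
  exact ⟨g, p, ⟨by simpa using hupper, hlower⟩, hv⟩

/-- The weighted Dirac operator is the inverse of a bounded self-adjoint operator if the squared
weight has infinite integral. -/
theorem exists_hasSelfAdjointInverse_of_graph (hI : IsRightOpenInterval a I)
    (hω : IsLocalWeight a I ω) (hinf : ∫⁻ x in I, ENNReal.ofReal (ω x ^ 2) = ⊤)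
    {c : ℝ} (hc : 0 < c) (A : SpinorL2 I →ₗ.[ℂ] SpinorL2 I)
    (hA : ∀ u v : SpinorL2 I, (u, v) ∈ A.graph ↔ ∃ (g : SpinorL2 I) (q : ℂ),
      IsWeightedDiracPair a I ω q u g ∧
        ∀ᵐ x ∂volume.restrict I, v x = diracExpr c (u x) (g x)) :
    ∃ S : SpinorL2 I →L[ℂ] SpinorL2 I, HasSelfAdjointInverse A S ∧ ‖S‖ ≤ (c ^ 2)⁻¹ := by
  let β : SpinorL2 I →L[ℂ] SpinorL2 I := betaCLM.compLpL 2 (volume.restrict I)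
  have hβ : ∀ f : SpinorL2 I, ∀ᵐ x ∂volume.restrict I, β f x = betaCLM (f x) := fun f =>
    betaCLM.coeFn_compLpL f
  refine exists_hasSelfAdjointInverse_of_testPairs A (weightedDiracTestPairs a I ω c)
    ?_ ?_ ?_ ?_ β ?_ ?_ (by positivity) ?_
  · rintro ⟨u, v⟩ ⟨g, q, h1, h2, -⟩
    exact (hA u v).2 ⟨g, q, h1, h2⟩
  · rintro ⟨u, v⟩ hx z hz
    obtain ⟨g, q, h1, h2⟩ := (hA u v).1 hx
    exact inner_eq_of_mem_testPairs hI hω h1 h2 hz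
  · intro u v h
    exact (hA u v).2 (exists_isWeightedDiracPair_of_test hI hω hc h)
  · intro u hu
    obtain ⟨g, q, ⟨h1, h2⟩, h3⟩ := (hA u 0).1 hu
    have hcc : (c : ℂ) ≠ 0 := Complex.ofReal_ne_zero.2 hc.ne'
    have hg : ∀ᵐ x ∂volume.restrict I, g x 0 = c * u x 1 ∧ g x 1 = c * u x 0 := by
      filter_upwards [h3, Lp.coeFn_zero Spinor 2 (volume.restrict I)] with x e1 e2
      rw [e2] at e1
      have k0 := congrArg (fun s : Spinor => s 0) e1
      have k1 := congrArg (fun s : Spinor => s 1) e1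
      simp only [diracExpr_apply_zero, diracExpr_apply_one, Pi.zero_apply, PiLp.zero_apply] at k0 k1
      constructor
      · apply mul_left_cancel₀ hcc; linear_combination -k1
      · apply mul_left_cancel₀ hcc; linear_combination k0
    have key := ae_eq_zero_of_isWeightedPrimitive hI hω hinf hc
      (memLp_spinor_apply (Lp.memLp u) 0) (memLp_spinor_apply (Lp.memLp u) 1)
      (h1.congr hI (Filter.EventuallyEq.refl _ _) (hg.mono fun x hx => hx.1))
      (h2.congr hI (Filter.EventuallyEq.refl _ _) (hg.mono fun x hx => hx.2))
    refine Lp.ext ?_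
    filter_upwards [key, Lp.coeFn_zero Spinor 2 (volume.restrict I)] with x e1 e2
    rw [e2]
    exact spinor_ext e1.1 e1.2
  · intro f g
    rw [L2.inner_def, L2.inner_def]
    refine integral_congr_ae ?_
    filter_upwards [hβ f, hβ g] with x e1 e2
    rw [e1, e2, inner_spinor, inner_spinor]
    simp only [betaCLM_apply_zero, betaCLM_apply_one, map_neg]
    ring
  · intro f
    refine Lp.norm_le_norm_of_ae_le ?_
    filter_upwards [hβ f] with x e1
    rw [e1, norm_betaCLM_apply]
  · rintro ⟨u, v⟩ ⟨g, q, ⟨h1, h2⟩, h3, T, hT, hsupp, hT0, hT1⟩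
    have e0 : ∀ f : SpinorL2 I, (fun x => f x 0) =ᵐ[volume.restrict I] fun x => β f x 0 := by
      intro f; filter_upwards [hβ f] with x e; rw [e, betaCLM_apply_zero]
    have e1 : ∀ f : SpinorL2 I, (fun x => -(f x 1)) =ᵐ[volume.restrict I] fun x => β f x 1 := by
      intro f; filter_upwards [hβ f] with x e; rw [e, betaCLM_apply_one]
    have haT : a ≤ T := (hI.subset_Ioi hT).le
    have hsub := hI.Ioc_subset T hT
    refine ⟨β g, -q, ⟨h1.congr hI (e0 u) (e0 g), ?_⟩, ?_, T, hT, ?_, ?_, ?_⟩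
    · have h2' : IsWeightedPrimitive a I (fun x => (ω x)⁻¹) (-q) (fun x => -(u x 1))
          fun x => -(g x 1) := by
        filter_upwards [h2] with x hx
        simp only [mul_neg, intervalIntegral.integral_neg]
        rw [hx]; ring
      exact h2'.congr hI (e1 u) (e1 g)
    · filter_upwards [h3, hβ u, hβ v, hβ g, Lp.coeFn_sub (((2 * c ^ 2 : ℝ) : ℂ) • u) (β v),
        Lp.coeFn_smul (((2 * c ^ 2 : ℝ) : ℂ)) u] with x k1 k2 k3 k4 k5 k6
      rw [k5, Pi.sub_apply, k6, Pi.smul_apply, k2, k3, k4, k1]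
      refine spinor_ext ?_ ?_
      · simp only [PiLp.sub_apply, PiLp.smul_apply, smul_eq_mul, betaCLM_apply_zero,
          betaCLM_apply_one, diracExpr_apply_zero]
        push_cast; ring
      · simp only [PiLp.sub_apply, PiLp.smul_apply, smul_eq_mul, betaCLM_apply_zero,
          betaCLM_apply_one, diracExpr_apply_one]
        push_cast; ring
    · filter_upwards [hsupp, hβ u, hβ g] with x k1 k2 k3 hx
      rw [k2, k3, (k1 hx).1, (k1 hx).2, map_zero]
      exact ⟨rfl, rfl⟩
    · rw [← hT0, intervalIntegral.integral_of_le haT, intervalIntegral.integral_of_le haT]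
      refine integral_congr_ae ?_
      filter_upwards [ae_restrict_of_ae_restrict_of_subset hsub (e0 g)] with x k
      rw [← k]
    · rw [← neg_eq_zero, ← hT1, neg_add, neg_neg, intervalIntegral.integral_of_le haT,
        intervalIntegral.integral_of_le haT, ← integral_neg]
      congr 1
      refine integral_congr_ae ?_
      filter_upwards [ae_restrict_of_ae_restrict_of_subset hsub (e1 g)] with x k
      rw [← k]; ring

end WeightedDirac

/-! ### The reduced operators as weighted Dirac operators -/

section StepWeight

/-- The number `j` with `t j ≤ x < t (j + 1)`; it is `0` for `x < t 0` and for `x ≥ sup t`. -/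
noncomputable def stepIndex (t : ℕ → ℝ) (x : ℝ) : ℕ :=
  open Classical in
  Nat.find (show ∃ n, x < t (n + 1) ∨ ∀ m, t (m + 1) ≤ x by
    by_cases h : ∀ m, t (m + 1) ≤ x
    · exact ⟨0, Or.inr h⟩
    · push Not at h
      obtain ⟨m, hm⟩ := h
      exact ⟨m, Or.inl hm⟩)

/-- The product of the `√(b i)` with `k < i ≤ j`. -/
noncomputable def stepFactor (b : ℕ → ℕ) (k j : ℕ) : ℝ := ∏ i ∈ Finset.Ioc k j, √(b i)

/-- The weight that is constant between the points `t j`, equals `1` on `(t k, t (k + 1))` and is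
multiplied by `√(b j)` at `t j`. -/
noncomputable def stepWeight (b : ℕ → ℕ) (t : ℕ → ℝ) (k : ℕ) (x : ℝ) : ℝ :=
  stepFactor b k (stepIndex t x)

variable {t : ℕ → ℝ} {b : ℕ → ℕ} {k : ℕ}

theorem measurable_stepIndex (t : ℕ → ℝ) : Measurable (stepIndex t) := by
  classical
  unfold stepIndex
  have h : MeasurableSet {x | ∀ m, t (m + 1) ≤ x} := by
    have : {x | ∀ m, t (m + 1) ≤ x} = ⋂ m, {x | t (m + 1) ≤ x} := by ext; simp
    rw [this]
    exact MeasurableSet.iInter fun m => measurableSet_le measurable_const measurable_id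
  exact measurable_find _ fun n => (measurableSet_lt measurable_id measurable_const).union h

theorem stepIndex_le {n : ℕ} {x : ℝ} (h : x < t (n + 1)) : stepIndex t x ≤ n := by
  classical
  exact Nat.find_min' _ (Or.inl h)

theorem stepIndex_eq (ht : StrictMono t) {j : ℕ} {x : ℝ} (hx : x ∈ Ioo (t j) (t (j + 1))) :
    stepIndex t x = j := by
  classical
  refine (Nat.find_eq_iff _).2 ⟨Or.inl hx.2, fun m hm h => ?_⟩
  rcases h with h | h
  · exact (hx.1.trans h).not_ge (ht.monotone hm)
  · exact (h j).not_gt hx.2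

theorem stepFactor_self (b : ℕ → ℕ) (k : ℕ) : stepFactor b k k = 1 := by simp [stepFactor]

theorem stepFactor_succ {j : ℕ} (hj : k ≤ j) :
    stepFactor b k (j + 1) = √(b (j + 1)) * stepFactor b k j := by
  rw [stepFactor, stepFactor, Finset.prod_Ioc_succ_top hj, mul_comm]

theorem one_le_sqrt_natCast {n : ℕ} (h : 1 ≤ n) : 1 ≤ √(n : ℝ) :=
  Real.one_le_sqrt.2 (by exact_mod_cast h)

theorem one_le_stepFactor (hb : ∀ n, 1 ≤ n → 1 ≤ b n) (k j : ℕ) : 1 ≤ stepFactor b k j :=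
  Finset.one_le_prod fun i hi => one_le_sqrt_natCast (hb i (by
    have := (Finset.mem_Ioc.1 hi).1; omega))

theorem stepFactor_mono (hb : ∀ n, 1 ≤ n → 1 ≤ b n) (k : ℕ) : Monotone (stepFactor b k) := by
  refine monotone_nat_of_le_succ fun j => ?_
  rcases le_or_gt k j with h | h
  · rw [stepFactor_succ h]
    exact le_mul_of_one_le_left (zero_le_one.trans (one_le_stepFactor hb k j))
      (one_le_sqrt_natCast (hb _ (by omega)))
  · rw [stepFactor, stepFactor, Finset.Ioc_eq_empty (by omega), Finset.Ioc_eq_empty (by omega)]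

theorem prod_range_eq_mul_sq_stepFactor (b : ℕ → ℕ) {k j : ℕ} (hj : k ≤ j) :
    (∏ i ∈ Finset.range (j + 1), (b i : ℝ)) =
      (∏ i ∈ Finset.range (k + 1), (b i : ℝ)) * stepFactor b k j ^ 2 := by
  induction j, hj using Nat.le_induction with
  | base => simp [stepFactor_self]
  | succ j hj ih =>
    rw [Finset.prod_range_succ, ih, stepFactor_succ hj, mul_pow, Real.sq_sqrt (Nat.cast_nonneg _)]
    ring

theorem isLocalWeight_stepWeight (ht : StrictMono t) (hb : ∀ n, 1 ≤ n → 1 ≤ b n) (k : ℕ) :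
    IsLocalWeight (t k) (reducedInterval t k) (stepWeight b t k) where
  measurable := (measurable_of_countable (stepFactor b k)).comp (measurable_stepIndex t)
  pos x := zero_lt_one.trans_le (one_le_stepFactor hb _ _)
  bounded T hT := by
    obtain ⟨n, hn⟩ := lt_iSup_iff.1 hT.2
    have hn' : T < t n := EReal.coe_lt_coe_iff.1 hn
    obtain ⟨m, rfl⟩ : ∃ m, n = m + 1 :=
      ⟨n - 1, by have := ht.lt_iff_lt.1 (hT.1.trans hn'); omega⟩
    refine ⟨stepFactor b k m, fun x hx => ⟨stepFactor_mono hb k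
      (stepIndex_le (hx.2.trans_lt hn')), ?_⟩⟩
    exact (inv_le_one_of_one_le₀ (one_le_stepFactor hb _ _)).trans (one_le_stepFactor hb _ _)

/-- On `(t j, t (j + 1))` the squared weight is proportional to the number `b 0 ⋯ b j` of the edges of
level `j`, so its integral is infinite if the total length of the tree is. -/
theorem lintegral_stepWeight_sq (ht : StrictMono t)
    (hsum : ¬ Summable fun n => (∏ i ∈ Finset.range (n + 1), (b i : ℝ)) * (t (n + 1) - t n))
    (k : ℕ) : ∫⁻ x in reducedInterval t k, ENNReal.ofReal (stepWeight b t k x ^ 2) = ⊤ := by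
  by_contra hfin
  refine hsum ((summable_nat_add_iff k).1 ?_)
  set J : ℕ → Set ℝ := fun j => Ioo (t (j + k)) (t (j + k + 1)) with hJ
  have hdisj : Pairwise (Function.onFun Disjoint J) := by
    refine (pairwise_disjoint_on J).2 fun m n hmn => ?_
    refine Set.disjoint_left.2 fun x hx hx' => ?_
    exact (hx.2.trans_le (ht.monotone (by omega : m + k + 1 ≤ n + k))).not_gt hx'.1
  have hle : (∑' j, ∫⁻ x in J j, ENNReal.ofReal (stepWeight b t k x ^ 2)) ≠ ⊤ := by
    rw [← lintegral_iUnion (fun j => measurableSet_Ioo) hdisj]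
    refine ne_top_of_le_ne_top hfin (lintegral_mono_set (iUnion_subset fun j => ?_))
    exact Ioo_subset_reducedInterval ht (Nat.le_add_left k j)
  have hval : ∀ j, ∫⁻ x in J j, ENNReal.ofReal (stepWeight b t k x ^ 2) =
      ENNReal.ofReal (stepFactor b k (j + k) ^ 2 * (t (j + k + 1) - t (j + k))) := by
    intro j
    rw [ENNReal.ofReal_mul (sq_nonneg _), ← Real.volume_Ioo, ← setLIntegral_const]
    refine setLIntegral_congr_fun measurableSet_Ioo fun x hx => ?_
    simp only [stepWeight]
    rw [stepIndex_eq ht hx]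
  simp only [hval] at hle
  refine ((ENNReal.summable_toReal hle).mul_left
    (∏ i ∈ Finset.range (k + 1), (b i : ℝ))).congr fun j => ?_
  rw [ENNReal.toReal_ofReal (mul_nonneg (sq_nonneg _)
      (sub_nonneg.2 (ht (Nat.lt_succ_self _)).le)), ← mul_assoc,
    ← prod_range_eq_mul_sq_stepFactor b (Nat.le_add_left k j)]

end StepWeight

section Components

theorem integral_spinor_apply {a x : ℝ} {g : ℝ → Spinor} (hg : IntervalIntegrable g volume a x)
    (i : Fin 2) : (∫ s in a..x, g s) i = ∫ s in a..x, g s i :=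
  ((EuclideanSpace.proj (𝕜 := ℂ) i : Spinor →L[ℂ] ℂ).intervalIntegral_comp_comm hg).symm

theorem HasSobolevData.apply {a b : ℝ} (hab : a ≤ b) {f g : ℝ → Spinor} {p q : Spinor}
    (h : HasSobolevData a b f g p q) (i : Fin 2) :
    (∀ᵐ x ∂volume.restrict (Ioo a b), f x i = p i + ∫ s in a..x, g s i) ∧
      q i = p i + ∫ s in a..b, g s i := by
  have hi := h.intervalIntegrable hab
  constructor
  · filter_upwards [h.ae_eq, ae_restrict_mem measurableSet_Ioo] with x e hx
    rw [e, PiLp.add_apply, integral_spinor_apply (hi.mono_set (uIcc_subset_uIcc_left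
      (by rw [uIcc_of_le hab]; exact Ioo_subset_Icc_self hx)))]
  · conv_lhs => rw [h.right]
    rw [PiLp.add_apply, integral_spinor_apply hi]

theorem hasSobolevData_of_apply {a b : ℝ} (hab : a ≤ b) {f g : ℝ → Spinor} {p q : Spinor}
    (hg : MemLp g 2 (volume.restrict (Ioo a b)))
    (h : ∀ i, (∀ᵐ x ∂volume.restrict (Ioo a b), f x i = p i + ∫ s in a..x, g s i) ∧
      q i = p i + ∫ s in a..b, g s i) : HasSobolevData a b f g p q := by
  have hi : IntervalIntegrable g volume a b := by
    rw [intervalIntegrable_iff_integrableOn_Ioo_of_le hab]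
    exact hg.integrable (by norm_num)
  refine ⟨hg, ?_, ?_⟩
  · filter_upwards [(h 0).1, (h 1).1, ae_restrict_mem measurableSet_Ioo] with x e0 e1 hx
    have hix := hi.mono_set (uIcc_subset_uIcc_left
      (show x ∈ uIcc a b by rw [uIcc_of_le hab]; exact Ioo_subset_Icc_self hx))
    refine spinor_ext ?_ ?_
    · rw [e0, PiLp.add_apply, integral_spinor_apply hix]
    · rw [e1, PiLp.add_apply, integral_spinor_apply hix]
  · refine spinor_ext ?_ ?_
    · rw [(h 0).2, PiLp.add_apply, integral_spinor_apply hi]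
    · rw [(h 1).2, PiLp.add_apply, integral_spinor_apply hi]

end Components

section PiecewisePrimitives

variable {t : ℕ → ℝ} {k : ℕ} {I : Set ℝ} {ρ : ℝ → ℝ} {r s : ℕ → ℝ}

theorem mem_reducedInterval (ht : StrictMono t) {k n : ℕ} (hn : k < n) :
    t n ∈ reducedInterval t k :=
  ⟨ht hn, (EReal.coe_lt_coe_iff.2 (ht (Nat.lt_succ_self n))).trans_le
    (le_iSup (fun n => (t n : EReal)) (n + 1))⟩

theorem isRightOpenInterval_reducedInterval (ht : StrictMono t) (k : ℕ) :
    IsRightOpenInterval (t k) (reducedInterval t k) where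
  subset_Ioi x hx := hx.1
  Ioc_subset T hT x hx := ⟨hx.1, (EReal.coe_le_coe_iff.2 hx.2).trans_lt hT.2⟩
  exhaust := by
    refine ⟨fun n => t (k + 1 + n), fun n => mem_reducedInterval ht (by omega), fun x hx => ?_⟩
    obtain ⟨n, hn⟩ := lt_iSup_iff.1 hx.2
    exact mem_iUnion.2 ⟨n, hx.1, (EReal.coe_lt_coe_iff.1 hn).le.trans
      (ht.monotone (by omega))⟩

theorem ae_reducedInterval (ht : StrictMono t) {P : ℝ → Prop}
    (h : ∀ j, k ≤ j → ∀ᵐ x ∂volume.restrict (Ioo (t j) (t (j + 1))), P x) :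
    ∀ᵐ x ∂volume.restrict (reducedInterval t k), P x := by
  refine ae_restrict_of_ae_restrict_of_subset (reducedInterval_subset ht k) ?_
  refine (ae_restrict_union_iff _ _ _).2 ⟨?_, ?_⟩
  · exact (ae_restrict_biUnion_iff _ (to_countable (Ici k)) _).2 fun j hj => h j hj
  · rw [Measure.restrict_eq_zero.2 ((countable_range t).measure_zero _)]
    simp

/-- The primitive of `g / ρ` for a weight that is constant between the points `t j`. -/
theorem integral_step (ht : StrictMono t) (hρ : IsLocalWeight (t k) (reducedInterval t k) ρ)
    (hr : ∀ j, k ≤ j → ∀ x ∈ Ioo (t j) (t (j + 1)), ρ x = r j) {g : ℝ → ℂ}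
    (hg : MemLp g 2 (volume.restrict (reducedInterval t k))) {j : ℕ} (hj : k ≤ j) {x : ℝ}
    (hx : x ∈ Icc (t j) (t (j + 1))) :
    ∫ y in t k..x, (ρ y : ℂ)⁻¹ * g y =
      (∫ y in t k..t j, (ρ y : ℂ)⁻¹ * g y) + (r j : ℂ)⁻¹ * ∫ y in t j..x, g y := by
  have hI := isRightOpenInterval_reducedInterval ht k
  have hT := mem_reducedInterval ht (Nat.lt_succ_of_le hj)
  have hkj : t k ≤ t j := ht.monotone hj
  have hint := intervalIntegrable_of_memLp_two (ht.monotone (hj.trans (Nat.le_succ j)))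
    (hρ.memLp_inv_mul hT (hg.mono_measure (hI.restrict_le hT)))
  have h1 : IntervalIntegrable (fun y => (ρ y : ℂ)⁻¹ * g y) volume (t k) (t j) :=
    hint.mono_set (by
      rw [uIcc_of_le hkj, uIcc_of_le (hkj.trans (hx.1.trans hx.2))]
      exact Icc_subset_Icc_right (hx.1.trans hx.2))
  have h2 : IntervalIntegrable (fun y => (ρ y : ℂ)⁻¹ * g y) volume (t j) x :=
    hint.mono_set (by
      rw [uIcc_of_le hx.1, uIcc_of_le (hkj.trans (hx.1.trans hx.2))]
      exact Icc_subset_Icc hkj hx.2)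
  rw [← intervalIntegral.integral_add_adjacent_intervals h1 h2,
    ← intervalIntegral.integral_const_mul, intervalIntegral.integral_of_le hx.1,
    intervalIntegral.integral_of_le hx.1, integral_Ioc_eq_integral_Ioo,
    integral_Ioc_eq_integral_Ioo]
  congr 1
  refine setIntegral_congr_fun measurableSet_Ioo fun y hy => ?_
  rw [hr j hj y ⟨hy.1, hy.2.trans_le hx.2⟩]

/-- Primitives on the intervals `(t j, t (j + 1))` with initial values `P j` and final values
`Q (j + 1)` form a weighted primitive if the values are matched by the jumps `s j` of the weight. -/
theorem isWeightedPrimitive_of_pieces (ht : StrictMono t)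
    (hρ : IsLocalWeight (t k) (reducedInterval t k) ρ)
    (hr : ∀ j, k ≤ j → ∀ x ∈ Ioo (t j) (t (j + 1)), ρ x = r j) (hrk : r k = 1)
    (hr0 : ∀ j, r j ≠ 0) (hs : ∀ j, k ≤ j → r (j + 1) = s (j + 1) * r j) {f g : ℝ → ℂ}
    (hg : MemLp g 2 (volume.restrict (reducedInterval t k))) {P Q : ℕ → ℂ}
    (hf : ∀ j, k ≤ j → ∀ᵐ x ∂volume.restrict (Ioo (t j) (t (j + 1))),
      f x = P j + ∫ y in t j..x, g y)
    (hQ : ∀ j, k ≤ j → Q (j + 1) = P j + ∫ y in t j..t (j + 1), g y)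
    (hP : ∀ j, k < j → P j = s j * Q j) :
    IsWeightedPrimitive (t k) (reducedInterval t k) ρ (P k) f g := by
  have hr0' : ∀ j, (r j : ℂ) ≠ 0 := fun j => Complex.ofReal_ne_zero.2 (hr0 j)
  have key : ∀ j, k ≤ j → P j = r j * (P k + ∫ y in t k..t j, (ρ y : ℂ)⁻¹ * g y) := by
    intro j hj
    induction j, hj using Nat.le_induction with
    | base => rw [hrk]; simp
    | succ j hj ih =>
      rw [hP _ (Nat.lt_succ_of_le hj), hQ j hj, hs j hj, ih,
        integral_step ht hρ hr hg hj (right_mem_Icc.2 (ht (Nat.lt_succ_self j)).le)]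
      have := hr0' j
      push_cast
      field_simp
      ring
  refine ae_reducedInterval ht fun j hj => ?_
  filter_upwards [hf j hj, ae_restrict_mem measurableSet_Ioo] with x e hx
  rw [e, integral_step ht hρ hr hg hj (Ioo_subset_Icc_self hx), hr j hj x hx]
  conv_lhs => rw [key j hj]
  have := hr0' j
  field_simp
  ring

/-- The converse of `isWeightedPrimitive_of_pieces`. -/
theorem exists_pieces_of_isWeightedPrimitive (ht : StrictMono t)
    (hρ : IsLocalWeight (t k) (reducedInterval t k) ρ)
    (hr : ∀ j, k ≤ j → ∀ x ∈ Ioo (t j) (t (j + 1)), ρ x = r j) (hrk : r k = 1)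
    (hr0 : ∀ j, r j ≠ 0) (hs : ∀ j, k ≤ j → r (j + 1) = s (j + 1) * r j) {f g : ℝ → ℂ}
    (hg : MemLp g 2 (volume.restrict (reducedInterval t k))) {q : ℂ}
    (h : IsWeightedPrimitive (t k) (reducedInterval t k) ρ q f g) :
    ∃ P Q : ℕ → ℂ, P k = q ∧
      (∀ j, k ≤ j → ∀ᵐ x ∂volume.restrict (Ioo (t j) (t (j + 1))),
        f x = P j + ∫ y in t j..x, g y) ∧
      (∀ j, k ≤ j → Q (j + 1) = P j + ∫ y in t j..t (j + 1), g y) ∧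
      (∀ j, k < j → P j = s j * Q j) := by
  have hr0' : ∀ j, (r j : ℂ) ≠ 0 := fun j => Complex.ofReal_ne_zero.2 (hr0 j)
  refine ⟨fun j => r j * (q + ∫ y in t k..t j, (ρ y : ℂ)⁻¹ * g y),
    fun j => r (j - 1) * (q + ∫ y in t k..t j, (ρ y : ℂ)⁻¹ * g y), ?_, ?_, ?_, ?_⟩
  · simp [hrk]
  · intro j hj
    filter_upwards [ae_restrict_of_ae_restrict_of_subset (Ioo_subset_reducedInterval ht hj) h,
      ae_restrict_mem measurableSet_Ioo] with x e hx
    rw [e, integral_step ht hρ hr hg hj (Ioo_subset_Icc_self hx), hr j hj x hx]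
    have := hr0' j
    field_simp
    ring
  · intro j hj
    simp only [Nat.add_sub_cancel]
    rw [integral_step ht hρ hr hg hj (right_mem_Icc.2 (ht (Nat.lt_succ_self j)).le)]
    have := hr0' j
    field_simp
    ring
  · intro j hj
    obtain ⟨m, rfl⟩ : ∃ m, j = m + 1 := ⟨j - 1, by omega⟩
    simp only [Nat.add_sub_cancel]
    rw [hs m (Nat.le_of_lt_succ hj)]
    push_cast
    ring

end PiecewisePrimitives

section ReducedDirac

variable {t : ℕ → ℝ} {b : ℕ → ℕ}

theorem mem_graph_reducedDirac {ht : StrictMono t} {c : ℝ} {k : ℕ}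
    {u v : SpinorL2 (reducedInterval t k)} : (u, v) ∈ (reducedDirac b t ht c k).graph ↔
    (u, v) ∈ reducedGraph b t ht c k := by
  rw [reducedDirac, Submodule.toLinearPMap_graph_eq _ (reducedGraph_functional b t ht c k)]

/-- Gluing the pieces with the matching conditions: the operator `M_k` is the weighted Dirac
operator with the step weight. -/
theorem mem_graph_reducedDirac_iff (ht : StrictMono t) (hb : ∀ n, 1 ≤ n → 1 ≤ b n) (c : ℝ) (k : ℕ)
    (u v : SpinorL2 (reducedInterval t k)) :
    (u, v) ∈ (reducedDirac b t ht c k).graph ↔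
      ∃ (g : SpinorL2 (reducedInterval t k)) (q : ℂ),
        IsWeightedDiracPair (t k) (reducedInterval t k) (stepWeight b t k) q u g ∧
          ∀ᵐ x ∂volume.restrict (reducedInterval t k), v x = diracExpr c (u x) (g x) := by
  have hω := isLocalWeight_stepWeight ht hb k
  have hr0 : ∀ j, stepFactor b k j ≠ 0 := fun j =>
    (zero_lt_one.trans_le (one_le_stepFactor hb k j)).ne'
  have hr1 : ∀ j, k ≤ j → ∀ x ∈ Ioo (t j) (t (j + 1)), stepWeight b t k x = stepFactor b k j :=
    fun j _ x hx => by rw [stepWeight, stepIndex_eq ht hx]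
  have hr2 : ∀ j, k ≤ j → ∀ x ∈ Ioo (t j) (t (j + 1)),
      (stepWeight b t k x)⁻¹ = (stepFactor b k j)⁻¹ := fun j hj x hx => by rw [hr1 j hj x hx]
  have hs1 : ∀ j, k ≤ j → stepFactor b k (j + 1) = √(b (j + 1)) * stepFactor b k j :=
    fun j hj => stepFactor_succ hj
  have hs2 : ∀ j, k ≤ j →
      (stepFactor b k (j + 1))⁻¹ = (√(b (j + 1)))⁻¹ * (stepFactor b k j)⁻¹ :=
    fun j hj => by rw [hs1 j hj, mul_inv]
  have hk2 : (stepFactor b k k)⁻¹ = 1 := by rw [stepFactor_self, inv_one]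
  rw [mem_graph_reducedDirac]
  constructor
  · rintro ⟨g, p, q, h1, h2, h3⟩
    have hle : ∀ j, t j ≤ t (j + 1) := fun j => (ht (Nat.lt_succ_self j)).le
    refine ⟨g, p k 1, ⟨?_, ?_⟩, h3⟩
    · rw [← h2.boundary]
      exact isWeightedPrimitive_of_pieces ht hω hr1 (stepFactor_self b k) hr0 hs1
        (memLp_spinor_apply (Lp.memLp g) 0) (P := fun j => p j 0) (Q := fun j => q j 0)
        (fun j hj => ((h1 j hj).apply (hle j) 0).1) (fun j hj => ((h1 j hj).apply (hle j) 0).2)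
        (fun j hj => h2.upper j hj)
    · exact isWeightedPrimitive_of_pieces ht hω.inv hr2 hk2 (fun j => inv_ne_zero (hr0 j)) hs2
        (memLp_spinor_apply (Lp.memLp g) 1) (P := fun j => p j 1) (Q := fun j => q j 1)
        (fun j hj => ((h1 j hj).apply (hle j) 1).1) (fun j hj => ((h1 j hj).apply (hle j) 1).2)
        (fun j hj => by rw [h2.lower j hj, Complex.ofReal_inv])
  · rintro ⟨g, q, ⟨h0, h1⟩, h3⟩
    obtain ⟨P, Q, hP, hf, hQ, hm⟩ := exists_pieces_of_isWeightedPrimitive ht hω hr1 (s := fun j => √(b j))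
      (stepFactor_self b k) hr0 hs1 (memLp_spinor_apply (Lp.memLp g) 0) h0
    obtain ⟨P', Q', -, hf', hQ', hm'⟩ := exists_pieces_of_isWeightedPrimitive ht hω.inv hr2
      (s := fun j => (√(b j))⁻¹)
      hk2 (fun j => inv_ne_zero (hr0 j)) hs2 (memLp_spinor_apply (Lp.memLp g) 1) h1
    refine ⟨g, fun j => !₂[P j, P' j], fun j => !₂[Q j, Q' j], fun j hj => ?_,
      ⟨by simpa using hP, fun j hj => by simpa using hm j hj,
        fun j hj => by simpa using hm' j hj⟩, h3⟩
    refine hasSobolevData_of_apply (ht (Nat.lt_succ_self j)).le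
      ((Lp.memLp g).mono_measure (Measure.restrict_mono_set _ (Ioo_subset_reducedInterval ht hj)))
      fun i => ?_
    fin_cases i
    · exact ⟨by simpa using hf j hj, by simpa using hQ j hj⟩
    · exact ⟨by simpa using hf' j hj, by simpa using hQ' j hj⟩

/-- The bound for the inverse is uniform in `k`. -/
theorem exists_hasSelfAdjointInverse_reducedDirac (ht : StrictMono t)
    (hb : ∀ n, 1 ≤ n → 1 ≤ b n)
    (hsum : ¬ Summable fun n => (∏ i ∈ Finset.range (n + 1), (b i : ℝ)) * (t (n + 1) - t n))
    {c : ℝ} (hc : 0 < c) (k : ℕ) :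
    ∃ S : SpinorL2 (reducedInterval t k) →L[ℂ] SpinorL2 (reducedInterval t k),
      HasSelfAdjointInverse (reducedDirac b t ht c k) S ∧ ‖S‖ ≤ (c ^ 2)⁻¹ :=
  exists_hasSelfAdjointInverse_of_graph (isRightOpenInterval_reducedInterval ht k)
    (isLocalWeight_stepWeight ht hb k) (lintegral_stepWeight_sq ht hsum k) hc _
    (mem_graph_reducedDirac_iff ht hb c k)

end ReducedDirac

/-! ### Haar systems on regular trees -/

section ZeroFiberSums

/-- The functions whose sums over the fibers of a surjective map vanish have an orthonormal
basis; its cardinality follows from rank–nullity. -/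
theorem exists_orthonormal_zero_fiber_sums {X Y : Type*} [Fintype X] [Fintype Y] [DecidableEq Y]
    {f : X → Y} (hf : Function.Surjective f) {r : ℕ}
    (hr : Fintype.card X = Fintype.card Y + r) :
    ∃ w : Fin r → X → ℂ, (∀ j y, ∑ x with f x = y, w j x = 0) ∧
      ∀ j j', ∑ x, conj (w j x) * w j' x = if j = j' then 1 else 0 := by
  let L : EuclideanSpace ℂ X →ₗ[ℂ] (Y → ℂ) :=
    { toFun := fun v y => ∑ x with f x = y, v x
      map_add' := fun v w => by ext y; simp [Finset.sum_add_distrib]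
      map_smul' := fun a v => by ext y; simp [Finset.mul_sum] }
  have hL : Function.Surjective L := by
    classical
    intro φ
    refine ⟨WithLp.toLp 2 fun x => if x = Function.surjInv hf (f x) then φ (f x) else 0, ?_⟩
    ext y
    change ∑ x with f x = y, (if x = Function.surjInv hf (f x) then φ (f x) else 0) = φ y
    rw [Finset.sum_eq_single (Function.surjInv hf y)]
    · simp [Function.surjInv_eq hf]
    · intro x hx hne
      rw [(Finset.mem_filter.1 hx).2, if_neg hne]
    · intro h
      exact (h (by simp [Function.surjInv_eq hf])).elim
  have hrank : Module.finrank ℂ (LinearMap.ker L) = r := by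
    have h := LinearMap.finrank_range_add_finrank_ker L
    rw [LinearMap.range_eq_top.2 hL, finrank_top, Module.finrank_fintype_fun_eq_card,
      finrank_euclideanSpace, hr] at h
    omega
  let B := (stdOrthonormalBasis ℂ (LinearMap.ker L)).reindex (finCongr hrank)
  refine ⟨fun j x => (B j : EuclideanSpace ℂ X) x, fun j y => ?_, fun j j' => ?_⟩
  · exact congrFun (LinearMap.mem_ker.1 (B j).2) y
  · rw [← orthonormal_iff_ite.1 B.orthonormal j j', Submodule.coe_inner, PiLp.inner_apply]
    exact Finset.sum_congr rfl fun x _ => by simp [mul_comm]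

end ZeroFiberSums

section HaarSystem

variable {b : ℕ → ℕ}

/-- The indices of the orthogonal sum whose level is at most `n`. -/
def ReducedIndex.upTo (b : ℕ → ℕ) (n : ℕ) : Finset (ReducedIndex b) :=
  Finset.univ.disjSum ((Finset.range n).sigma fun _ => Finset.univ)

theorem ReducedIndex.mem_upTo {n : ℕ} {i : ReducedIndex b} : i ∈ upTo b n ↔ i.level ≤ n := by
  rcases i with i | ⟨m, j⟩
  · simp [upTo, level]
  · simp [upTo, level]

theorem ReducedIndex.card_upTo (hb0 : b 0 = 1) (hb : ∀ n, 1 ≤ n → 1 ≤ b n) (n : ℕ) :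
    (upTo b n).card = ∏ i ∈ Finset.range (n + 1), b i := by
  have h : ∀ n, (upTo b n).card =
      1 + ∑ m ∈ Finset.range n, (∏ i ∈ Finset.range (m + 1), b i) * (b (m + 1) - 1) := by
    intro n
    simp [upTo, Finset.card_sigma]
  induction n with
  | zero => simp [h, hb0]
  | succ n ih =>
    rw [h, Finset.sum_range_succ, ← add_assoc, ← h, ih, Finset.prod_range_succ _ (n + 1)]
    obtain ⟨d, hd⟩ := Nat.exists_eq_add_of_le (hb (n + 1) (by omega))
    rw [hd, Nat.add_sub_cancel_left]
    ring

theorem ReducedIndex.upTo_subset (b : ℕ → ℕ) (n : ℕ) :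
    ReducedIndex.upTo b n ⊆ ReducedIndex.upTo b (n + 1) := fun _ hi =>
  ReducedIndex.mem_upTo.2 ((ReducedIndex.mem_upTo.1 hi).trans n.le_succ)

theorem ofReal_sqrt_mul_self_natCast (n : ℕ) : (√(n : ℝ) : ℂ) * (√(n : ℝ) : ℂ) = n := by
  rw [← Complex.ofReal_mul, Real.mul_self_sqrt (Nat.cast_nonneg _), Complex.ofReal_natCast]

/-- A system of functions `a i n`, indexed by `i`, on the levels `E n` of a tree with branching
numbers `b`, that is adapted to the tree like the Haar functions to the dyadic tree: `a i`
vanishes below the level of `i`, has vanishing sums over siblings at that level, and is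
propagated with a normalizing factor beyond it. -/
structure IsHaarSystem {E : ℕ → Type*} [∀ n, Fintype (E n)] (π : ∀ n, E (n + 1) → E n)
    (a : ReducedIndex b → ∀ n, E n → ℂ) : Prop where
  zero : ∀ i n e, n < i.level → a i n e = 0
  propagate : ∀ i n e, i.level ≤ n → a i (n + 1) e = (√(b (n + 1)) : ℂ)⁻¹ * a i n (π n e)
  sum_siblings : ∀ i n, i.level = n + 1 → ∀ φ : E n → ℂ, ∑ e, φ (π n e) * a i (n + 1) e = 0
  orthonormal : ∀ n i i', i.level ≤ n → i'.level ≤ n →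
    ∑ e, conj (a i n e) * a i' n e = open Classical in if i = i' then 1 else 0

variable {E : ℕ → Type*} [∀ n, Fintype (E n)] [∀ n, DecidableEq (E n)] {π : ∀ n, E (n + 1) → E n}

theorem sum_comp_eq_of_card_fiber {X Y : Type*} [Fintype X] [Fintype Y] [DecidableEq Y]
    {f : X → Y} {r : ℕ} (hf : ∀ y, (Finset.univ.filter fun x => f x = y).card = r) (φ : Y → ℂ) :
    ∑ x, φ (f x) = r * ∑ y, φ y := by
  rw [← Finset.sum_fiberwise_of_maps_to (fun x _ => Finset.mem_univ (f x)), Finset.mul_sum]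
  refine Finset.sum_congr rfl fun y _ => ?_
  rw [Finset.sum_congr rfl fun x hx => by rw [(Finset.mem_filter.1 hx).2], Finset.sum_const, hf,
    nsmul_eq_mul]

theorem card_level (hE0 : Fintype.card (E 0) = 1) (hb0 : b 0 = 1)
    (hπ : ∀ n e, (Finset.univ.filter fun e' => π n e' = e).card = b (n + 1)) (n : ℕ) :
    Fintype.card (E n) = ∏ i ∈ Finset.range (n + 1), b i := by
  induction n with
  | zero => simp [hE0, hb0]
  | succ n ih =>
    rw [Finset.prod_range_succ, ← ih, ← Finset.card_univ,
      Finset.card_eq_sum_card_fiberwise (fun x _ => Finset.mem_univ (π n x)),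
      Finset.sum_congr rfl fun e _ => hπ n e, Finset.sum_const, smul_eq_mul, Finset.card_univ]

/-- The vectors of level `n + 1` are an orthonormal basis of the functions on `E (n + 1)` whose sums
over siblings vanish; those of lower level are constant on siblings, hence orthogonal to them. -/
theorem exists_isHaarSystem (hE0 : Fintype.card (E 0) = 1) (hb0 : b 0 = 1)
    (hb : ∀ n, 1 ≤ n → 1 ≤ b n)
    (hπ : ∀ n e, (Finset.univ.filter fun e' => π n e' = e).card = b (n + 1)) :
    ∃ a : ReducedIndex b → ∀ n, E n → ℂ, IsHaarSystem π a := by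
  classical
  have hsurj : ∀ n, Function.Surjective (π n) := fun n e => by
    have h : 0 < (Finset.univ.filter fun e' => π n e' = e).card := by
      rw [hπ]; exact hb _ (by omega)
    obtain ⟨e', he'⟩ := Finset.card_pos.1 h
    exact ⟨e', (Finset.mem_filter.1 he').2⟩
  have hcard : ∀ m, Fintype.card (E (m + 1)) =
      Fintype.card (E m) + (∏ i ∈ Finset.range (m + 1), b i) * (b (m + 1) - 1) := by
    intro m
    rw [card_level hE0 hb0 hπ, card_level hE0 hb0 hπ, Finset.prod_range_succ]
    obtain ⟨d, hd⟩ := Nat.exists_eq_add_of_le (hb (m + 1) (by omega))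
    rw [hd, Nat.add_sub_cancel_left]
    ring
  choose w hw0 hw1 using fun m => exists_orthonormal_zero_fiber_sums (hsurj m) (hcard m)
  let W : ReducedIndex b → ∀ n, E (n + 1) → ℂ := fun i n e => match i with
    | Sum.inl _ => 0
    | Sum.inr ⟨m, j⟩ => if h : m = n then w n (h ▸ j) e else 0
  let a : ReducedIndex b → ∀ n, E n → ℂ := fun i n => Nat.rec
    (motive := fun n => E n → ℂ) (fun _ => if i.level = 0 then 1 else 0)
    (fun n prev e => if i.level = n + 1 then W i n e else (√(b (n + 1)) : ℂ)⁻¹ * prev (π n e)) n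
  have ha0 : ∀ i e, a i 0 e = if i.level = 0 then 1 else 0 := fun i e => rfl
  have ha1 : ∀ i n e, a i (n + 1) e =
    if i.level = n + 1 then W i n e else (√(b (n + 1)) : ℂ)⁻¹ * a i n (π n e) := fun i n e => rfl
  have hinr : ∀ (i : ReducedIndex b) n, i.level = n + 1 → ∃ j, i = Sum.inr ⟨n, j⟩ := by
    rintro (i | ⟨m, j⟩) n h
    · simp [ReducedIndex.level] at h
    · obtain rfl : m = n := by simpa [ReducedIndex.level] using h
      exact ⟨j, rfl⟩
  have hnew : ∀ n j e, a (Sum.inr ⟨n, j⟩) (n + 1) e = w n j e := fun n j e => by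
    rw [ha1, if_pos (by rfl)]; simp [W]
  have hprop : ∀ i n e, i.level ≤ n →
      a i (n + 1) e = (√(b (n + 1)) : ℂ)⁻¹ * a i n (π n e) := fun i n e h => by
    rw [ha1, if_neg (by omega)]
  have hsib : ∀ i n, i.level = n + 1 → ∀ φ : E n → ℂ, ∑ e, φ (π n e) * a i (n + 1) e = 0 := by
    intro i n h φ
    obtain ⟨j, rfl⟩ := hinr i n h
    rw [← Finset.sum_fiberwise_of_maps_to (fun x _ => Finset.mem_univ (π n x))]
    refine Finset.sum_eq_zero fun y _ => ?_
    rw [← mul_zero (φ y), ← hw0 n j y, Finset.mul_sum]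
    exact Finset.sum_congr rfl fun x hx => by rw [(Finset.mem_filter.1 hx).2, hnew]
  refine ⟨a, fun i n => ?_, hprop, hsib, fun n => ?_⟩
  · induction n with
    | zero => intro e h; rw [ha0, if_neg (by omega)]
    | succ n ih =>
      intro e h
      rw [ha1, if_neg (by omega), ih _ (by omega), mul_zero]
  · induction n with
    | zero =>
      intro i i' h h'
      have h0 : ∀ i : ReducedIndex b, i.level ≤ 0 → i = Sum.inl () := by
        rintro (i | i) h
        · rfl
        · simp [ReducedIndex.level] at h
      rw [h0 i h, h0 i' h']
      simp [ha0, ReducedIndex.level, hE0]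
    | succ n ih =>
      intro i i' h h'
      rcases Nat.le_succ_iff.1 h with h | h <;> rcases Nat.le_succ_iff.1 h' with h' | h'
      · rw [← ih i i' h h']
        have hne : (√(b (n + 1)) : ℂ) ≠ 0 := Complex.ofReal_ne_zero.2
          (zero_lt_one.trans_le (one_le_sqrt_natCast (hb (n + 1) (by omega)))).ne'
        have := sum_comp_eq_of_card_fiber (hπ n) fun e => conj (a i n e) * a i' n e
        rw [← ofReal_sqrt_mul_self_natCast] at this
        calc ∑ e, conj (a i (n + 1) e) * a i' (n + 1) e
            = (√(b (n + 1)) : ℂ)⁻¹ * (√(b (n + 1)) : ℂ)⁻¹ *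
                ∑ e, conj (a i n (π n e)) * a i' n (π n e) := by
              rw [Finset.mul_sum]
              refine Finset.sum_congr rfl fun e _ => ?_
              rw [hprop i n e h, hprop i' n e h', map_mul, map_inv₀, Complex.conj_ofReal]
              ring
          _ = ∑ e, conj (a i n e) * a i' n e := by rw [this]; field_simp
      · rw [if_neg (by rintro rfl; omega), ← hsib i' n h' fun e =>
          conj ((√(b (n + 1)) : ℂ)⁻¹ * a i n e)]
        exact Finset.sum_congr rfl fun e _ => by rw [hprop i n e h]
      · have := hsib i n h fun e => conj ((√(b (n + 1)) : ℂ)⁻¹ * a i' n e)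
        rw [if_neg (by rintro rfl; omega), ← map_zero (starRingEnd ℂ), ← this, map_sum]
        refine Finset.sum_congr rfl fun e _ => ?_
        rw [hprop i' n e h', map_mul, Complex.conj_conj, mul_comm]
      · obtain ⟨j, rfl⟩ := hinr i n h
        obtain ⟨j', rfl⟩ := hinr i' n h'
        simp only [hnew]
        rw [hw1]
        simp

/-- By a count of dimensions, the functions of level at most `n` form a basis on `E n`. -/
theorem IsHaarSystem.complete {a : ReducedIndex b → ∀ n, E n → ℂ} (ha : IsHaarSystem π a)
    (hE0 : Fintype.card (E 0) = 1) (hb0 : b 0 = 1) (hb : ∀ n, 1 ≤ n → 1 ≤ b n)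
    (hπ : ∀ n e, (Finset.univ.filter fun e' => π n e' = e).card = b (n + 1)) (n : ℕ) (e e' : E n) :
    ∑ i ∈ ReducedIndex.upTo b n, a i n e * conj (a i n e') = if e = e' then 1 else 0 := by
  classical
  let A : Matrix (ReducedIndex.upTo b n) (E n) ℂ := fun i e => conj (a i n e)
  let B : Matrix (E n) (ReducedIndex.upTo b n) ℂ := fun e i => a i n e
  have hAB : A * B = 1 := by
    ext i i'
    rw [Matrix.mul_apply, Matrix.one_apply]
    refine (ha.orthonormal n i i' (ReducedIndex.mem_upTo.1 i.2)
      (ReducedIndex.mem_upTo.1 i'.2)).trans ?_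
    simp only [Subtype.ext_iff]
  have hBA : B * A = 1 := (Matrix.mul_eq_one_comm_of_card_eq _ _ _ (by
    rw [Fintype.card_coe, ReducedIndex.card_upTo hb0 hb, card_level hE0 hb0 hπ])).1 hAB
  have := congrFun (congrFun hBA e) e'
  rw [Matrix.mul_apply, Matrix.one_apply] at this
  rw [← this, ← Finset.sum_coe_sort]

end HaarSystem

/-! ### Edges of a regular metric tree by level -/

namespace MetricTree

variable {Γ : MetricTree.{u}}

theorem lt_iff_le_pred {v w : Γ.tree} (hw : w ≠ ⊥) : v < w ↔ v ≤ Order.pred w :=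
  (Order.le_pred_iff_of_not_isMin (by rwa [isMin_iff_eq_bot])).symm

theorem Iio_eq_insert_pred {w : Γ.tree} (hw : w ≠ ⊥) :
    Iio w = insert (Order.pred w) (Iio (Order.pred w)) := by
  ext v
  rw [mem_Iio, lt_iff_le_pred hw, mem_insert_iff, mem_Iio, le_iff_eq_or_lt]

/-- Induction along the path from the root. -/
theorem vertex_induction {P : Γ.tree → Prop} (bot : P ⊥)
    (pred : ∀ w, w ≠ ⊥ → P (Order.pred w) → P w) (v : Γ.tree) : P v := by
  obtain ⟨n, hn⟩ := (bot_le (a := v)).exists_pred_iterate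
  induction n generalizing v with
  | zero => rw [show v = ⊥ from hn]; exact bot
  | succ n ih =>
    by_cases hv : v = ⊥
    · rw [hv]; exact bot
    · exact pred v hv (ih _ hn)

theorem finite_Iio (v : Γ.tree) : (Iio v).Finite := by
  induction v using vertex_induction with
  | bot => simp
  | pred w hw ih => rw [Iio_eq_insert_pred hw]; exact ih.insert _

theorem gen_bot : Γ.gen ⊥ = 0 := by simp [gen]

theorem gen_eq_gen_pred_add_one {w : Γ.tree} (hw : w ≠ ⊥) : Γ.gen w = Γ.gen (Order.pred w) + 1 := by
  rw [gen, Iio_eq_insert_pred hw, ncard_insert_of_notMem (by simp) (finite_Iio _), gen]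

theorem gen_eq_zero_iff {v : Γ.tree} : Γ.gen v = 0 ↔ v = ⊥ := by
  refine ⟨fun h => ?_, fun h => h ▸ gen_bot⟩
  by_contra hv
  rw [gen_eq_gen_pred_add_one hv] at h
  omega

theorem mem_emanating {v : Γ.tree} {e : Γ.Edge} : e ∈ Γ.emanating v ↔ Order.pred e.1 = v := by
  rw [emanating, Finite.mem_toFinset, mem_ofPred_eq]
  refine ⟨fun h => h.pred_eq, fun h => h ▸ Order.pred_covBy_of_not_isMin ?_⟩
  rw [isMin_iff_eq_bot]
  exact e.2

theorem finite_edge_le (v : Γ.tree) : {e : Γ.Edge | e.1 ≤ v}.Finite := by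
  refine Finite.of_finite_image (f := Subtype.val) (((finite_Iio v).insert v).subset ?_)
    Subtype.val_injective.injOn
  rintro _ ⟨e, he, rfl⟩
  exact (le_iff_eq_or_lt.1 he).imp id id

theorem distRoot_eq_distRoot_pred_add (e : Γ.Edge) :
    Γ.distRoot e.1 = Γ.distRoot (Order.pred e.1) + Γ.length e := by
  have h : {e' : Γ.Edge | e'.1 ≤ e.1} = insert e {e' : Γ.Edge | e'.1 ≤ Order.pred e.1} := by
    ext e'
    rw [mem_ofPred_eq, le_iff_eq_or_lt, lt_iff_le_pred e.2, mem_insert_iff, Subtype.ext_iff,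
      mem_ofPred_eq]
  have hn : e ∉ {e' : Γ.Edge | e'.1 ≤ Order.pred e.1} := fun h =>
    ((lt_iff_le_pred e.2).2 h).false
  have := finsum_mem_insert Γ.length hn (finite_edge_le _)
  rw [← h, add_comm] at this
  exact this

/-- The generation of the initial vertex of an edge. -/
noncomputable def edgeLevel (e : Γ.Edge) : ℕ := Γ.gen (Order.pred e.1)

theorem gen_eq_edgeLevel_add_one (e : Γ.Edge) : Γ.gen e.1 = edgeLevel e + 1 :=
  gen_eq_gen_pred_add_one e.2

theorem edgeLevel_of_mem_emanating {e e' : Γ.Edge} (h : e' ∈ Γ.emanating e.1) :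
    edgeLevel e' = edgeLevel e + 1 := by
  rw [edgeLevel, mem_emanating.1 h, gen_eq_edgeLevel_add_one]

theorem edgeLevel_eq_zero_iff {e : Γ.Edge} : edgeLevel e = 0 ↔ e ∈ Γ.emanating ⊥ := by
  rw [edgeLevel, gen_eq_zero_iff, mem_emanating]

theorem finite_setOf_edgeLevel_eq (n : ℕ) : {e : Γ.Edge | edgeLevel e = n}.Finite := by
  induction n with
  | zero =>
    refine (Γ.emanating ⊥).finite_toSet.subset fun e he => ?_
    exact edgeLevel_eq_zero_iff.1 he
  | succ n ih =>
    refine (ih.biUnion fun e _ => (Γ.emanating e.1).finite_toSet).subset fun e he => ?_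
    have hne : Order.pred e.1 ≠ ⊥ := fun h => by
      have h1 : Γ.gen (Order.pred e.1) = n + 1 := he
      rw [h, gen_bot] at h1
      omega
    refine mem_biUnion (x := ⟨Order.pred e.1, hne⟩) ?_ (mem_emanating.2 rfl)
    have := gen_eq_edgeLevel_add_one (⟨Order.pred e.1, hne⟩ : Γ.Edge)
    exact Nat.succ_injective (this.symm.trans he)

variable (Γ) in
/-- The edges whose initial vertex has generation `n`. -/
abbrev EdgesAt (n : ℕ) : Type u := {e : Γ.Edge // edgeLevel e = n}

noncomputable instance (n : ℕ) : Fintype (Γ.EdgesAt n) :=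
  (finite_setOf_edgeLevel_eq n).fintype

noncomputable instance (n : ℕ) : DecidableEq (Γ.EdgesAt n) := Classical.decEq _

theorem pred_ne_bot {n : ℕ} (e : Γ.EdgesAt (n + 1)) : Order.pred e.1.1 ≠ ⊥ := fun h => by
  have h1 : Γ.gen (Order.pred e.1.1) = n + 1 := e.2
  rw [h, gen_bot] at h1
  omega

/-- The edge that terminates where the given edge begins. -/
noncomputable def parentEdge (n : ℕ) (e : Γ.EdgesAt (n + 1)) : Γ.EdgesAt n :=
  ⟨⟨Order.pred e.1.1, pred_ne_bot e⟩, Nat.succ_injective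
    ((gen_eq_edgeLevel_add_one (⟨Order.pred e.1.1, pred_ne_bot e⟩ : Γ.Edge)).symm.trans e.2)⟩

theorem parentEdge_eq_iff {n : ℕ} {e : Γ.EdgesAt n} {e' : Γ.EdgesAt (n + 1)} :
    parentEdge n e' = e ↔ e'.1 ∈ Γ.emanating e.1.1 := by
  rw [mem_emanating, Subtype.ext_iff, Subtype.ext_iff, parentEdge]

theorem sum_emanating {M : Type*} [AddCommMonoid M] {n : ℕ} (e : Γ.EdgesAt n) (F : Γ.Edge → M) :
    ∑ e' ∈ Γ.emanating e.1.1, F e' = ∑ e' with parentEdge n e' = e, F e'.1 := by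
  refine (Finset.sum_bij (fun e' _ => e'.1) ?_ ?_ ?_ ?_).symm
  · intro e' he'
    exact parentEdge_eq_iff.1 (Finset.mem_filter.1 he').2
  · exact fun _ _ _ _ h => Subtype.ext h
  · intro e' he'
    refine ⟨⟨e', by rw [edgeLevel_of_mem_emanating he', e.2]⟩, ?_, rfl⟩
    exact Finset.mem_filter.2 ⟨Finset.mem_univ _, parentEdge_eq_iff.2 he'⟩
  · exact fun _ _ => rfl

theorem sum_emanating_bot {M : Type*} [AddCommMonoid M] (F : Γ.Edge → M) :
    ∑ e' ∈ Γ.emanating ⊥, F e' = ∑ e' : Γ.EdgesAt 0, F e'.1 := by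
  refine (Finset.sum_bij (fun e' _ => e'.1) ?_ ?_ ?_ ?_).symm
  · exact fun e' _ => edgeLevel_eq_zero_iff.1 e'.2
  · exact fun _ _ _ _ h => Subtype.ext h
  · exact fun e' he' => ⟨⟨e', edgeLevel_eq_zero_iff.2 he'⟩, Finset.mem_univ _, rfl⟩
  · exact fun _ _ => rfl

variable {b : ℕ → ℕ} {t : ℕ → ℝ}

theorem IsRegular.card_edgesAt_zero (h : Γ.IsRegular b t) (hb0 : b 0 = 1) :
    Fintype.card (Γ.EdgesAt 0) = 1 := by
  have := h.branching_eq ⊥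
  rw [gen_bot, hb0, branching, Finset.card_eq_sum_ones, sum_emanating_bot] at this
  simpa using this

theorem IsRegular.card_fiber_parentEdge (h : Γ.IsRegular b t) (n : ℕ) (e : Γ.EdgesAt n) :
    (Finset.univ.filter fun e' => parentEdge n e' = e).card = b (n + 1) := by
  have := h.branching_eq e.1.1
  rwa [gen_eq_edgeLevel_add_one, e.2, branching, Finset.card_eq_sum_ones, sum_emanating,
    ← Finset.card_eq_sum_ones] at this

theorem IsRegular.length_eq (h : Γ.IsRegular b t) (e : Γ.Edge) :
    Γ.length e = t (edgeLevel e + 1) - t (edgeLevel e) := by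
  have := distRoot_eq_distRoot_pred_add e
  rw [h.distRoot_eq, h.distRoot_eq, gen_eq_edgeLevel_add_one] at this
  rw [this, edgeLevel]
  ring

/-- The total length of the tree, summed level by level. -/
theorem IsRegular.not_summable (h : Γ.IsRegular b t) (hb0 : b 0 = 1)
    (hlen : ¬ Summable Γ.length) :
    ¬ Summable fun n => (∏ i ∈ Finset.range (n + 1), (b i : ℝ)) * (t (n + 1) - t n) := by
  refine fun hs => hlen ?_
  rw [← (Equiv.sigmaFiberEquiv (edgeLevel (Γ := Γ))).summable_iff]
  have hnonneg : ∀ x, 0 ≤ (Γ.length ∘ Equiv.sigmaFiberEquiv (edgeLevel (Γ := Γ))) x :=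
    fun x => (Γ.length_pos _).le
  refine (summable_sigma_of_nonneg hnonneg).2 ⟨fun n => Summable.of_finite, hs.congr fun n => ?_⟩
  have hval : ∀ e : Γ.EdgesAt n, (Γ.length ∘ Equiv.sigmaFiberEquiv (edgeLevel (Γ := Γ))) ⟨n, e⟩ =
      t (n + 1) - t n := fun e => by
    rw [Function.comp_apply]
    exact (h.length_eq e.1).trans (by rw [e.2])
  rw [tsum_fintype, Finset.sum_congr rfl fun e _ => hval e, Finset.sum_const, nsmul_eq_mul,
    Finset.card_univ, card_level (h.card_edgesAt_zero hb0) hb0 h.card_fiber_parentEdge,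
    Nat.cast_prod]

end MetricTree

/-! ### Translation between edges and pieces of the half-line -/

section Translation

variable {I J : Set ℝ}

theorem ae_restrict_comp_add (hI : MeasurableSet I) (τ : ℝ) {P : ℝ → Prop}
    (h : ∀ᵐ x ∂volume.restrict I, P x) : ∀ᵐ x ∂volume.restrict J, x + τ ∈ I → P (x + τ) :=
  ae_restrict_of_ae ((measurePreserving_add_right volume τ).quasiMeasurePreserving.ae
    ((ae_restrict_iff' hI).1 h))

theorem memLp_translate (hI : MeasurableSet I) (τ : ℝ) (ψ : SpinorL2 I) :
    MemLp (fun x => I.indicator ψ (x + τ)) 2 (volume.restrict J) :=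
  (((memLp_indicator_iff_restrict hI).2 (Lp.memLp ψ)).comp_measurePreserving
    (measurePreserving_add_right volume τ)).restrict J

/-- The function `x ↦ ψ (x + τ)` on `J`, where `ψ` is extended by zero outside `I`. -/
noncomputable def translateLp (hI : MeasurableSet I) (τ : ℝ) :
    SpinorL2 I →ₗ[ℂ] SpinorL2 J where
  toFun ψ := (memLp_translate hI τ ψ).toLp _
  map_add' ψ φ := by
    refine Lp.ext ?_
    filter_upwards [(memLp_translate (J := J) hI τ (ψ + φ)).coeFn_toLp,
      (memLp_translate (J := J) hI τ ψ).coeFn_toLp, (memLp_translate (J := J) hI τ φ).coeFn_toLp,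
      Lp.coeFn_add ((memLp_translate (J := J) hI τ ψ).toLp _)
        ((memLp_translate (J := J) hI τ φ).toLp _),
      ae_restrict_comp_add hI τ (Lp.coeFn_add ψ φ)] with x h1 h2 h3 h4 h5
    rw [h1, h4, Pi.add_apply, h2, h3]
    by_cases hx : x + τ ∈ I
    · rw [indicator_of_mem hx, indicator_of_mem hx, indicator_of_mem hx, h5 hx, Pi.add_apply]
    · simp [hx]
  map_smul' a ψ := by
    refine Lp.ext ?_
    filter_upwards [(memLp_translate (J := J) hI τ (a • ψ)).coeFn_toLp,
      (memLp_translate (J := J) hI τ ψ).coeFn_toLp,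
      Lp.coeFn_smul a ((memLp_translate (J := J) hI τ ψ).toLp _),
      ae_restrict_comp_add hI τ (Lp.coeFn_smul a ψ)] with x h1 h2 h4 h5
    rw [h1, RingHom.id_apply, h4, Pi.smul_apply, h2]
    by_cases hx : x + τ ∈ I
    · rw [indicator_of_mem hx, indicator_of_mem hx, h5 hx, Pi.smul_apply]
    · simp [hx]

theorem coeFn_translateLp (hI : MeasurableSet I) (τ : ℝ) (ψ : SpinorL2 I) :
    ∀ᵐ x ∂volume.restrict J, translateLp (J := J) hI τ ψ x = I.indicator ψ (x + τ) :=
  (memLp_translate hI τ ψ).coeFn_toLp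

theorem inner_translateLp {I' : Set ℝ} (hI : MeasurableSet I) (hI' : MeasurableSet I') {ℓ : ℝ}
    (hℓ : 0 ≤ ℓ) (τ : ℝ) (ψ : SpinorL2 I) (φ : SpinorL2 I') :
    ⟪translateLp hI (J := Ioo 0 ℓ) τ ψ,
      translateLp hI' (J := Ioo 0 ℓ) τ φ⟫_ℂ =
      ∫ x in Ioo τ (ℓ + τ), ⟪I.indicator ψ x, I'.indicator φ x⟫_ℂ := by
  have h := intervalIntegral.integral_comp_add_right (a := 0) (b := ℓ)
    (fun x => ⟪I.indicator ψ x, I'.indicator φ x⟫_ℂ) τ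
  rw [zero_add, intervalIntegral.integral_of_le hℓ, intervalIntegral.integral_of_le (by linarith),
    integral_Ioc_eq_integral_Ioo, integral_Ioc_eq_integral_Ioo] at h
  rw [L2.inner_def, ← h]
  refine integral_congr_ae ?_
  filter_upwards [coeFn_translateLp hI (J := Ioo 0 ℓ) τ ψ,
    coeFn_translateLp hI' (J := Ioo 0 ℓ) τ φ] with x h1 h2
  rw [h1, h2]

theorem HasSobolevData.comp_sub {a b : ℝ} {f g : ℝ → Spinor} {p q : Spinor}
    (h : HasSobolevData a b f g p q) (τ : ℝ) :
    HasSobolevData (a + τ) (b + τ) (fun x => f (x - τ)) (fun x => g (x - τ)) p q := by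
  have hmp : MeasurePreserving (fun x : ℝ => x - τ) (volume.restrict (Ioo (a + τ) (b + τ)))
      (volume.restrict (Ioo a b)) := by
    have := (measurePreserving_sub_right volume τ).restrict_preimage
      (measurableSet_Ioo (a := a) (b := b))
    simpa using this
  refine ⟨h.memLp.comp_measurePreserving hmp, ?_, ?_⟩
  · filter_upwards [hmp.quasiMeasurePreserving.ae h.ae_eq] with x hx
    rw [hx, intervalIntegral.integral_comp_sub_right, add_sub_cancel_right]
  · rw [intervalIntegral.integral_comp_sub_right, add_sub_cancel_right, add_sub_cancel_right,
      ← h.right]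

theorem HasSobolevData.sum {ι : Type*} (s : Finset ι) {a b : ℝ} (hab : a ≤ b)
    {f g : ι → ℝ → Spinor} {p q : ι → Spinor} (c : ι → ℂ)
    (h : ∀ i ∈ s, HasSobolevData a b (f i) (g i) (p i) (q i)) :
    HasSobolevData a b (fun x => ∑ i ∈ s, c i • f i x) (fun x => ∑ i ∈ s, c i • g i x)
      (∑ i ∈ s, c i • p i) (∑ i ∈ s, c i • q i) := by
  classical
  induction s using Finset.induction_on with
  | empty => exact HasSobolevData.zero a b
  | insert i s hi ih =>
    simp only [Finset.sum_insert hi]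
    exact ((h i (Finset.mem_insert_self i s)).smul (c i)).add hab
      (ih fun j hj => h j (Finset.mem_insert_of_mem hj))

theorem diracExpr_sum {ι : Type*} (s : Finset ι) (c : ℝ) (a : ι → ℂ) (f g : ι → Spinor) :
    diracExpr c (∑ i ∈ s, a i • f i) (∑ i ∈ s, a i • g i) =
      ∑ i ∈ s, a i • diracExpr c (f i) (g i) := by
  classical
  induction s using Finset.induction_on with
  | empty => simp [diracExpr_zero]
  | insert i s hi ih =>
    simp only [Finset.sum_insert hi]
    rw [diracExpr_add, diracExpr_smul, ih]

end Translation

section Pieces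

variable {t : ℕ → ℝ}

theorem measurableSet_reducedInterval (t : ℕ → ℝ) (k : ℕ) :
    MeasurableSet (reducedInterval t k) :=
  (measurableSet_lt measurable_const measurable_id).inter
    (measurableSet_lt measurable_coe_real_ereal measurable_const)

theorem pairwise_disjoint_Ioo (ht : StrictMono t) :
    Pairwise (Function.onFun Disjoint fun j => Ioo (t j) (t (j + 1))) := by
  refine (pairwise_disjoint_on _).2 fun m n hmn => Set.disjoint_left.2 fun x hx hx' => ?_
  exact (hx.2.trans_le (ht.monotone hmn)).not_gt hx'.1

theorem notMem_reducedInterval (ht : StrictMono t) {k n : ℕ} (hn : n < k) {x : ℝ}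
    (hx : x ∈ Ioo (t n) (t (n + 1))) : x ∉ reducedInterval t k := fun h =>
  (h.1.trans hx.2).not_ge (ht.monotone hn)

theorem hasSum_inner_pieces (ht : StrictMono t) {k : ℕ} (ψ φ : SpinorL2 (reducedInterval t k)) :
    HasSum (fun n => ∫ x in Ioo (t n) (t (n + 1)),
      ⟪(reducedInterval t k).indicator ψ x, (reducedInterval t k).indicator φ x⟫_ℂ) ⟪ψ, φ⟫_ℂ := by
  have hind : (fun x => ⟪(reducedInterval t k).indicator ψ x,
      (reducedInterval t k).indicator φ x⟫_ℂ) =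
      (reducedInterval t k).indicator fun x => ⟪ψ x, φ x⟫_ℂ := by
    ext x
    by_cases hx : x ∈ reducedInterval t k <;> simp [hx]
  have hint : Integrable (fun x => ⟪(reducedInterval t k).indicator ψ x,
      (reducedInterval t k).indicator φ x⟫_ℂ) := by
    rw [hind, integrable_indicator_iff (measurableSet_reducedInterval t k)]
    exact L2.integrable_inner ψ φ
  have h := hasSum_integral_iUnion (fun n => measurableSet_Ioo) (pairwise_disjoint_Ioo ht)
    hint.integrableOn
  have hlim : ∫ x in ⋃ n, Ioo (t n) (t (n + 1)), ⟪(reducedInterval t k).indicator ψ x,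
      (reducedInterval t k).indicator φ x⟫_ℂ = ⟪ψ, φ⟫_ℂ := by
    rw [hind, setIntegral_indicator (measurableSet_reducedInterval t k), L2.inner_def]
    refine setIntegral_congr_set ?_
    have hnull : ∀ᵐ x : ℝ, x ∉ range t :=
      measure_eq_zero_iff_ae_notMem.1 ((countable_range t).measure_zero _)
    filter_upwards [hnull] with x hx
    refine propext ⟨fun h => h.2, fun h => ⟨?_, h⟩⟩
    rcases reducedInterval_subset ht k h with h' | h'
    · obtain ⟨j, -, hj⟩ := mem_iUnion₂.1 h'
      exact mem_iUnion.2 ⟨j, hj⟩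
    · exact (hx h').elim
  rwa [hlim] at h

end Pieces

namespace MetricTree

variable {Γ : MetricTree.{u}} {b : ℕ → ℕ} {t : ℕ → ℝ}

/-- The values of a Haar system as a function of the edge. -/
noncomputable def haarCoeff (a : ReducedIndex b → ∀ n, Γ.EdgesAt n → ℂ) (i : ReducedIndex b)
    (e : Γ.Edge) : ℂ :=
  a i (edgeLevel e) ⟨e, rfl⟩

theorem haarCoeff_coe (a : ReducedIndex b → ∀ n, Γ.EdgesAt n → ℂ) (i : ReducedIndex b) {n : ℕ}
    (e : Γ.EdgesAt n) : haarCoeff a i e.1 = a i n e := by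
  obtain ⟨e, rfl⟩ := e
  rfl

/-- The restriction of `ψ` to the part of `(t k, h)` that corresponds to the edge `e`. -/
noncomputable def restrictEdge (t : ℕ → ℝ) (k : ℕ) (e : Γ.Edge) :
    SpinorL2 (reducedInterval t k) →ₗ[ℂ] SpinorL2 (Ioo 0 (Γ.length e)) :=
  translateLp (measurableSet_reducedInterval t k) (t (edgeLevel e))

theorem hasSum_edgesAt {F : Γ.Edge → ℂ} {s : ℂ} (h : HasSum F s) :
    HasSum (fun n => ∑ e : Γ.EdgesAt n, F e.1) s := by
  have h' := (Equiv.sigmaFiberEquiv (edgeLevel (Γ := Γ))).hasSum_iff.2 h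
  exact h'.sigma fun n => hasSum_fintype _

theorem summable_of_summable_edgesAt {F : Γ.Edge → ℝ} (hF : ∀ e, 0 ≤ F e)
    (h : Summable fun n => ∑ e : Γ.EdgesAt n, F e.1) : Summable F := by
  rw [← (Equiv.sigmaFiberEquiv (edgeLevel (Γ := Γ))).summable_iff]
  refine (summable_sigma_of_nonneg fun x => hF _).2 ⟨fun n => Summable.of_finite, ?_⟩
  exact h.congr fun n => (tsum_fintype _).symm




theorem IsRegular.inner_restrictEdge (hΓ : Γ.IsRegular b t) {k k' n : ℕ} (e : Γ.EdgesAt n)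
    (ψ : SpinorL2 (reducedInterval t k)) (φ : SpinorL2 (reducedInterval t k')) :
    ⟪restrictEdge t k e.1 ψ, restrictEdge t k' e.1 φ⟫_ℂ = ∫ x in Ioo (t n) (t (n + 1)),
      ⟪(reducedInterval t k).indicator ψ x, (reducedInterval t k').indicator φ x⟫_ℂ := by
  rw [restrictEdge, restrictEdge, inner_translateLp _ _ (Γ.length_pos e.1).le, hΓ.length_eq, e.2,
    sub_add_cancel]

end MetricTree

/-! ### Decomposition of the Hilbert space of a regular tree -/

namespace MetricTree

variable {Γ : MetricTree.{u}} {b : ℕ → ℕ} {t : ℕ → ℝ}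
  {a : ReducedIndex b → ∀ n, Γ.EdgesAt n → ℂ}

/-- The restrictions of `ψ` and `φ` to the edges of level `n` are translates of the same functions, so
the sum over these edges is governed by the orthonormality of the Haar system. -/
theorem IsRegular.sum_inner_haar (hΓ : Γ.IsRegular b t) (ht : StrictMono t)
    (ha : IsHaarSystem parentEdge a) (i i' : ReducedIndex b)
    (ψ : SpinorL2 (reducedInterval t i.level)) (φ : SpinorL2 (reducedInterval t i'.level)) (n : ℕ) :
    ∑ e : Γ.EdgesAt n, ⟪haarCoeff a i e.1 • restrictEdge t i.level e.1 ψ,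
      haarCoeff a i' e.1 • restrictEdge t i'.level e.1 φ⟫_ℂ =
    open Classical in if i = i' then ∫ x in Ioo (t n) (t (n + 1)),
      ⟪(reducedInterval t i.level).indicator ψ x, (reducedInterval t i'.level).indicator φ x⟫_ℂ
    else 0 := by
  simp only [inner_smul_left, inner_smul_right, hΓ.inner_restrictEdge, haarCoeff_coe, ← mul_assoc]
  rw [← Finset.sum_mul]
  by_cases h : i.level ≤ n
  · by_cases h' : i'.level ≤ n
    · have := ha.orthonormal n i i' h h'
      simp only [mul_comm] at this ⊢
      rw [this]
      split_ifs <;> simp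
    · rw [Finset.sum_eq_zero fun e _ => by rw [ha.zero i' n e (not_le.1 h'), zero_mul], zero_mul,
        if_neg (by rintro rfl; exact h' h)]
  · rw [Finset.sum_eq_zero fun e _ => by rw [ha.zero i n e (not_le.1 h)]; simp, zero_mul]
    split_ifs
    · refine (setIntegral_eq_zero_of_forall_eq_zero fun x hx => ?_).symm
      rw [indicator_of_notMem (notMem_reducedInterval ht (not_le.1 h) hx), inner_zero_left]
    · rfl

theorem IsRegular.memℓp_haar (hΓ : Γ.IsRegular b t) (ht : StrictMono t)
    (ha : IsHaarSystem parentEdge a) (i : ReducedIndex b)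
    (ψ : SpinorL2 (reducedInterval t i.level)) :
    Memℓp (fun e => haarCoeff a i e • restrictEdge t i.level e ψ) 2 := by
  refine memℓp_gen (summable_of_summable_edgesAt (fun e => by positivity) ?_)
  have h := (Complex.hasSum_re (hasSum_inner_pieces ht ψ ψ)).summable
  refine h.congr fun n => ?_
  have := hΓ.sum_inner_haar ht ha i i ψ ψ n
  rw [if_pos rfl] at this
  rw [← this, Complex.re_sum]
  refine Finset.sum_congr rfl fun e _ => ?_
  rw [inner_self_eq_norm_sq_to_K, ENNReal.toReal_ofNat, Real.rpow_ofNat]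
  norm_cast

theorem IsRegular.inner_haar (hΓ : Γ.IsRegular b t) (ht : StrictMono t)
    (ha : IsHaarSystem parentEdge a) (i i' : ReducedIndex b)
    (ψ : SpinorL2 (reducedInterval t i.level)) (φ : SpinorL2 (reducedInterval t i'.level))
    {f f' : Γ.L2} (hf : ∀ e, f e = haarCoeff a i e • restrictEdge t i.level e ψ)
    (hf' : ∀ e, f' e = haarCoeff a i' e • restrictEdge t i'.level e φ) :
    HasSum (fun n => open Classical in if i = i' then ∫ x in Ioo (t n) (t (n + 1)),
      ⟪(reducedInterval t i.level).indicator ψ x, (reducedInterval t i'.level).indicator φ x⟫_ℂ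
    else 0) ⟪f, f'⟫_ℂ := by
  have h := hasSum_edgesAt (lp.hasSum_inner f f')
  simp only [hf, hf', hΓ.sum_inner_haar ht ha] at h
  exact h

/-- The isometry that spreads a function on `(t k, h)` over the tree with the values of the
Haar function `a i` as coefficients. -/
noncomputable def IsRegular.haarIsometry (hΓ : Γ.IsRegular b t) (ht : StrictMono t)
    (ha : IsHaarSystem parentEdge a) (i : ReducedIndex b) :
    SpinorL2 (reducedInterval t i.level) →ₗᵢ[ℂ] Γ.L2 :=
  LinearMap.isometryOfInner
    { toFun := fun ψ => ⟨_, hΓ.memℓp_haar ht ha i ψ⟩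
      map_add' := fun ψ φ => by
        ext e : 2
        change haarCoeff a i e • restrictEdge t i.level e (ψ + φ) =
          haarCoeff a i e • restrictEdge t i.level e ψ + haarCoeff a i e • restrictEdge t i.level e φ
        rw [map_add, smul_add]
      map_smul' := fun k ψ => by
        ext e : 2
        change haarCoeff a i e • restrictEdge t i.level e (k • ψ) =
          k • haarCoeff a i e • restrictEdge t i.level e ψ
        rw [map_smul, smul_comm] }
    fun ψ φ => by
      have h := hΓ.inner_haar ht ha i i ψ φ (f := ⟨_, hΓ.memℓp_haar ht ha i ψ⟩)
        (f' := ⟨_, hΓ.memℓp_haar ht ha i φ⟩) (fun _ => rfl) fun _ => rfl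
      simp only [if_true] at h
      exact h.unique (hasSum_inner_pieces ht ψ φ)

theorem IsRegular.haarIsometry_apply (hΓ : Γ.IsRegular b t) (ht : StrictMono t)
    (ha : IsHaarSystem parentEdge a) (i : ReducedIndex b)
    (ψ : SpinorL2 (reducedInterval t i.level)) (e : Γ.Edge) :
    hΓ.haarIsometry ht ha i ψ e = haarCoeff a i e • restrictEdge t i.level e ψ := rfl

theorem IsRegular.orthogonalFamily_haarIsometry (hΓ : Γ.IsRegular b t) (ht : StrictMono t)
    (ha : IsHaarSystem parentEdge a) :
    OrthogonalFamily ℂ (fun i : ReducedIndex b => SpinorL2 (reducedInterval t i.level))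
      (hΓ.haarIsometry ht ha) := by
  intro i i' hii' ψ φ
  have h := hΓ.inner_haar ht ha i i' ψ φ (hΓ.haarIsometry_apply ht ha i ψ)
    (hΓ.haarIsometry_apply ht ha i' φ)
  simp only [if_neg hii'] at h
  exact h.unique hasSum_zero

theorem IsRegular.mem_Ioo_length_iff (hΓ : Γ.IsRegular b t) (e : Γ.Edge) (x : ℝ) :
    x ∈ Ioo 0 (Γ.length e) ↔ x + t (edgeLevel e) ∈ Ioo (t (edgeLevel e)) (t (edgeLevel e + 1)) := by
  rw [hΓ.length_eq, mem_Ioo, mem_Ioo, lt_add_iff_pos_left, lt_sub_iff_add_lt]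

/-- The restriction to `e'` of the function on `(t k, h)` that is given by `φ` on the piece of the
edge `e` and vanishes elsewhere. For edges of the same level it is `φ`; the translation by `0`
accounts for the two intervals being equal only propositionally. -/
theorem IsRegular.restrictEdge_translateLp (hΓ : Γ.IsRegular b t) (ht : StrictMono t) {k : ℕ}
    (e e' : Γ.Edge) (hk : k ≤ edgeLevel e) (φ : SpinorL2 (Ioo 0 (Γ.length e))) :
    restrictEdge t k e' (translateLp measurableSet_Ioo (-t (edgeLevel e)) φ) =
      if edgeLevel e' = edgeLevel e then translateLp measurableSet_Ioo 0 φ else 0 := by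
  refine Lp.ext ?_
  filter_upwards [coeFn_translateLp (J := Ioo 0 (Γ.length e')) (measurableSet_reducedInterval t k)
      (t (edgeLevel e')) (translateLp measurableSet_Ioo (-t (edgeLevel e)) φ),
    ae_restrict_comp_add (J := Ioo 0 (Γ.length e')) (measurableSet_reducedInterval t k)
      (t (edgeLevel e')) (coeFn_translateLp measurableSet_Ioo (-t (edgeLevel e)) φ),
    coeFn_translateLp (J := Ioo 0 (Γ.length e')) measurableSet_Ioo 0 φ,
    Lp.coeFn_zero Spinor 2 (volume.restrict (Ioo 0 (Γ.length e'))),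
    ae_restrict_mem measurableSet_Ioo] with x h1 h2 h3 h4 hx
  rw [restrictEdge, h1]
  have hx' := (hΓ.mem_Ioo_length_iff e' x).1 hx
  split_ifs with h
  · rw [h3]
    have hmem : x + t (edgeLevel e') ∈ reducedInterval t k :=
      Ioo_subset_reducedInterval ht (h ▸ hk) hx'
    rw [indicator_of_mem hmem, h2 hmem, h, add_neg_cancel_right, add_zero]
  · rw [h4, Pi.zero_apply]
    by_cases hmem : x + t (edgeLevel e') ∈ reducedInterval t k
    · rw [indicator_of_mem hmem, h2 hmem]
      refine indicator_of_notMem (fun hx'' => ?_) _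
      rw [hΓ.mem_Ioo_length_iff, neg_add_cancel_right] at hx''
      exact Set.disjoint_left.1 (pairwise_disjoint_Ioo ht h) hx' hx''
    · rw [indicator_of_notMem hmem]

theorem translateLp_zero_self {I : Set ℝ} (hI : MeasurableSet I) (φ : SpinorL2 I) :
    translateLp hI 0 φ = φ := by
  refine Lp.ext ?_
  filter_upwards [coeFn_translateLp (J := I) hI 0 φ, ae_restrict_mem hI] with x h hx
  rw [h, add_zero, indicator_of_mem hx]

/-- The ranges of the isometries span a dense subspace: by the completeness of the Haar system, a
function that is supported on a single edge is a finite combination of functions in the ranges. -/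
theorem IsRegular.isHilbertSum_haarIsometry (hΓ : Γ.IsRegular b t) (ht : StrictMono t)
    (hb0 : b 0 = 1) (hb : ∀ n, 1 ≤ n → 1 ≤ b n) (ha : IsHaarSystem parentEdge a) :
    IsHilbertSum ℂ (fun i : ReducedIndex b => SpinorL2 (reducedInterval t i.level))
      (hΓ.haarIsometry ht ha) := by
  classical
  refine IsHilbertSum.mk (hΓ.orthogonalFamily_haarIsometry ht ha) fun f _ => ?_
  refine (Submodule.isClosed_topologicalClosure _).mem_of_tendsto
    (lp.hasSum_single (by norm_num) f) (Filter.Eventually.of_forall fun s => ?_)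
  refine Submodule.le_topologicalClosure _ (Submodule.sum_mem _ fun e _ => ?_)
  have key : lp.single 2 e (f e) = ∑ i ∈ ReducedIndex.upTo b (edgeLevel e),
      conj (haarCoeff a i e) • hΓ.haarIsometry ht ha i
        (translateLp measurableSet_Ioo (-t (edgeLevel e)) (f e)) := by
    ext e' : 2
    rw [lp.coeFn_sum, Finset.sum_apply]
    have h1 : ∀ i ∈ ReducedIndex.upTo b (edgeLevel e),
        (conj (haarCoeff a i e) • hΓ.haarIsometry ht ha i
          (translateLp measurableSet_Ioo (-t (edgeLevel e)) (f e))) e' =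
        (haarCoeff a i e' * conj (haarCoeff a i e)) •
          if edgeLevel e' = edgeLevel e then translateLp measurableSet_Ioo 0 (f e) else 0 := by
      intro i hi
      rw [lp.coeFn_smul, Pi.smul_apply, hΓ.haarIsometry_apply,
        hΓ.restrictEdge_translateLp ht e e' (ReducedIndex.mem_upTo.1 hi), smul_smul, mul_comm]
    rw [Finset.sum_congr rfl h1, ← Finset.sum_smul]
    by_cases h : edgeLevel e' = edgeLevel e
    · have hc := ha.complete (hΓ.card_edgesAt_zero hb0) hb0 hb hΓ.card_fiber_parentEdge
        (edgeLevel e) ⟨e', h⟩ ⟨e, rfl⟩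
      simp only [← haarCoeff_coe] at hc
      rw [if_pos h, hc]
      by_cases he : e' = e
      · subst he
        rw [if_pos rfl, one_smul, translateLp_zero_self, lp.single_apply_self]
      · rw [if_neg (by simpa using he), zero_smul, lp.single_apply_ne _ _ _ he]
    · rw [if_neg h, smul_zero, lp.single_apply_ne _ _ _ (by rintro rfl; exact h rfl)]
  rw [key]
  exact Submodule.sum_mem _ fun i _ => Submodule.smul_mem _ _
    (Submodule.mem_iSup_of_mem i ⟨_, rfl⟩)

end MetricTree

/-! ### Haar expansions and boundary values -/

section DiracDerivative

theorem norm_le_of_eq_diracExpr {c : ℝ} (hc : 0 < c) {F f g : Spinor} (h : F = diracExpr c f g) :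
    ‖g‖ ≤ c⁻¹ * ‖F‖ + c * ‖f‖ := by
  have h0 : F 0 = -c * g 1 + c ^ 2 * f 0 := by rw [h, diracExpr_apply_zero]
  have h1 : F 1 = c * g 0 - c ^ 2 * f 1 := by rw [h, diracExpr_apply_one]
  have hcc : (c : ℂ) ≠ 0 := Complex.ofReal_ne_zero.2 hc.ne'
  let J : Spinor → Spinor := fun v => !₂[v 1, -v 0]
  have hJ : ∀ v, ‖J v‖ = ‖v‖ := fun v => by
    simp [J, EuclideanSpace.norm_eq, add_comm]
  have hg : g = (c : ℂ)⁻¹ • J F + (c : ℂ) • !₂[f 1, f 0] := by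
    refine spinor_ext ?_ ?_
    · simp [J, h1]; field_simp; ring
    · simp [J, h0]; field_simp; ring
  have hs : ‖(!₂[f 1, f 0] : Spinor)‖ = ‖f‖ := by
    simp [EuclideanSpace.norm_eq, add_comm]
  rw [hg]
  refine (norm_add_le _ _).trans (le_of_eq ?_)
  rw [norm_smul, norm_smul, hJ, hs, norm_inv, Complex.norm_real, Real.norm_of_nonneg hc.le]

end DiracDerivative

namespace MetricTree

variable {Γ : MetricTree.{u}} {b : ℕ → ℕ} {t : ℕ → ℝ}
  {a : ReducedIndex b → ∀ n, Γ.EdgesAt n → ℂ}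

/-- The function `f` on the tree is the expansion with respect to the Haar system `a` with the
radial coefficients `w`. -/
def IsHaarExpansion (t : ℕ → ℝ) (a : ReducedIndex b → ∀ n, Γ.EdgesAt n → ℂ) (f : Γ.L2)
    (w : ∀ i : ReducedIndex b, SpinorL2 (reducedInterval t i.level)) : Prop :=
  ∀ n (e : Γ.EdgesAt n), ∀ᵐ x ∂volume.restrict (Ioo 0 (Γ.length e.1)),
    f e.1 x = ∑ i ∈ ReducedIndex.upTo b n, a i n e • w i (x + t n)

theorem IsRegular.isHaarExpansion_symm (hΓ : Γ.IsRegular b t) (ht : StrictMono t)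
    (ha : IsHaarSystem parentEdge a)
    (hV : IsHilbertSum ℂ (fun i : ReducedIndex b => SpinorL2 (reducedInterval t i.level))
      (hΓ.haarIsometry ht ha))
    (w : lp (fun i : ReducedIndex b => SpinorL2 (reducedInterval t i.level)) 2) :
    IsHaarExpansion t a (hV.linearIsometryEquiv.symm w) w := by
  rintro n ⟨e, rfl⟩
  have h1 : (hV.linearIsometryEquiv.symm w) e = ∑ i ∈ ReducedIndex.upTo b (edgeLevel e),
      haarCoeff a i e • restrictEdge t i.level e (w i) := by
    have h := (hV.hasSum_linearIsometryEquiv_symm w).mapL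
      (lp.evalCLM ℂ (fun e : Γ.Edge => SpinorL2 (Ioo 0 (Γ.length e))) 2 e)
    refine h.unique (hasSum_sum_of_ne_finset_zero fun i hi => ?_)
    change haarCoeff a i e • restrictEdge t i.level e (w i) = 0
    rw [haarCoeff, ha.zero i _ _ (not_le.1 fun h => hi (ReducedIndex.mem_upTo.2 h)), zero_smul]
  have h2 : ∀ i ∈ ReducedIndex.upTo b (edgeLevel e), ∀ᵐ x ∂volume.restrict (Ioo 0 (Γ.length e)),
      (haarCoeff a i e • restrictEdge t i.level e (w i)) x =
        a i _ ⟨e, rfl⟩ • w i (x + t (edgeLevel e)) := by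
    intro i hi
    filter_upwards [coeFn_translateLp (J := Ioo 0 (Γ.length e))
      (measurableSet_reducedInterval t i.level) (t (edgeLevel e)) (w i),
      Lp.coeFn_smul (haarCoeff a i e) (restrictEdge t i.level e (w i)),
      ae_restrict_mem measurableSet_Ioo] with x h h' hx
    rw [h', Pi.smul_apply, restrictEdge, h, indicator_of_mem, haarCoeff]
    exact Ioo_subset_reducedInterval ht (ReducedIndex.mem_upTo.1 hi)
      ((hΓ.mem_Ioo_length_iff e x).1 hx)
  rw [h1]
  have h3 := (ae_ball_iff (Finset.countable_toSet _)).2 h2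
  filter_upwards [h3, Lp.coeFn_finsetSum (ReducedIndex.upTo b (edgeLevel e))
    fun i => haarCoeff a i e • restrictEdge t i.level e (w i)] with x h4 h5
  rw [h5, Finset.sum_apply]
  exact Finset.sum_congr rfl fun i hi => h4 i hi

theorem IsRegular.length_add (hΓ : Γ.IsRegular b t) {n : ℕ} (e : Γ.EdgesAt n) :
    Γ.length e.1 + t n = t (n + 1) := by
  rw [hΓ.length_eq, e.2]; ring

/-- Inversion of the expansion by the orthonormality of the Haar system. -/
theorem IsHaarExpansion.ae_eq {f : Γ.L2}
    {w : ∀ i : ReducedIndex b, SpinorL2 (reducedInterval t i.level)}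
    (h : IsHaarExpansion t a f w) (hΓ : Γ.IsRegular b t) (ha : IsHaarSystem parentEdge a)
    (i : ReducedIndex b) {n : ℕ} (hn : i.level ≤ n) :
    ∀ᵐ x ∂volume.restrict (Ioo (t n) (t (n + 1))),
      w i x = ∑ e : Γ.EdgesAt n, conj (a i n e) • f e.1 (x - t n) := by
  have h1 : ∀ e : Γ.EdgesAt n, ∀ᵐ x ∂volume.restrict (Ioo (t n) (t (n + 1))),
      f e.1 (x - t n) = ∑ i ∈ ReducedIndex.upTo b n, a i n e • w i x := by
    intro e
    have := ae_restrict_comp_add (J := Ioo (t n) (t (n + 1))) measurableSet_Ioo (-t n) (h n e)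
    filter_upwards [this, ae_restrict_mem measurableSet_Ioo] with x hx hm
    rw [sub_eq_add_neg, hx ⟨by linarith [hm.1], by
      have := hΓ.length_add e; linarith [hm.2]⟩, neg_add_cancel_right]
  filter_upwards [ae_all_iff.2 h1] with x hx
  simp only [hx, Finset.smul_sum, smul_smul]
  rw [Finset.sum_comm]
  simp only [← Finset.sum_smul]
  rw [Finset.sum_eq_single i]
  · rw [ha.orthonormal n i i hn hn, if_pos rfl, one_smul]
  · intro i' hi' hne
    rw [ha.orthonormal n i i' hn (ReducedIndex.mem_upTo.1 hi'), if_neg hne.symm, zero_smul]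
  · exact fun h => (h (ReducedIndex.mem_upTo.2 hn)).elim

theorem mem_graph_dirac {c : ℝ} {f F : Γ.L2} : (f, F) ∈ (Γ.dirac c).graph ↔
    (f, F) ∈ Γ.diracGraph c := by
  rw [dirac, Submodule.toLinearPMap_graph_eq _ (Γ.diracGraph_functional c)]

/-- The Haar coefficients of boundary values that satisfy the vertex conditions satisfy the
matching conditions. -/
theorem VertexConditions.reducedConditions (hΓ : Γ.IsRegular b t) (hb : ∀ n, 1 ≤ n → 1 ≤ b n)
    (ha : IsHaarSystem parentEdge a) {p q : Γ.Edge → Spinor} (h : Γ.VertexConditions p q)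
    (i : ReducedIndex b) :
    ReducedConditions b i.level (fun n => ∑ e : Γ.EdgesAt n, conj (a i n e) • p e.1)
      (fun n => ∑ e : Γ.EdgesAt (n - 1), conj (a i (n - 1) e) • q e.1) := by
  have hupper : ∀ n (e : Γ.EdgesAt (n + 1)), p e.1 0 = q (parentEdge n e).1 0 := fun n e =>
    h.upper _ _ (parentEdge_eq_iff.1 rfl)
  have hne : ∀ n, (√(b (n + 1)) : ℂ) ≠ 0 := fun n => Complex.ofReal_ne_zero.2
    (zero_lt_one.trans_le (one_le_sqrt_natCast (hb (n + 1) (by omega)))).ne'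
  refine ⟨?_, fun j hj => ?_, fun j hj => ?_⟩
  · simp only [WithLp.ofLp_sum, Finset.sum_apply, PiLp.smul_apply, smul_eq_mul]
    rcases hk : i.level with - | n
    · exact Finset.sum_eq_zero fun e _ => by
        rw [h.root _ (edgeLevel_eq_zero_iff.1 e.2), mul_zero]
    · have := ha.sum_siblings i n hk fun e => conj (q e.1 0)
      rw [← map_zero (starRingEnd ℂ), ← this, map_sum]
      refine Finset.sum_congr rfl fun e _ => ?_
      rw [hupper, map_mul, Complex.conj_conj, mul_comm]
  · obtain ⟨n, rfl⟩ : ∃ n, j = n + 1 := ⟨j - 1, by omega⟩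
    have hn : i.level ≤ n := Nat.lt_succ_iff.1 hj
    simp only [WithLp.ofLp_sum, Finset.sum_apply, PiLp.smul_apply, smul_eq_mul]
    rw [Finset.sum_congr rfl fun e _ => by
      rw [hupper, ha.propagate i n e hn, map_mul, map_inv₀, Complex.conj_ofReal, mul_assoc],
      ← Finset.mul_sum, sum_comp_eq_of_card_fiber (hΓ.card_fiber_parentEdge n)
        (fun e => conj (a i n e) * q e.1 0), ← ofReal_sqrt_mul_self_natCast]
    have := hne n
    field_simp
    rfl
  · obtain ⟨n, rfl⟩ : ∃ n, j = n + 1 := ⟨j - 1, by omega⟩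
    have hn : i.level ≤ n := Nat.lt_succ_iff.1 hj
    simp only [WithLp.ofLp_sum, Finset.sum_apply, PiLp.smul_apply, smul_eq_mul]
    rw [Finset.mul_sum, ← Finset.sum_fiberwise_of_maps_to
      (fun x _ => Finset.mem_univ (parentEdge n x))]
    refine Finset.sum_congr rfl fun e _ => ?_
    rw [← h.lower, sum_emanating, Finset.mul_sum, Finset.mul_sum]
    refine Finset.sum_congr rfl fun e' he' => ?_
    rw [ha.propagate i n e' hn, (Finset.mem_filter.1 he').2, map_mul, map_inv₀,
      Complex.conj_ofReal, mul_assoc]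
    rfl

/-- Boundary values with Haar coefficients that satisfy the matching conditions satisfy the vertex
conditions. -/
theorem vertexConditions_of_reducedConditions (hΓ : Γ.IsRegular b t)
    (hb : ∀ n, 1 ≤ n → 1 ≤ b n) (ha : IsHaarSystem parentEdge a)
    {p q : ReducedIndex b → ℕ → Spinor} (h : ∀ i, ReducedConditions b i.level (p i) (q i)) :
    Γ.VertexConditions
      (fun e => ∑ i ∈ ReducedIndex.upTo b (edgeLevel e), haarCoeff a i e • p i (edgeLevel e))
      (fun e => ∑ i ∈ ReducedIndex.upTo b (edgeLevel e),
        haarCoeff a i e • q i (edgeLevel e + 1)) := by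
  have hne : ∀ n, (√(b (n + 1)) : ℂ) ≠ 0 := fun n => Complex.ofReal_ne_zero.2
    (zero_lt_one.trans_le (one_le_sqrt_natCast (hb (n + 1) (by omega)))).ne'
  have hlevel : ∀ n, ∀ i ∈ ReducedIndex.upTo b (n + 1), i ∉ ReducedIndex.upTo b n →
      i.level = n + 1 := fun n i hi hi' => by
    rw [ReducedIndex.mem_upTo] at hi hi'
    omega
  refine ⟨fun e he => ?_, fun e e' he' => ?_, fun e => ?_⟩
  · simp only [WithLp.ofLp_sum, Finset.sum_apply, PiLp.smul_apply, smul_eq_mul]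
    refine Finset.sum_eq_zero fun i hi => ?_
    rw [ReducedIndex.mem_upTo, edgeLevel_eq_zero_iff.2 he, Nat.le_zero] at hi
    have := (h i).boundary
    rw [hi] at this
    rw [edgeLevel_eq_zero_iff.2 he, this, mul_zero]
  · simp only [WithLp.ofLp_sum, Finset.sum_apply, PiLp.smul_apply, smul_eq_mul]
    obtain ⟨n, hn⟩ : ∃ n, edgeLevel e = n := ⟨_, rfl⟩
    have hn' : edgeLevel e' = n + 1 := by rw [edgeLevel_of_mem_emanating he', hn]
    rw [hn, hn', ← Finset.sum_subset (ReducedIndex.upTo_subset b n) fun i hi hi' => by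
      have := (h i).boundary
      rw [hlevel n i hi hi'] at this
      rw [this, mul_zero]]
    refine Finset.sum_congr rfl fun i hi => ?_
    have hi' := ReducedIndex.mem_upTo.1 hi
    have hpar : parentEdge n ⟨e', hn'⟩ = (⟨e, hn⟩ : Γ.EdgesAt n) := parentEdge_eq_iff.2 he'
    rw [show haarCoeff a i e' = a i (n + 1) ⟨e', hn'⟩ from haarCoeff_coe a i ⟨e', hn'⟩,
      show haarCoeff a i e = a i n ⟨e, hn⟩ from haarCoeff_coe a i ⟨e, hn⟩,
      ha.propagate i n _ hi', hpar, (h i).upper _ (Nat.lt_succ_of_le hi')]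
    have := hne n
    field_simp
  · obtain ⟨n, hn⟩ : ∃ n, edgeLevel e = n := ⟨_, rfl⟩
    have hsum : ∀ i ∈ ReducedIndex.upTo b (n + 1),
        (∑ e' ∈ Γ.emanating e.1, haarCoeff a i e') =
          if i ∈ ReducedIndex.upTo b n then (√(b (n + 1)) : ℂ) * haarCoeff a i e else 0 := by
      intro i hi
      rw [sum_emanating (⟨e, hn⟩ : Γ.EdgesAt n)]
      simp only [haarCoeff_coe]
      rw [show haarCoeff a i e = a i n ⟨e, hn⟩ from haarCoeff_coe a i ⟨e, hn⟩]
      split_ifs with hi'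
      · rw [Finset.sum_congr rfl fun e' he' => by
          rw [ha.propagate i n e' (ReducedIndex.mem_upTo.1 hi'), (Finset.mem_filter.1 he').2],
          Finset.sum_const, hΓ.card_fiber_parentEdge, nsmul_eq_mul, ← ofReal_sqrt_mul_self_natCast]
        have := hne n
        field_simp
      · rw [← ha.sum_siblings i n (hlevel n i hi hi')
          fun e' => if e' = (⟨e, hn⟩ : Γ.EdgesAt n) then 1 else 0]
        simp [Finset.sum_filter]
    simp only [WithLp.ofLp_sum, Finset.sum_apply, PiLp.smul_apply, smul_eq_mul]
    rw [Finset.sum_congr rfl fun e' he' => by rw [edgeLevel_of_mem_emanating he', hn],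
      Finset.sum_comm, hn]
    simp only [← Finset.sum_mul]
    rw [Finset.sum_congr rfl fun i hi => by rw [hsum i hi],
      ← Finset.sum_subset (ReducedIndex.upTo_subset b n) fun i hi hi' => by
        rw [if_neg hi', zero_mul]]
    refine Finset.sum_congr rfl fun i hi => ?_
    rw [if_pos hi, (h i).lower _ (Nat.lt_succ_of_le (ReducedIndex.mem_upTo.1 hi))]
    have := hne n
    field_simp

end MetricTree

/-! ### Decomposition of the Dirac operator -/

namespace MetricTree

variable {Γ : MetricTree.{u}} {b : ℕ → ℕ} {t : ℕ → ℝ}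
  {a : ReducedIndex b → ∀ n, Γ.EdgesAt n → ℂ}

theorem IsRegular.mem_reducedGraph_of_mem_diracGraph (hΓ : Γ.IsRegular b t) (ht : StrictMono t)
    (hb : ∀ n, 1 ≤ n → 1 ≤ b n) (ha : IsHaarSystem parentEdge a) {c : ℝ} {f g F : Γ.L2}
    {w G W : ∀ i : ReducedIndex b, SpinorL2 (reducedInterval t i.level)}
    (hf : IsHaarExpansion t a f w) (hg : IsHaarExpansion t a g G) (hF : IsHaarExpansion t a F W)
    {p q : Γ.Edge → Spinor}
    (h1 : ∀ e, HasSobolevData 0 (Γ.length e) (f e) (g e) (p e) (q e))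
    (h2 : Γ.VertexConditions p q)
    (h3 : ∀ e, ∀ᵐ x ∂volume.restrict (Ioo 0 (Γ.length e)), F e x = diracExpr c (f e x) (g e x))
    (i : ReducedIndex b) : (w i, W i) ∈ reducedGraph b t ht c i.level := by
  refine ⟨G i, _, _, fun j hj => ?_, h2.reducedConditions hΓ hb ha i, ?_⟩
  · have hs : HasSobolevData (t j) (t (j + 1)) _ _ _ _ :=
      HasSobolevData.sum Finset.univ (ht (Nat.lt_succ_self j)).le
        (f := fun (e : Γ.EdgesAt j) x => f e.1 (x - t j))
        (g := fun (e : Γ.EdgesAt j) x => g e.1 (x - t j)) (p := fun e => p e.1)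
        (q := fun e => q e.1) (fun e => conj (a i j e)) fun e _ => by
          have := (h1 e.1).comp_sub (t j)
          rwa [zero_add, hΓ.length_add e] at this
    refine hs.congr (ht (Nat.lt_succ_self j)).le ?_ ?_
    · filter_upwards [hf.ae_eq hΓ ha i hj] with x hx using hx.symm
    · filter_upwards [hg.ae_eq hΓ ha i hj] with x hx using hx.symm
  · refine ae_reducedInterval ht fun j hj => ?_
    have h3' : ∀ e : Γ.EdgesAt j, ∀ᵐ x ∂volume.restrict (Ioo (t j) (t (j + 1))),
        F e.1 (x - t j) = diracExpr c (f e.1 (x - t j)) (g e.1 (x - t j)) := fun e => by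
      filter_upwards [ae_restrict_comp_add (J := Ioo (t j) (t (j + 1))) measurableSet_Ioo (-t j)
        (h3 e.1), ae_restrict_mem measurableSet_Ioo] with x hx hm
      exact hx ⟨by linarith [hm.1], by have := hΓ.length_add e; linarith [hm.2]⟩
    filter_upwards [hf.ae_eq hΓ ha i hj, hg.ae_eq hΓ ha i hj, hF.ae_eq hΓ ha i hj,
      ae_all_iff.2 h3'] with x e1 e2 e3 e4
    rw [e1, e2, e3, diracExpr_sum]
    exact Finset.sum_congr rfl fun e _ => by rw [e4]

theorem IsRegular.mem_diracGraph_of_mem_reducedGraph (hΓ : Γ.IsRegular b t) (ht : StrictMono t)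
    (hb : ∀ n, 1 ≤ n → 1 ≤ b n) (ha : IsHaarSystem parentEdge a) {c : ℝ} {f g F : Γ.L2}
    {w G W : ∀ i : ReducedIndex b, SpinorL2 (reducedInterval t i.level)}
    (hf : IsHaarExpansion t a f w) (hg : IsHaarExpansion t a g G) (hF : IsHaarExpansion t a F W)
    {p q : ReducedIndex b → ℕ → Spinor}
    (h1 : ∀ i j, i.level ≤ j → HasSobolevData (t j) (t (j + 1)) (w i) (G i) (p i j) (q i (j + 1)))
    (h2 : ∀ i, ReducedConditions b i.level (p i) (q i))
    (h3 : ∀ i, ∀ᵐ x ∂volume.restrict (reducedInterval t i.level),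
      W i x = diracExpr c (w i x) (G i x)) : (f, F) ∈ Γ.diracGraph c := by
  refine ⟨g, _, _, ?_, vertexConditions_of_reducedConditions hΓ hb ha h2, ?_⟩
  · intro e
    obtain ⟨n, hn⟩ : ∃ n, edgeLevel e = n := ⟨_, rfl⟩
    have hco : ∀ i, haarCoeff a i e = a i n ⟨e, hn⟩ := fun i => haarCoeff_coe a i ⟨e, hn⟩
    have hs : HasSobolevData 0 (Γ.length e) _ _ _ _ :=
      HasSobolevData.sum (ReducedIndex.upTo b n) (Γ.length_pos e).le
        (f := fun i x => w i (x + t n)) (g := fun i x => G i (x + t n)) (p := fun i => p i n)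
        (q := fun i => q i (n + 1)) (fun i => haarCoeff a i e) fun i hi => by
          have := (h1 i n (ReducedIndex.mem_upTo.1 hi)).comp_sub (-t n)
          rw [← hΓ.length_add ⟨e, hn⟩] at this
          simpa using this
    rw [hn]
    refine hs.congr (Γ.length_pos e).le ?_ ?_
    · filter_upwards [hf n ⟨e, hn⟩] with x hx
      rw [hx]
      exact Finset.sum_congr rfl fun i _ => by rw [hco]
    · filter_upwards [hg n ⟨e, hn⟩] with x hx
      rw [hx]
      exact Finset.sum_congr rfl fun i _ => by rw [hco]
  · intro e
    obtain ⟨n, hn⟩ : ∃ n, edgeLevel e = n := ⟨_, rfl⟩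
    have h3' : ∀ i ∈ ReducedIndex.upTo b n, ∀ᵐ x ∂volume.restrict (Ioo 0 (Γ.length e)),
        W i (x + t n) = diracExpr c (w i (x + t n)) (G i (x + t n)) := by
      intro i hi
      filter_upwards [ae_restrict_comp_add (J := Ioo 0 (Γ.length e))
        (measurableSet_reducedInterval t i.level) (t n) (h3 i),
        ae_restrict_mem measurableSet_Ioo] with x hx hm
      refine hx (Ioo_subset_reducedInterval ht (ReducedIndex.mem_upTo.1 hi) ?_)
      rw [← hn]
      exact (hΓ.mem_Ioo_length_iff e x).1 hm
    filter_upwards [hf n ⟨e, hn⟩, hg n ⟨e, hn⟩, hF n ⟨e, hn⟩,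
      (ae_ball_iff (Finset.countable_toSet _)).2 h3'] with x e1 e2 e3 e4
    change F e x = diracExpr c (f e x) (g e x)
    rw [e1, e2, e3, diracExpr_sum]
    exact Finset.sum_congr rfl fun i hi => by rw [e4 i hi]

/-- The derivatives of the components are square summable since they are controlled by the
components of `f` and of `D f`. -/
theorem memℓp_of_diracExpr {c : ℝ} (hc : 0 < c)
    (w W : lp (fun i : ReducedIndex b => SpinorL2 (reducedInterval t i.level)) 2)
    {G : ∀ i : ReducedIndex b, SpinorL2 (reducedInterval t i.level)}
    (h : ∀ i, ∀ᵐ x ∂volume.restrict (reducedInterval t i.level),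
      W i x = diracExpr c (w i x) (G i x)) : Memℓp G 2 := by
  have hle : ∀ i, ‖G i‖ ≤ c⁻¹ * ‖W i‖ + c * ‖w i‖ := by
    intro i
    let N : SpinorL2 (reducedInterval t i.level) →
        Lp ℝ 2 (volume.restrict (reducedInterval t i.level)) := fun f => (Lp.memLp f).norm.toLp _
    have hN : ∀ f, ‖N f‖ = ‖f‖ := fun f => by
      rw [Lp.norm_toLp, eLpNorm_norm, Lp.norm_def]
    have hN' : ∀ f, ∀ᵐ x ∂volume.restrict (reducedInterval t i.level), N f x = ‖f x‖ := fun f =>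
      (Lp.memLp f).norm.coeFn_toLp
    calc ‖G i‖ ≤ ‖c⁻¹ • N (W i) + c • N (w i)‖ := by
          refine Lp.norm_le_norm_of_ae_le ?_
          filter_upwards [h i, hN' (W i), hN' (w i), Lp.coeFn_add (c⁻¹ • N (W i)) (c • N (w i)),
            Lp.coeFn_smul c⁻¹ (N (W i)), Lp.coeFn_smul c (N (w i))] with x e1 e2 e3 e4 e5 e6
          rw [e4, Pi.add_apply, e5, e6, Pi.smul_apply, Pi.smul_apply, e2, e3, smul_eq_mul,
            smul_eq_mul]
          exact (norm_le_of_eq_diracExpr hc e1).trans (Real.le_norm_self _)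
      _ ≤ c⁻¹ * ‖W i‖ + c * ‖w i‖ := by
          refine (norm_add_le _ _).trans (le_of_eq ?_)
          rw [norm_smul, norm_smul, hN, hN, Real.norm_of_nonneg hc.le,
            Real.norm_of_nonneg (inv_nonneg.2 hc.le)]
  have h1 : Memℓp (fun i => c⁻¹ * ‖W i‖ + c * ‖w i‖) 2 :=
    (memℓp_two_of_norm_le W c⁻¹ fun i => by
      rw [norm_mul, norm_norm, Real.norm_of_nonneg (inv_nonneg.2 hc.le)]).add
    (memℓp_two_of_norm_le w c fun i => by
      rw [norm_mul, norm_norm, Real.norm_of_nonneg hc.le])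
  refine memℓp_two_of_norm_le (⟨_, h1⟩ : lp (fun _ : ReducedIndex b => ℝ) 2) 1 fun i => ?_
  rw [one_mul]
  exact (hle i).trans (Real.le_norm_self _)

/-- The unitary operator maps the graph of `D_c` onto the graph of the orthogonal sum of the `M_k`. -/
theorem IsRegular.mem_graph_dirac_iff (hΓ : Γ.IsRegular b t) (ht : StrictMono t)
    (hb : ∀ n, 1 ≤ n → 1 ≤ b n) (ha : IsHaarSystem parentEdge a)
    (hV : IsHilbertSum ℂ (fun i : ReducedIndex b => SpinorL2 (reducedInterval t i.level))
      (hΓ.haarIsometry ht ha)) {c : ℝ} (hc : 0 < c) (f F : Γ.L2) :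
    (f, F) ∈ (Γ.dirac c).graph ↔ ∀ i, (hV.linearIsometryEquiv f i, hV.linearIsometryEquiv F i) ∈
      (reducedDirac b t ht c i.level).graph := by
  have hexp : ∀ f : Γ.L2, IsHaarExpansion t a f (hV.linearIsometryEquiv f) := fun f => by
    have := hΓ.isHaarExpansion_symm ht ha hV (hV.linearIsometryEquiv f)
    rwa [LinearIsometryEquiv.symm_apply_apply] at this
  rw [mem_graph_dirac]
  simp only [mem_graph_reducedDirac]
  constructor
  · rintro ⟨g, p, q, h1, h2, h3⟩ i
    exact hΓ.mem_reducedGraph_of_mem_diracGraph ht hb ha (hexp f) (hexp g) (hexp F) h1 h2 h3 i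
  · intro h
    choose G p q h1 h2 h3 using h
    have hG : Memℓp G 2 := memℓp_of_diracExpr hc _ _ h3
    exact hΓ.mem_diracGraph_of_mem_reducedGraph ht hb ha (hexp f)
      (hΓ.isHaarExpansion_symm ht ha hV ⟨G, hG⟩) (hexp F) h1 h2 h3

end MetricTree

theorem theorem3 (Γ : MetricTree.{u}) (b : ℕ → ℕ) (t : ℕ → ℝ) (ht : StrictMono t)
    (hΓ : Γ.IsRegular b t) (hb0 : b 0 = 1) (hb : ∀ n, 1 ≤ n → 2 ≤ b n)
    (hlen : ¬ Summable Γ.length) (c : ℝ) (hc : 0 < c) :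
    (IsSelfAdjoint (Γ.dirac c) ∧ ∃! K, IsPositiveSpectralSubspace (Γ.dirac c) K) ∧
    (∀ k, IsSelfAdjoint (reducedDirac b t ht c k) ∧
      ∃! K, IsPositiveSpectralSubspace (reducedDirac b t ht c k) K) ∧
    UnitarilyEquivalent (positivePart (Γ.dirac c))
      (orthogonalSum fun i : ReducedIndex b => positivePart (reducedDirac b t ht c i.level)) ∧
    UnitarilyEquivalent (positivePartExtended (Γ.dirac c))
      (orthogonalSum fun i : ReducedIndex b =>
        positivePartExtended (reducedDirac b t ht c i.level)) := by
  have hb1 : ∀ n, 1 ≤ n → 1 ≤ b n := fun n hn => one_le_two.trans (hb n hn)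
  choose S hS hSc using exists_hasSelfAdjointInverse_reducedDirac ht hb1
    (hΓ.not_summable hb0 hlen) hc
  obtain ⟨a, ha⟩ := exists_isHaarSystem (hΓ.card_edgesAt_zero hb0) hb0 hb1 hΓ.card_fiber_parentEdge
  have hV := hΓ.isHilbertSum_haarIsometry ht hb0 hb1 ha
  have hU := hΓ.mem_graph_dirac_iff ht hb1 ha hV hc
  obtain ⟨T, hT⟩ := exists_hasSelfAdjointInverse_of_orthogonalSum hV.linearIsometryEquiv hU
    (fun i => hS i.level) (c ^ 2)⁻¹ fun i => hSc i.level
  have hA := fun i : ReducedIndex b => (hS i.level).existsUnique_isPositiveSpectralSubspace.exists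
  have hD := hT.existsUnique_isPositiveSpectralSubspace
  exact ⟨⟨hT.isSelfAdjoint_operator, hD⟩, fun k => ⟨(hS k).isSelfAdjoint_operator,
    (hS k).existsUnique_isPositiveSpectralSubspace⟩,
    unitarilyEquivalent_positivePart_of_orthogonalSum _ hU hA hD,
    unitarilyEquivalent_positivePartExtended_of_orthogonalSum _ hU hA hD⟩
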